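/- Let $p$ be a prime, let $F$ be a field of characteristic $p$, and let $K/F$ be a finite Galois extension whose group $G=\mathrm{Gal}(K/F)=\langle\sigma_1\rangle\times\cdots\times\langle\sigma_r\rangle$ is a noncyclic finite abelian $p$-group; put $n_i=|\sigma_i|$. Let $\Delta=(K/F,z_\sigma,u,b)$ be an abelian crossed product, that is, an $F$-algebra containing $K$ with elements $z_1,\dots,z_r$ such that $$\Delta=\bigoplus_{0\le m_i<n_i}K\,z^{\overline m},\qquad z_ik=\sigma_i(k)z_i\ (k\in K),\qquad z_iz_j=u_{ij}z_jz_i,\qquad z_i^{n_i}=b_i,$$ where $u_{ij},b_i\in K^*$ and $z^{\overline m}=z_1^{m_1}\cdots z_r^{m_r}$. Write $\sigma^{\overline m}=\sigma_1^{m_1}\cdots\sigma_r^{m_r}$ and $u_{i,\overline m}=z_iz^{\overline m}z_i^{-1}(z^{\overline m})^{-1}\in K^*$. Assume that $u$ is not strongly degenerate: there are no $\sigma^{\overline m}\in G$ of prime order and $l,k_1,\dots,k_r\in K^*$ such that $u_{i,\overline m}=\sigma^{\overline m}(k_i)k_i^{-1}\sigma_i(l)l^{-1}$ for all $1\le i\le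 r$. Let $F''=F((x_1))\cdots((x_r))$ and $K''=K((x_1))\cdots((x_r))$ be the fields of iterated Laurent series, with $G$ acting on the coefficients of $K''$, and let $\mathbb A_\Delta=(K''/F'',z_\sigma,u,bx)$ be the power series generic abelian crossed product, i.e. the $F''$-algebra generated by $K''$ and elements $z_1,\dots,z_r$ with $z_ik=\sigma_i(k)z_i$ for $k\in K''$, $z_iz_j=u_{ij}z_jz_i$ and $z_i^{n_i}=b_ix_i$. Let $E''/F''$ be any finite field extension of degree prime to $p$. If $L$ is a subfield of $\mathbb A_\Delta\otimes_{F''}E''$ that contains $E''$ and is Galois over $E''$, then $\mathrm{Gal}(L/E'')$ is a homomorphic image of $G$. -/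

import Mathlib

open scoped TensorProduct

universe u v w

/-- The ordered monomial `a ^ m = a₁ ^ m₁ * a₂ ^ m₂ * ⋯ * aᵣ ^ mᵣ` in a (noncommutative) monoid. -/
def orderedMonomial {M : Type*} [Monoid M] {r : ℕ} (a : Fin r → M) (m : Fin r → ℕ) : M :=
  (List.ofFn fun i => a i ^ m i).prod

/-- An abelian crossed product `Δ = (K/F, z_σ, u, b)`: an `F`-algebra `Δ` containing `K`, together
with elements `z₁, …, zᵣ`, such that

* `Gal(K/F) = ⟨σ₁⟩ × ⋯ × ⟨σᵣ⟩` is abelian: the `σᵢ` commute and every automorphism is `σ ^ m` for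
  exactly one `m` with `0 ≤ mᵢ < nᵢ`, where `nᵢ` is the order of `σᵢ`;
* `zᵢ k = σᵢ(k) zᵢ`, `zᵢ zⱼ = uᵢⱼ zⱼ zᵢ` and `zᵢ ^ nᵢ = bᵢ` with `uᵢⱼ` and `bᵢ` in `Kˣ`;
* `Δ = ⨁ K z ^ m`, the sum being over all `m` with `0 ≤ mᵢ < nᵢ`. -/
structure AbelianCrossedProduct (F : Type u) (K : Type v) (Δ : Type w) [Field F] [Field K]
    [Algebra F K] [Ring Δ] [Algebra F Δ] (r : ℕ) where
  σ : Fin r → (K ≃ₐ[F] K)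
  u : Fin r → Fin r → Kˣ
  b : Fin r → Kˣ
  /-- the embedding of `K` in `Δ` -/
  ι : K →ₐ[F] Δ
  z : Fin r → Δ
  σ_commute : ∀ i j, Commute (σ i) (σ j)
  σ_bijective : Function.Bijective
    fun m : (i : Fin r) → Fin (orderOf (σ i)) => orderedMonomial σ fun i => (m i : ℕ)
  z_mul_ι : ∀ (i : Fin r) (k : K), z i * ι k = ι (σ i k) * z i
  z_mul_z : ∀ i j : Fin r, z i * z j = ι (u i j) * (z j * z i)
  z_pow : ∀ i : Fin r, z i ^ orderOf (σ i) = ι (b i)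
  basis : ∀ a : Δ, ∃! c : ((i : Fin r) → Fin (orderOf (σ i))) → K,
    a = ∑ m, ι (c m) * orderedMonomial z fun i => (m i : ℕ)

namespace AbelianCrossedProduct

variable {F : Type u} {K : Type v} {Δ : Type w} [Field F] [Field K] [Algebra F K] [Ring Δ]
  [Algebra F Δ] {r : ℕ}

/-- `c = u_{m,n}`, the element of `Kˣ` with `c = z ^ m * z ^ n * (z ^ m)⁻¹ * (z ^ n)⁻¹`. All `zᵢ`
are invertible in `Δ`, and the equation is written here without the inverses. -/
def IsCommutator (D : AbelianCrossedProduct F K Δ r) (m n : Fin r → ℕ) (c : Kˣ) : Prop :=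
  orderedMonomial D.z m * orderedMonomial D.z n =
    D.ι c * (orderedMonomial D.z n * orderedMonomial D.z m)

/-- The matrix `u` is strongly degenerate: for some `σ ^ m` of prime order there are
`l, k₁, …, kᵣ` in `Kˣ` such that `u_{i,m} = σ ^ m (kᵢ) kᵢ⁻¹ σᵢ(l) l⁻¹` for all `i`, where `i`
stands for the standard basis vector `eᵢ`. -/
def StronglyDegenerate (D : AbelianCrossedProduct F K Δ r) : Prop :=
  ∃ m : Fin r → ℕ, (orderOf (orderedMonomial D.σ m)).Prime ∧
    ∃ (l : Kˣ) (k : Fin r → Kˣ), ∀ i : Fin r,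
      D.IsCommutator (Pi.single i 1) m
        (Units.mapEquiv (orderedMonomial D.σ m).toMulEquiv (k i) * (k i)⁻¹ *
          (Units.mapEquiv (D.σ i).toMulEquiv l * l⁻¹))

end AbelianCrossedProduct

/-- The relations of the algebra `(K/F, z_σ, u, b)`: the generators are the elements of `K`, whose
addition, multiplication and `F`-algebra structure are kept, and `z₁, …, zᵣ`. -/
inductive CrossedRel (F : Type u) {K : Type v} [Field F] [Field K] [Algebra F K] {r : ℕ}
    (σ : Fin r → (K ≃ₐ[F] K)) (u : Fin r → Fin r → K) (b : Fin r → K) :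
    FreeAlgebra F (K ⊕ Fin r) → FreeAlgebra F (K ⊕ Fin r) → Prop
  | add (x y : K) : CrossedRel F σ u b (FreeAlgebra.ι F (Sum.inl (x + y)))
      (FreeAlgebra.ι F (Sum.inl x) + FreeAlgebra.ι F (Sum.inl y))
  | mul (x y : K) : CrossedRel F σ u b (FreeAlgebra.ι F (Sum.inl (x * y)))
      (FreeAlgebra.ι F (Sum.inl x) * FreeAlgebra.ι F (Sum.inl y))
  | scalar (c : F) : CrossedRel F σ u b (FreeAlgebra.ι F (Sum.inl (algebraMap F K c)))
      (algebraMap F (FreeAlgebra F (K ⊕ Fin r)) c)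
  | z_mul (i : Fin r) (x : K) : CrossedRel F σ u b
      (FreeAlgebra.ι F (Sum.inr i) * FreeAlgebra.ι F (Sum.inl x))
      (FreeAlgebra.ι F (Sum.inl (σ i x)) * FreeAlgebra.ι F (Sum.inr i))
  | z_mul_z (i j : Fin r) : CrossedRel F σ u b
      (FreeAlgebra.ι F (Sum.inr i) * FreeAlgebra.ι F (Sum.inr j))
      (FreeAlgebra.ι F (Sum.inl (u i j)) *
        (FreeAlgebra.ι F (Sum.inr j) * FreeAlgebra.ι F (Sum.inr i)))
  | z_pow (i : Fin r) : CrossedRel F σ u b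
      (FreeAlgebra.ι F (Sum.inr i) ^ orderOf (σ i)) (FreeAlgebra.ι F (Sum.inl (b i)))

/-- The `F`-algebra `(K/F, z_σ, u, b)`: it is generated by `K` and elements `z₁, …, zᵣ`, subject to
`zᵢ k = σᵢ(k) zᵢ`, `zᵢ zⱼ = uᵢⱼ zⱼ zᵢ` and `zᵢ ^ nᵢ = bᵢ`, where `nᵢ` is the order of `σᵢ`. -/
abbrev CrossedAlgebra (F : Type u) {K : Type v} [Field F] [Field K] [Algebra F K] {r : ℕ}
    (σ : Fin r → (K ≃ₐ[F] K)) (u : Fin r → Fin r → K) (b : Fin r → K) : Type (max u v) :=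
  RingQuot (CrossedRel F σ u b)

/-- The field `F((x₁))⋯((xᵣ))` of iterated Laurent series: the variable `x₁` is adjoined first. -/
def IterLaurent : ℕ → (F : Type u) → [Field F] → Type u
  | 0, F, _ => F
  | r + 1, F, _ => IterLaurent r (LaurentSeries F)

namespace IterLaurent

noncomputable instance instField : (r : ℕ) → (F : Type u) → [Field F] → Field (IterLaurent r F)
  | 0, _, i => i
  | r + 1, F, _ => instField r (LaurentSeries F)

/-- The inclusion of the constants `F ⊆ F((x₁))⋯((xᵣ))`. -/
noncomputable def C : (r : ℕ) → (F : Type u) → [Field F] → F →+* IterLaurent r F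
  | 0, F, _ => RingHom.id F
  | r + 1, F, _ => (C r (LaurentSeries F)).comp HahnSeries.C

/-- The variables `x₁, …, xᵣ` of `F((x₁))⋯((xᵣ))`. -/
noncomputable def X : (r : ℕ) → (F : Type u) → [Field F] → Fin r → IterLaurent r F
  | 0, _, _ => Fin.elim0
  | r + 1, F, _ => Fin.cons (C r (LaurentSeries F) (HahnSeries.single 1 1)) (X r (LaurentSeries F))

/-- A ring homomorphism applied to the coefficients of Laurent series. -/
noncomputable def mapLaurent {F : Type u} {K : Type v} [Field F] [Field K] (f : F →+* K) :
    LaurentSeries F →+* LaurentSeries K where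
  toFun x := x.map f
  map_one' := HahnSeries.map_one f.toMonoidWithZeroHom
  map_mul' _ _ := HahnSeries.map_mul (f : F →ₙ+* K)
  map_zero' := HahnSeries.map_zero (f : ZeroHom F K)
  map_add' _ _ := HahnSeries.map_add (f : F →+ K)

/-- A homomorphism `F → K`, applied to the coefficients of iterated Laurent series. -/
noncomputable def map : (r : ℕ) → {F : Type u} → {K : Type v} → [Field F] → [Field K] →
    (F →+* K) → (IterLaurent r F →+* IterLaurent r K)
  | 0, _, _, _, _, f => f
  | r + 1, _, _, _, _, f => map r (mapLaurent f)

theorem map_id (r : ℕ) {F : Type u} [Field F] (x : IterLaurent r F) :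
    map r (RingHom.id F) x = x := by
  induction r generalizing F with
  | zero => rfl
  | succ r ih =>
    have h : mapLaurent (RingHom.id F) = RingHom.id (LaurentSeries F) := by
      refine RingHom.ext fun x => HahnSeries.ext ?_
      rfl
    change map r (mapLaurent (RingHom.id F)) x = x
    rw [h]
    exact ih x

theorem map_map (r : ℕ) {F : Type u} {K : Type v} {L : Type w} [Field F] [Field K] [Field L]
    (f : F →+* K) (g : K →+* L) (x : IterLaurent r F) :
    map r g (map r f x) = map r (g.comp f) x := by
  induction r generalizing F K L with
  | zero => rfl
  | succ r ih =>
    have h : mapLaurent (g.comp f) = (mapLaurent g).comp (mapLaurent f) := by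
      refine RingHom.ext fun x => HahnSeries.ext ?_
      rfl
    change map r (mapLaurent g) (map r (mapLaurent f) x) = map r (mapLaurent (g.comp f)) x
    rw [h]
    exact ih _ _ x

/-- `K'' = K((x₁))⋯((xᵣ))` as an extension of `F'' = F((x₁))⋯((xᵣ))`. -/
@[reducible] noncomputable def algebra (r : ℕ) (F : Type u) (K : Type v) [Field F] [Field K]
    [Algebra F K] : Algebra (IterLaurent r F) (IterLaurent r K) :=
  (map r (algebraMap F K)).toAlgebra

section

attribute [local instance] algebra

/-- An automorphism of `K/F`, applied to the coefficients, is an automorphism of `K''/F''`. -/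
noncomputable def mapAut (r : ℕ) {F : Type u} {K : Type v} [Field F] [Field K] [Algebra F K]
    (τ : K ≃ₐ[F] K) : IterLaurent r K ≃ₐ[IterLaurent r F] IterLaurent r K :=
  AlgEquiv.ofRingEquiv
    (f := RingEquiv.ofRingHom (map r (τ : K →+* K)) (map r (τ.symm : K →+* K))
      (by
        ext x
        have h : (τ : K →+* K).comp (τ.symm : K →+* K) = RingHom.id K := by ext y; simp
        simp only [RingHom.comp_apply, map_map, h, map_id, RingHom.id_apply])
      (by
        ext x
        have h : (τ.symm : K →+* K).comp (τ : K →+* K) = RingHom.id K := by ext y; simp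
        simp only [RingHom.comp_apply, map_map, h, map_id, RingHom.id_apply]))
    (by
      intro x
      have h : (τ : K →+* K).comp (algebraMap F K) = algebraMap F K := by ext y; simp
      change map r (τ : K →+* K) (map r (algebraMap F K) x) = map r (algebraMap F K) x
      rw [map_map, h])

end

end IterLaurent

namespace AbelianCrossedProduct

variable {F : Type u} {K : Type v} {Δ : Type w} [Field F] [Field K] [Algebra F K] [Ring Δ]
  [Algebra F Δ] {r : ℕ}

section

attribute [local instance] IterLaurent.algebra

/-- The power series generic abelian crossed product `𝔸_Δ = (K''/F'', z_σ, u, bx)` defined by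
`Δ = (K/F, z_σ, u, b)`, where `F'' = F((x₁))⋯((xᵣ))`, `K'' = K((x₁))⋯((xᵣ))` and
`bx = (b₁ x₁, …, bᵣ xᵣ)`. -/
def PowerSeriesGeneric (D : AbelianCrossedProduct F K Δ r) : Type (max u v) :=
  CrossedAlgebra (IterLaurent r F) (fun i => IterLaurent.mapAut r (D.σ i))
    (fun i j => IterLaurent.C r K (D.u i j))
    (fun i => IterLaurent.C r K (D.b i) * IterLaurent.X r K i)

noncomputable instance (D : AbelianCrossedProduct F K Δ r) : Ring D.PowerSeriesGeneric :=
  inferInstanceAs (Ring (CrossedAlgebra (IterLaurent r F) _ _ _))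

noncomputable instance (D : AbelianCrossedProduct F K Δ r) :
    Algebra (IterLaurent r F) D.PowerSeriesGeneric :=
  inferInstanceAs (Algebra (IterLaurent r F) (CrossedAlgebra (IterLaurent r F) _ _ _))

end

end AbelianCrossedProduct

/-! The proof is valuation-theoretic, with explicit Hahn series in place of Henselian fields. There
is an ordered group `Γ` (a lexicographic power of the localization of `ℤ` at `p`) with a
homomorphism `g` onto `G`, such that `ker g` is divisible by all integers prime to `p` and contains
the exponents of `F''`. The value `e i` given to `z_i` is the `n_i`-th part of the value of `x_i`,
and `g (e i) = σ_i`.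

Polynomials of degree prime to `p` over `k((ker g))` acquire roots after a finite extension of `k`
of degree prime to `p` (`hasRootInExt_of_coprime`, resting on Weierstrass preparation). Hence `E''`
embeds into `Ω = k((ker g))` with `k/F` finite of degree prime to `p`
(`exists_extension_of_coprime`). Then `K' = k ⊗ K` is a field with group `G` over `k`, and with `R =
k ⊗ Δ` the algebra `Ω ⊗ 𝔸_Δ` embeds into the ring of Hahn series over `R` whose coefficient at `γ`
lies in `K' z ^ m`, where `σ ^ m = g γ`. Nonzero homogeneous elements of `R` are units, so the order
of series is a valuation on this ring, even if `R` has zero divisors. Thus `Ω ⊗ 𝔸_Δ` is a division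
algebra, with center `Ω` (`exists_algHom_baseChange`).

Now let `L` be Galois over `E''` inside `𝔸_Δ ⊗ E''`. Its degree is a power of `p`, and `L' = Ω ⊗ L`
is a field with the same group. Elements with the same minimal polynomial are conjugate in the
division algebra (`exists_ne_zero_mul_eq_mul`), so automorphisms of `L'` preserve the valuation and
act on the residue field, which is a subfield of `K'`. Taking norms and using that `K'/k` is
separable, the fixed field of this action is `k`, so the residue field is Galois over `k` and the
action is surjective onto its group.

It remains to see that the action is faithful, that is, that `L'/Ω` has no ramification
(`exists_val_eq_coe_ker`). Given `θ` in `L'`, Hilbert 90 in the residue field supplies a unit by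
which `θ` can be changed so that every `h θ / θ` has residue `1`. The norm of `θ` is then `θ ^ p ^
s` times an element with leading coefficient `1`, so the leading coefficient `d` of `θ` is
homogeneous with a `p`-power power in `k`. If the degree `τ` of `d` were not `1`, some power of `d`
would have degree of order `p` and its `p`-th power in `k`. That contradicts the assumption on `u`
(`noCentralPower_baseChange`): such an element puts the `[k : F]`-th power of the tuple `(u_{i,m})`
into the group of degenerate tuples, the `p`-th power always lies there, and the two exponents are
coprime. So all values lie in `ker g`; by spherical completeness `[L' : Ω]` is at most the residue
degree (`finrank_le`), and `Gal(L'/Ω)` is the Galois group of a subfield of `K'`, a quotient of `G`.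
-/

namespace HahnSeries

/-! ### Spherical completeness and successive approximation. -/

/-- Hahn series are spherically complete: a coherent family of approximations has a limit. -/
theorem exists_limit {Γ R : Type*} [LinearOrder Γ] [AddGroup R] {α : Type*}
    (x : α → HahnSeries Γ R) (e : α → WithTop Γ)
    (h : ∀ a b, ∀ γ : Γ, γ < e a → γ < e b → (x a).coeff γ = (x b).coeff γ) :
    ∃ y : HahnSeries Γ R, ∀ a, ∀ γ : Γ, γ < e a → y.coeff γ = (x a).coeff γ := by
  classical
  let f : Γ → R := fun γ => if h : ∃ a, (γ : WithTop Γ) < e a then (x h.choose).coeff γ else 0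
  have hf : ∀ a, ∀ γ : Γ, (γ : WithTop Γ) < e a → f γ = (x a).coeff γ := by
    intro a γ hγ
    have hex : ∃ a, (γ : WithTop Γ) < e a := ⟨a, hγ⟩
    simp only [f, dif_pos hex]
    exact h _ _ _ hex.choose_spec hγ
  -- A descending sequence in the support starts below some `e a` and stays there, where `f` agrees
  -- with `x a`, whose support is well-founded.
  have hsupp : (Function.support f).IsPWO := by
    rw [Set.isPWO_iff_isWF, Set.isWF_iff_no_descending_seq]
    intro s hs hmem
    have h0 := hmem 0
    obtain ⟨a, ha⟩ : ∃ a, ((s 0 : Γ) : WithTop Γ) < e a := by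
      by_contra hcon
      exact h0 (by simp only [f, dif_neg hcon])
    have := (x a).isWF_support
    rw [Set.isWF_iff_no_descending_seq] at this
    refine this s hs fun n => ?_
    have hlt : ((s n : Γ) : WithTop Γ) < e a :=
      lt_of_le_of_lt (WithTop.coe_le_coe.2 (hs.antitone (Nat.zero_le n))) ha
    have h1 := hmem n
    rw [Function.mem_support, hf a _ hlt] at h1
    exact h1
  exact ⟨⟨f, hsupp⟩, hf⟩

/-- In a spherically complete situation, if every approximation `x` with error `e x ≠ ⊤` can be
improved without moving it by more than its error, then there is an approximation without error. -/
theorem exists_eq_top_of_improve {Γ R : Type*} [LinearOrder Γ] [AddGroup R] {ι : Type*}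
    (S : Set (ι → HahnSeries Γ R)) (hS : S.Nonempty) (e : (ι → HahnSeries Γ R) → WithTop Γ)
    (hball : ∀ x ∈ S, ∀ y, (∀ i, e x ≤ (y i - x i).orderTop) → y ∈ S ∧ e x ≤ e y)
    (himp : ∀ x ∈ S, e x ≠ ⊤ → ∃ y, (∀ i, e x ≤ (y i - x i).orderTop) ∧ e x < e y) :
    ∃ x ∈ S, e x = ⊤ := by
  -- Zorn's lemma is applied to this relation. Improvements stay within the ball of radius `e x`, so
  -- chains are coherent families and have limits.
  let r : S → S → Prop := fun x y =>
    x = y ∨ ((∀ i, e x.1 ≤ (y.1 i - x.1 i).orderTop) ∧ e x.1 < e y.1)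
  have hcoeff : ∀ x y : S, r x y → ∀ i, ∀ γ : Γ, (γ : WithTop Γ) < e x.1 →
      (y.1 i).coeff γ = (x.1 i).coeff γ := by
    rintro x y (rfl | ⟨h1, -⟩) i γ hγ
    · rfl
    · have := coeff_eq_zero_of_lt_orderTop (lt_of_lt_of_le hγ (h1 i))
      rw [coeff_sub, sub_eq_zero] at this
      exact this
  have hr_le : ∀ x y : S, r x y → e x.1 ≤ e y.1 := by
    rintro x y (rfl | ⟨-, h1⟩)
    · exact le_rfl
    · exact h1.le
  have htrans : ∀ {a b c : S}, r a b → r b c → r a c := by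
    rintro a b c (rfl | ⟨h1, h2⟩) hbc
    · exact hbc
    · refine Or.inr ⟨fun i => le_orderTop_iff_forall.2 fun γ hγ => ?_,
        lt_of_lt_of_le h2 (hr_le _ _ hbc)⟩
      rw [coeff_sub, hcoeff b c hbc i γ (hγ.trans h2),
        hcoeff a b (Or.inr ⟨h1, h2⟩) i γ hγ, sub_self]
  have : Nonempty S := hS.to_subtype
  obtain ⟨m, hm⟩ := exists_maximal_of_nonempty_chains_bounded (r := r) (by
    intro c hc hne
    have htot : ∀ a ∈ c, ∀ b ∈ c, r a b ∨ r b a := by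
      intro a ha b hb
      by_cases hab : a = b
      · exact Or.inl (Or.inl hab)
      · exact hc ha hb hab
    -- If the chain has no last element, each member is beaten strictly by another one; this makes
    -- the limit strictly better than every member, as `r` demands.
    by_cases hmax : ∃ x ∈ c, ∀ x' ∈ c, r x' x
    · obtain ⟨x, -, hx⟩ := hmax
      exact ⟨x, hx⟩
    push Not at hmax
    have hlim : ∀ i, ∃ y : HahnSeries Γ R, ∀ a : c, ∀ γ : Γ, γ < e a.1.1 →
        y.coeff γ = (a.1.1 i).coeff γ := by
      intro i
      refine exists_limit (fun a : c => a.1.1 i) (fun a : c => e a.1.1) fun a b γ ha hb => ?_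
      rcases htot _ a.2 _ b.2 with hab | hba
      · exact (hcoeff _ _ hab i γ ha).symm
      · exact hcoeff _ _ hba i γ hb
    choose y hy using hlim
    have hnear : ∀ a ∈ c, ∀ i, e a.1 ≤ (y i - a.1 i).orderTop := by
      intro a ha i
      refine le_orderTop_iff_forall.2 fun γ hγ => ?_
      rw [coeff_sub, hy i ⟨a, ha⟩ γ hγ, sub_self]
    obtain ⟨a0, ha0⟩ := hne
    refine ⟨⟨y, (hball a0.1 a0.2 y (hnear a0 ha0)).1⟩, fun a ha => Or.inr ⟨hnear a ha, ?_⟩⟩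
    obtain ⟨b, hb, hba⟩ := hmax a ha
    have hab : r a b := (htot _ ha _ hb).resolve_right hba
    rcases hab with rfl | ⟨-, hlt⟩
    · exact absurd (Or.inl rfl) hba
    · exact lt_of_lt_of_le hlt (hball b.1 b.2 y (hnear b hb)).2) htrans
  refine ⟨m.1, m.2, ?_⟩
  by_contra hne
  obtain ⟨y, hy1, hy2⟩ := himp m.1 m.2 hne
  have hyS := (hball m.1 m.2 y hy1).1
  have := hr_le _ _ (hm ⟨y, hyS⟩ (Or.inr ⟨hy1, hy2⟩))
  exact absurd hy2 (not_lt.2 this)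

end HahnSeries

/-! ### Integral polynomials over Hahn series and Weierstrass preparation. -/

namespace HahnSeries

section Weierstrass

open Polynomial

variable {Γ k : Type*} [AddCommGroup Γ] [LinearOrder Γ] [IsOrderedAddMonoid Γ] [Field k]

/-- All coefficients of the polynomial `P` have order at least `t`. -/
def PolyGE (t : WithTop Γ) (P : (HahnSeries Γ k)[X]) : Prop := ∀ i, t ≤ (P.coeff i).orderTop

/-- All coefficients of the polynomial `P` have order greater than `t`. -/
def PolyGT (t : WithTop Γ) (P : (HahnSeries Γ k)[X]) : Prop := ∀ i, t < (P.coeff i).orderTop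

omit [AddCommGroup Γ] [IsOrderedAddMonoid Γ] in
theorem le_orderTop_sum {ι : Type*} (s : Finset ι) (f : ι → HahnSeries Γ k) (t : WithTop Γ)
    (h : ∀ i ∈ s, t ≤ (f i).orderTop) : t ≤ (∑ i ∈ s, f i).orderTop := by
  classical
  induction s using Finset.induction_on with
  | empty => simp
  | insert a s ha ih =>
    rw [Finset.sum_insert ha]
    exact (le_min (h a (Finset.mem_insert_self _ _))
      (ih fun i hi => h i (Finset.mem_insert_of_mem hi))).trans min_orderTop_le_orderTop_add

theorem PolyGE.add {t : WithTop Γ} {P Q : (HahnSeries Γ k)[X]} (hP : PolyGE t P)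
    (hQ : PolyGE t Q) : PolyGE t (P + Q) := fun i => by
  rw [Polynomial.coeff_add]
  exact (le_min (hP i) (hQ i)).trans min_orderTop_le_orderTop_add

theorem PolyGE.neg {t : WithTop Γ} {P : (HahnSeries Γ k)[X]} (hP : PolyGE t P) :
    PolyGE t (-P) := fun i => by
  rw [Polynomial.coeff_neg, orderTop_neg]
  exact hP i

theorem PolyGE.sub {t : WithTop Γ} {P Q : (HahnSeries Γ k)[X]} (hP : PolyGE t P)
    (hQ : PolyGE t Q) : PolyGE t (P - Q) := by
  rw [sub_eq_add_neg]
  exact hP.add hQ.neg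

theorem PolyGE.mul {s t : WithTop Γ} {P Q : (HahnSeries Γ k)[X]} (hP : PolyGE s P)
    (hQ : PolyGE t Q) : PolyGE (s + t) (P * Q) := fun i => by
  rw [Polynomial.coeff_mul]
  exact le_orderTop_sum _ _ _ fun x _ => (add_le_add (hP x.1) (hQ x.2)).trans orderTop_add_le_mul

theorem PolyGE.mul_left {t : WithTop Γ} {P Q : (HahnSeries Γ k)[X]} (hP : PolyGE 0 P)
    (hQ : PolyGE t Q) : PolyGE t (P * Q) := by
  simpa using hP.mul hQ

theorem PolyGE.mul_right {t : WithTop Γ} {P Q : (HahnSeries Γ k)[X]} (hP : PolyGE t P)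
    (hQ : PolyGE 0 Q) : PolyGE t (P * Q) := by
  simpa using hP.mul hQ

theorem PolyGE.C {t : WithTop Γ} {a : HahnSeries Γ k} (ha : t ≤ a.orderTop) :
    PolyGE t (Polynomial.C a) := fun i => by
  rw [Polynomial.coeff_C]
  split_ifs <;> simp [ha]

theorem PolyGE.one : PolyGE 0 (1 : (HahnSeries Γ k)[X]) := by
  rw [← Polynomial.C_1]
  exact PolyGE.C (by simp)

theorem PolyGE.X_pow (n : ℕ) : PolyGE 0 (X ^ n : (HahnSeries Γ k)[X]) := fun i => by
  rw [Polynomial.coeff_X_pow]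
  split_ifs <;> simp

theorem PolyGE.pow {P : (HahnSeries Γ k)[X]} (hP : PolyGE 0 P) (n : ℕ) : PolyGE 0 (P ^ n) := by
  induction n with
  | zero => simpa using PolyGE.one
  | succ n ih => rw [pow_succ]; exact ih.mul_right hP

theorem PolyGE.sum {ι : Type*} (s : Finset ι) (f : ι → (HahnSeries Γ k)[X]) (t : WithTop Γ)
    (h : ∀ i ∈ s, PolyGE t (f i)) : PolyGE t (∑ i ∈ s, f i) := fun j => by
  rw [Polynomial.finsetSum_coeff]
  exact le_orderTop_sum _ _ _ fun i hi => h i hi j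

theorem PolyGT.le {t : WithTop Γ} {P : (HahnSeries Γ k)[X]}
    (hP : PolyGT t P) : PolyGE t P := fun i => (hP i).le

/-- A polynomial has finitely many coefficients, so a strict bound is uniform. This reduces strict
estimates to the ones for `PolyGE`. -/
theorem polyGT_iff {t : WithTop Γ} (ht : t ≠ ⊤) {P : (HahnSeries Γ k)[X]} :
    PolyGT t P ↔ ∃ s, t < s ∧ PolyGE s P := by
  constructor
  · intro h
    refine ⟨P.support.inf fun i => (P.coeff i).orderTop,
      (Finset.lt_inf_iff (lt_top_iff_ne_top.2 ht)).2 fun i _ => h i, fun i => ?_⟩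
    by_cases hi : i ∈ P.support
    · exact Finset.inf_le (f := fun i => (P.coeff i).orderTop) hi
    · rw [Polynomial.notMem_support_iff.1 hi]
      simp
  · rintro ⟨s, hs, h⟩ i
    exact lt_of_lt_of_le hs (h i)

/-- Each step of long division by a monic integral `g` subtracts a multiple of `g` by a current
leading coefficient, so no order drops below `t`. -/
theorem exists_div_of_polyGE {t : WithTop Γ} {g : (HahnSeries Γ k)[X]} (hg : g.Monic)
    (hg0 : PolyGE 0 g) (n : ℕ) (P : (HahnSeries Γ k)[X]) (hn : P.degree < n) (hP : PolyGE t P) :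
    ∃ q r, r + g * q = P ∧ r.degree < g.degree ∧ PolyGE t q ∧ PolyGE t r := by
  induction n generalizing P with
  | zero =>
    have : P = 0 := Polynomial.degree_eq_bot.1 (by
      rw [← Nat.WithBot.lt_zero_iff]; exact_mod_cast hn)
    subst this
    exact ⟨0, 0, by simp, by simpa [bot_lt_iff_ne_bot, Polynomial.degree_eq_bot] using hg.ne_zero,
      hP, hP⟩
  | succ n ih =>
    by_cases hd : P.degree < g.degree
    · exact ⟨0, P, by simp, hd, fun i => by simp, hP⟩
    · by_cases hP0 : P = 0
      · exact absurd (by simpa [hP0, bot_lt_iff_ne_bot, Polynomial.degree_eq_bot] using hg.ne_zero) hd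
      have hlt := Polynomial.div_wf_lemma ⟨not_lt.1 hd, hP0⟩ hg
      have hz : PolyGE t (Polynomial.C P.leadingCoeff * X ^ (P.natDegree - g.natDegree)) :=
        (PolyGE.C (hP _)).mul_right (PolyGE.X_pow _)
      obtain ⟨q, r, h1, h2, h3, h4⟩ := ih _
        (lt_of_lt_of_le hlt (by
          rw [Polynomial.degree_eq_natDegree hP0] at hn ⊢
          exact_mod_cast Nat.lt_succ_iff.1 (by exact_mod_cast hn))) (hP.sub (hg0.mul_left hz))
      exact ⟨q + Polynomial.C P.leadingCoeff * X ^ (P.natDegree - g.natDegree), r,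
        by rw [mul_add, ← add_assoc, h1]; ring, h2, h3.add hz, h4⟩

theorem PolyGE.div_mod {t : WithTop Γ} {g P : (HahnSeries Γ k)[X]} (hP : PolyGE t P)
    (hg : g.Monic) (hg0 : PolyGE 0 g) : PolyGE t (P /ₘ g) ∧ PolyGE t (P %ₘ g) := by
  obtain ⟨q, r, h1, h2, h3, h4⟩ := exists_div_of_polyGE hg hg0 (P.natDegree + 1) P
    (by
      refine lt_of_le_of_lt Polynomial.degree_le_natDegree ?_
      exact_mod_cast Nat.lt_succ_self _) hP
  obtain ⟨h5, h6⟩ := Polynomial.div_modByMonic_unique q r hg ⟨h1, h2⟩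
  rw [h5, h6]
  exact ⟨h3, h4⟩

theorem PolyGT.div_mod {t : WithTop Γ} {g P : (HahnSeries Γ k)[X]} (hP : PolyGT t P)
    (ht : t ≠ ⊤) (hg : g.Monic) (hg0 : PolyGE 0 g) : PolyGT t (P /ₘ g) ∧ PolyGT t (P %ₘ g) := by
  obtain ⟨s, hs, h⟩ := (polyGT_iff ht).1 hP
  exact ⟨(polyGT_iff ht).2 ⟨s, hs, (h.div_mod hg hg0).1⟩,
    (polyGT_iff ht).2 ⟨s, hs, (h.div_mod hg hg0).2⟩⟩

/-- The monic polynomial of degree `m` with the given lower coefficients. -/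
noncomputable def monicOfCoeffs {m : ℕ} (c : Fin m → HahnSeries Γ k) : (HahnSeries Γ k)[X] :=
  X ^ m + ∑ i : Fin m, Polynomial.C (c i) * X ^ (i : ℕ)

theorem degree_sum_fin_lt {m : ℕ} (c : Fin m → HahnSeries Γ k) :
    (∑ i : Fin m, Polynomial.C (c i) * X ^ (i : ℕ)).degree < (m : WithBot ℕ) :=
  Polynomial.degree_sum_fin_lt c

theorem monicOfCoeffs_monic {m : ℕ} (c : Fin m → HahnSeries Γ k) : (monicOfCoeffs c).Monic :=
  Polynomial.monic_X_pow_add (degree_sum_fin_lt c)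

theorem degree_monicOfCoeffs {m : ℕ} (c : Fin m → HahnSeries Γ k) :
    (monicOfCoeffs c).degree = m := by
  rw [monicOfCoeffs, Polynomial.degree_add_eq_left_of_degree_lt, Polynomial.degree_X_pow]
  rw [Polynomial.degree_X_pow]
  exact degree_sum_fin_lt c

theorem PolyGE.monicOfCoeffs {m : ℕ} {c : Fin m → HahnSeries Γ k}
    (hc : ∀ i, 0 < (c i).orderTop) : PolyGE 0 (monicOfCoeffs c) :=
  (PolyGE.X_pow m).add (PolyGE.sum _ _ _ fun i _ =>
    (PolyGE.C (hc i).le).mul_right (PolyGE.X_pow _))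

theorem PolyGT.lower {m : ℕ} {c : Fin m → HahnSeries Γ k} (hc : ∀ i, 0 < (c i).orderTop) :
    PolyGT 0 (∑ i : Fin m, Polynomial.C (c i) * X ^ (i : ℕ)) := by
  refine (polyGT_iff (by simp)).2 ⟨Finset.univ.inf fun i => (c i).orderTop,
    (Finset.lt_inf_iff (by simp)).2 fun i _ => hc i, PolyGE.sum _ _ _ fun i _ => ?_⟩
  exact (PolyGE.C (Finset.inf_le (f := fun i => (c i).orderTop) (Finset.mem_univ i))).mul_right
    (PolyGE.X_pow _)

theorem monicOfCoeffs_add {m : ℕ} (c : Fin m → HahnSeries Γ k) {δ : (HahnSeries Γ k)[X]}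
    (hδ : δ.degree < m) :
    HahnSeries.monicOfCoeffs (fun i => c i + δ.coeff i) = HahnSeries.monicOfCoeffs c + δ := by
  have h : δ = ∑ i : Fin m, Polynomial.C (δ.coeff i) * X ^ (i : ℕ) := by
    rw [Fin.sum_univ_eq_sum_range (fun i => Polynomial.C (δ.coeff i) * X ^ i)]
    ext1 j
    simp only [Polynomial.finsetSum_coeff, Polynomial.coeff_C_mul, Polynomial.coeff_X_pow,
      mul_ite, mul_one, mul_zero, Finset.sum_ite_eq, Finset.mem_range]
    split_ifs with hj
    · rfl
    · exact Polynomial.coeff_eq_zero_of_degree_lt (lt_of_lt_of_le hδ (by exact_mod_cast not_lt.1 hj))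
  conv_rhs => rw [h]
  simp only [HahnSeries.monicOfCoeffs, map_add, add_mul, Finset.sum_add_distrib, add_assoc]

theorem polyGT_mul {t : WithTop Γ} (ht : t ≠ ⊤) {P Q : (HahnSeries Γ k)[X]} (hP : PolyGE t P)
    (hQ : PolyGT 0 Q) : PolyGT t (P * Q) := by
  obtain ⟨s, hs, h⟩ := (polyGT_iff (by simp)).1 hQ
  refine (polyGT_iff ht).2 ⟨t + s, ?_, hP.mul h⟩
  calc t = t + 0 := (add_zero t).symm
    _ < t + s := WithTop.add_lt_add_left ht hs

theorem PolyGT.add {t : WithTop Γ} {P Q : (HahnSeries Γ k)[X]} (hP : PolyGT t P)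
    (hQ : PolyGT t Q) : PolyGT t (P + Q) := fun i => by
  rw [Polynomial.coeff_add]
  exact lt_of_lt_of_le (lt_min (hP i) (hQ i)) min_orderTop_le_orderTop_add

theorem PolyGT.neg {t : WithTop Γ} {P : (HahnSeries Γ k)[X]} (hP : PolyGT t P) :
    PolyGT t (-P) := fun i => by
  rw [Polynomial.coeff_neg, orderTop_neg]
  exact hP i

/-- A Weierstrass preparation theorem over fields of Hahn series. -/
theorem exists_monic_dvd_of_decomp {m : ℕ} {f f₀ f₁ : (HahnSeries Γ k)[X]}
    (hf : f = X ^ m * f₁ + f₀) (h0 : PolyGT 0 f₀) (h1 : PolyGE 0 f₁)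
    (ha : (f₁.coeff 0).orderTop = 0) :
    ∃ g : (HahnSeries Γ k)[X], g.Monic ∧ g.natDegree = m ∧ g ∣ f := by
  classical
  -- An integral inverse `s` of `f₁` modulo `X ^ m`, from the truncated geometric series of `f₁ = a
  -- (1 - X h)`.
  obtain ⟨s, w, hs, hw, hsw⟩ : ∃ s w : (HahnSeries Γ k)[X], PolyGE 0 s ∧ PolyGE 0 w ∧
      s * f₁ = 1 - X ^ m * w := by
    set a := f₁.coeff 0 with ha_def
    have ha0 : a ≠ 0 := by
      rintro h
      rw [h] at ha
      simp at ha
    have hainv : (a⁻¹).orderTop = 0 := by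
      have := orderTop_mul a a⁻¹
      rw [mul_inv_cancel₀ ha0, orderTop_one, ha, zero_add] at this
      exact this.symm
    let h := -(Polynomial.C a⁻¹ * f₁.divX)
    have hh : PolyGE 0 h :=
      ((PolyGE.C hainv.ge).mul_left fun i => by rw [Polynomial.coeff_divX]; exact h1 _).neg
    have hf1 : f₁ = Polynomial.C a * (1 - X * h) := by
      have e1 := Polynomial.divX_mul_X_add f₁
      have e2 : Polynomial.C a * Polynomial.C a⁻¹ = (1 : (HahnSeries Γ k)[X]) := by
        rw [← Polynomial.C_mul, mul_inv_cancel₀ ha0, Polynomial.C_1]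
      calc f₁ = f₁.divX * X + Polynomial.C a := e1.symm
        _ = Polynomial.C a + (Polynomial.C a * Polynomial.C a⁻¹) * f₁.divX * X := by
          rw [e2]; ring
        _ = _ := by simp only [h]; ring
    refine ⟨Polynomial.C a⁻¹ * ∑ i ∈ Finset.range m, (X * h) ^ i, h ^ m, ?_, hh.pow m, ?_⟩
    · refine (PolyGE.C hainv.ge).mul_left (PolyGE.sum _ _ _ fun i _ => ?_)
      exact PolyGE.pow (PolyGE.mul_left (by simpa using PolyGE.X_pow (Γ := Γ) (k := k) 1) hh) i
    · have e2 : Polynomial.C a⁻¹ * Polynomial.C a = (1 : (HahnSeries Γ k)[X]) := by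
        rw [← Polynomial.C_mul, inv_mul_cancel₀ ha0, Polynomial.C_1]
      have e3 := geom_sum_mul_neg (X * h) m
      calc _ = Polynomial.C a⁻¹ * (∑ i ∈ Finset.range m, (X * h) ^ i) *
            (Polynomial.C a * (1 - X * h)) := by rw [← hf1]
        _ = (Polynomial.C a⁻¹ * Polynomial.C a) *
            ((∑ i ∈ Finset.range m, (X * h) ^ i) * (1 - X * h)) := by ring
        _ = _ := by rw [e2, e3, one_mul, mul_pow]
  have hfge : PolyGE 0 f := by
    rw [hf]
    exact ((PolyGE.X_pow m).mul_left h1).add h0.le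
  -- The unknowns are the lower coefficients of `g`. The error is the least order among the
  -- coefficients of the remainder of `f` modulo `g`, which is `⊤` exactly when `g ∣ f`.
  let S : Set (Fin m → HahnSeries Γ k) := {c | ∀ i, 0 < (c i).orderTop}
  let e : (Fin m → HahnSeries Γ k) → WithTop Γ := fun c =>
    Finset.univ.inf fun i : Fin m => ((f %ₘ monicOfCoeffs c).coeff i).orderTop
  have he_ge : ∀ c, PolyGE (e c) (f %ₘ monicOfCoeffs c) := by
    intro c i
    by_cases hi : i < m
    · exact Finset.inf_le (f := fun i : Fin m => ((f %ₘ monicOfCoeffs c).coeff i).orderTop)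
        (Finset.mem_univ (⟨i, hi⟩ : Fin m))
    · rw [Polynomial.coeff_eq_zero_of_degree_lt]
      · simp
      · refine lt_of_lt_of_le (Polynomial.degree_modByMonic_lt _ (monicOfCoeffs_monic c)) ?_
        rw [degree_monicOfCoeffs]
        exact_mod_cast not_lt.1 hi
  have hle_e : ∀ c t, PolyGE t (f %ₘ monicOfCoeffs c) → t ≤ e c := fun c t h =>
    Finset.le_inf fun i _ => h i
  -- comparison of the quotient with `f₁`
  have hquot : ∀ c ∈ S, PolyGT 0 (f %ₘ monicOfCoeffs c) ∧
      PolyGT 0 (f /ₘ monicOfCoeffs c - f₁) := by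
    intro c hc
    set g := monicOfCoeffs c with hg_def
    have hg := monicOfCoeffs_monic c
    have hg0 : PolyGE 0 g := PolyGE.monicOfCoeffs hc
    have hXg : PolyGT 0 (X ^ m - g) := by
      have : X ^ m - g = -(∑ i : Fin m, Polynomial.C (c i) * X ^ (i : ℕ)) := by
        rw [hg_def, monicOfCoeffs]; ring
      rw [this]
      exact (PolyGT.lower hc).neg
    have hP : PolyGT 0 (f₁ * (X ^ m - g) + f₀) := (polyGT_mul (by simp) h1 hXg).add h0
    have hdm := hP.div_mod (by simp) hg hg0
    have huniq := Polynomial.div_modByMonic_unique (f := f)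
      (f₁ + (f₁ * (X ^ m - g) + f₀) /ₘ g) ((f₁ * (X ^ m - g) + f₀) %ₘ g) hg
      ⟨by
        have := Polynomial.modByMonic_add_div (f₁ * (X ^ m - g) + f₀) g
        rw [mul_add, add_left_comm, this, hf]; ring,
       Polynomial.degree_modByMonic_lt _ hg⟩
    rw [huniq.1, huniq.2]
    exact ⟨hdm.2, by simpa using hdm.1⟩
  have he_pos : ∀ c ∈ S, 0 < e c := fun c hc =>
    (Finset.lt_inf_iff (by simp)).2 fun i _ => (hquot c hc).1 i
  have hq_ge : ∀ c ∈ S, PolyGE 0 (f /ₘ monicOfCoeffs c) := fun c hc =>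
    (hfge.div_mod (monicOfCoeffs_monic c) (PolyGE.monicOfCoeffs hc)).1
  obtain ⟨c, hc, hec⟩ := exists_eq_top_of_improve S ⟨0, fun i => by simp⟩ e (by
    intro c hc c' hcc'
    have hc' : c' ∈ S := fun i => by
      have : c' i = c i + (c' i - c i) := by ring
      rw [this]
      exact lt_of_lt_of_le (lt_min (hc i) (lt_of_lt_of_le (he_pos c hc) (hcc' i)))
        min_orderTop_le_orderTop_add
    refine ⟨hc', hle_e _ _ ?_⟩
    set g := monicOfCoeffs c with hg_def
    set g' := monicOfCoeffs c' with hg'_def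
    have hg' := monicOfCoeffs_monic c'
    have hδ : PolyGE (e c) (g' - g) := by
      have : g' - g = ∑ i : Fin m, Polynomial.C (c' i - c i) * X ^ (i : ℕ) := by
        rw [hg_def, hg'_def, monicOfCoeffs, monicOfCoeffs]
        simp only [map_sub, sub_mul, Finset.sum_sub_distrib]
        ring
      rw [this]
      exact PolyGE.sum _ _ _ fun i _ => (PolyGE.C (hcc' i)).mul_right (PolyGE.X_pow _)
    have hP : PolyGE (e c) (f %ₘ g - (g' - g) * (f /ₘ g)) :=
      (he_ge c).sub (hδ.mul_right (hq_ge c hc))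
    have huniq := Polynomial.div_modByMonic_unique (f := f)
      (f /ₘ g + (f %ₘ g - (g' - g) * (f /ₘ g)) /ₘ g') ((f %ₘ g - (g' - g) * (f /ₘ g)) %ₘ g') hg'
      ⟨by
        have h2 := Polynomial.modByMonic_add_div (f %ₘ g - (g' - g) * (f /ₘ g)) g'
        have h3 := Polynomial.modByMonic_add_div f g
        rw [mul_add, add_left_comm, h2]
        linear_combination h3,
       Polynomial.degree_modByMonic_lt _ hg'⟩
    rw [huniq.2]
    exact (hP.div_mod hg' (PolyGE.monicOfCoeffs hc')).2) (by
    intro c hc het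
    set t := e c with ht_def
    set g := monicOfCoeffs c with hg_def
    have hg := monicOfCoeffs_monic c
    have hg0 : PolyGE 0 g := PolyGE.monicOfCoeffs hc
    set q := f /ₘ g with hq_def
    set R := f %ₘ g with hR_def
    have hR : PolyGE t R := he_ge c
    have hfgR : R + g * q = f := Polynomial.modByMonic_add_div f g
    -- `s * q + w * g = 1 + η` with `η` small
    obtain ⟨η, hη, hsq⟩ : ∃ η, PolyGT 0 η ∧ s * q + w * g = 1 + η := by
      refine ⟨s * (q - f₁) + w * (g - X ^ m), ?_, ?_⟩
      · refine (polyGT_mul (by simp) hs (hquot c hc).2).add (polyGT_mul (by simp) hw ?_)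
        have : g - X ^ m = ∑ i : Fin m, Polynomial.C (c i) * X ^ (i : ℕ) := by
          rw [hg_def, monicOfCoeffs]; ring
        rw [this]
        exact PolyGT.lower hc
      · linear_combination hsw
    -- Newton step: replacing `g` by `g + δ` cancels the remainder to first order if `δ * q ≡ R`
    -- modulo `g`. Up to `η`, the element `s` inverts `q` modulo `g`, hence the choice. What remains
    -- is `W * δ - R * η`, a sum of products of a term of order at least `t` with one of positive
    -- order.
    set δ := (s * R) %ₘ g with hδ_def
    set a := (s * R) /ₘ g with ha_def
    have hsR : δ + g * a = s * R := Polynomial.modByMonic_add_div _ _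
    have hδa := PolyGE.div_mod (hs.mul_left hR) hg hg0
    have hδdeg : δ.degree < m := by
      have := Polynomial.degree_modByMonic_lt (s * R) hg
      rwa [degree_monicOfCoeffs] at this
    refine ⟨fun i => c i + δ.coeff i, fun i => by simpa using hδa.2 i, ?_⟩
    have hc' : (fun i : Fin m => c i + δ.coeff i) ∈ S := fun i =>
      lt_of_lt_of_le (lt_min (hc i) (lt_of_lt_of_le (he_pos c hc) (hδa.2 i)))
        min_orderTop_le_orderTop_add
    have hg' := monicOfCoeffs_monic fun i : Fin m => c i + δ.coeff i
    have hg'0 : PolyGE 0 (monicOfCoeffs fun i : Fin m => c i + δ.coeff i) :=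
      PolyGE.monicOfCoeffs hc'
    have hg'eq := monicOfCoeffs_add c hδdeg
    rw [← hg_def] at hg'eq
    set g' := monicOfCoeffs fun i : Fin m => c i + δ.coeff i with hg'_def
    set W := -(w * R) - a * q with hW_def
    have hW : PolyGE t W := (hw.mul_left hR).neg.sub (hδa.1.mul_right (hq_ge c hc))
    have hP : PolyGT t (W * δ + -(R * η)) := by
      refine PolyGT.add (polyGT_mul het hW ?_) (polyGT_mul het hR hη).neg
      exact fun i => lt_of_lt_of_le (he_pos c hc) (hδa.2 i)
    have huniq := Polynomial.div_modByMonic_unique (f := f)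
      (q - W + (W * δ + -(R * η)) /ₘ g') ((W * δ + -(R * η)) %ₘ g') hg'
      ⟨by
        have h2 := Polynomial.modByMonic_add_div (W * δ + -(R * η)) g'
        rw [mul_add, add_left_comm, h2, hg'eq, hW_def]
        linear_combination hfgR + q * hsR + R * hsq,
       Polynomial.degree_modByMonic_lt _ hg'⟩
    have hgt := (hP.div_mod het hg' hg'0).2
    rw [← huniq.2] at hgt
    exact (Finset.lt_inf_iff (lt_top_iff_ne_top.2 het)).2 fun i _ => hgt i)
  refine ⟨monicOfCoeffs c, monicOfCoeffs_monic c,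
    Polynomial.natDegree_eq_of_degree_eq_some (degree_monicOfCoeffs c), ?_⟩
  rw [← Polynomial.modByMonic_eq_zero_iff_dvd (monicOfCoeffs_monic c)]
  ext1 i
  have := he_ge c i
  rw [hec, top_le_iff, orderTop_eq_top] at this
  simpa using this

/-- This takes the role of Hensel's lemma: if the residue polynomial is `X ^ m` times one with
nonzero constant term, division by `X ^ m` gives the decomposition to which Weierstrass preparation
applies. -/
theorem exists_monic_dvd {m : ℕ} {f : (HahnSeries Γ k)[X]} (hf : PolyGE 0 f)
    (hlt : ∀ i < m, 0 < (f.coeff i).orderTop) (hm : (f.coeff m).orderTop = 0) :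
    ∃ g : (HahnSeries Γ k)[X], g.Monic ∧ g.natDegree = m ∧ g ∣ f := by
  have hXm : (X ^ m : (HahnSeries Γ k)[X]).Monic := Polynomial.monic_X_pow m
  have h := Polynomial.modByMonic_add_div f (X ^ m)
  have hdeg : (f %ₘ X ^ m).degree < m := by
    simpa using Polynomial.degree_modByMonic_lt f hXm
  have hzero : ∀ i, m ≤ i → (f %ₘ X ^ m).coeff i = 0 := fun i hi =>
    Polynomial.coeff_eq_zero_of_degree_lt (lt_of_lt_of_le hdeg (by exact_mod_cast hi))
  refine exists_monic_dvd_of_decomp (f₀ := f %ₘ X ^ m) (f₁ := f /ₘ X ^ m)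
    (by rw [add_comm]; exact h.symm) (fun i => ?_) (hf.div_mod hXm (PolyGE.X_pow m)).1 ?_
  · by_cases hi : i < m
    · have := congrArg (fun P => Polynomial.coeff P i) h
      simp only [Polynomial.coeff_add, Polynomial.coeff_X_pow_mul', not_le.2 hi, if_false,
        add_zero] at this
      rw [this]
      exact hlt i hi
    · rw [hzero i (not_lt.1 hi)]
      simp
  · have := congrArg (fun P => Polynomial.coeff P m) h
    simp only [Polynomial.coeff_add, Polynomial.coeff_X_pow_mul', le_refl, if_true,
      hzero m le_rfl, zero_add, Nat.sub_self] at this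
    rw [this, hm]

end Weierstrass

end HahnSeries

/-! ### Roots of polynomials of degree prime to `p`. -/

namespace HahnSeries

/-- A ring homomorphism applied to the coefficients of Hahn series. -/
noncomputable def mapRingHom (Γ : Type*) [AddCommMonoid Γ] [PartialOrder Γ]
    [IsOrderedCancelAddMonoid Γ] {R S : Type*} [Semiring R] [Semiring S] (f : R →+* S) :
    HahnSeries Γ R →+* HahnSeries Γ S where
  toFun x := x.map f
  map_one' := HahnSeries.map_one f.toMonoidWithZeroHom
  map_mul' _ _ := HahnSeries.map_mul (f : R →ₙ+* S)
  map_zero' := HahnSeries.map_zero (f : ZeroHom R S)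
  map_add' _ _ := HahnSeries.map_add (f : R →+ S)

@[simp]
theorem coeff_mapRingHom {Γ : Type*} [AddCommMonoid Γ] [PartialOrder Γ]
    [IsOrderedCancelAddMonoid Γ] {R S : Type*} [Semiring R] [Semiring S] (f : R →+* S)
    (x : HahnSeries Γ R) (γ : Γ) : (mapRingHom Γ f x).coeff γ = f (x.coeff γ) := rfl

@[simp]
theorem mapRingHom_single {Γ : Type*} [AddCommMonoid Γ] [PartialOrder Γ]
    [IsOrderedCancelAddMonoid Γ] {R S : Type*} [Semiring R] [Semiring S] (f : R →+* S)
    (γ : Γ) (r : R) : mapRingHom Γ f (single γ r) = single γ (f r) :=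
  HahnSeries.map_single (f : ZeroHom R S)

end HahnSeries

/-- The degrees of the irreducible factors add up to a number prime to `p`, so they cannot all be
divisible by `p`. -/
theorem Polynomial.exists_irreducible_dvd_natDegree_coprime {k : Type*} [Field k] {p : ℕ}
    [hp : Fact p.Prime] (f : Polynomial k) (hf : f.natDegree.Coprime p) :
    ∃ q : Polynomial k, Irreducible q ∧ q ∣ f ∧ q.natDegree.Coprime p := by
  induction hn : f.natDegree using Nat.strong_induction_on generalizing f with
  | _ n ih =>
    have hpos : f.natDegree ≠ 0 := by
      intro h
      rw [h, Nat.coprime_zero_left] at hf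
      exact hp.out.one_lt.ne' hf
    have hf0 : f ≠ 0 := by rintro rfl; simp at hpos
    obtain ⟨q, hq, h, hqh⟩ := WfDvdMonoid.exists_irreducible_factor
      (Polynomial.not_isUnit_of_natDegree_pos f (Nat.pos_of_ne_zero hpos)) hf0
    have hh0 : h ≠ 0 := by rintro rfl; simp at hqh; exact hf0 hqh
    have hdeg : f.natDegree = q.natDegree + h.natDegree := by
      rw [hqh, Polynomial.natDegree_mul hq.ne_zero hh0]
    by_cases hqp : q.natDegree.Coprime p
    · exact ⟨q, hq, ⟨h, hqh⟩, hqp⟩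
    · have hpq : p ∣ q.natDegree := by
        rwa [Nat.coprime_comm, ← (hp.out).dvd_iff_not_coprime] at hqp
      have hhp : h.natDegree.Coprime p := by
        rw [Nat.coprime_comm, (hp.out).coprime_iff_not_dvd] at hf ⊢
        rw [hdeg] at hf
        exact fun h' => hf (dvd_add hpq h')
      obtain ⟨q', h1, h2, h3⟩ := ih h.natDegree (by
        have := hq.natDegree_pos; omega) h hhp rfl
      exact ⟨q', h1, h2.trans ⟨q, by rw [hqh, mul_comm]⟩, h3⟩

namespace HahnSeries

section Root

open Polynomial Module

variable {Γ : Type v} [AddCommGroup Γ] [LinearOrder Γ] [IsOrderedAddMonoid Γ]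

/-- The polynomial `f` over `k((Γ))` has a root in `k₁((Γ))` for some finite extension `k₁/k` of
degree prime to `p`. -/
def HasRootInExt (p : ℕ) {k : Type u} [Field k] (f : (HahnSeries Γ k)[X]) : Prop :=
  ∃ (k₁ : Type u) (_ : Field k₁) (_ : Algebra k k₁), FiniteDimensional k k₁ ∧
    (finrank k k₁).Coprime p ∧ ∃ x, (f.map (mapRingHom Γ (algebraMap k k₁))).eval x = 0

theorem HasRootInExt.of_dvd {p : ℕ} {k : Type u} [Field k] {f g : (HahnSeries Γ k)[X]}
    (hg : HasRootInExt p g) (h : g ∣ f) : HasRootInExt p f := by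
  obtain ⟨k₁, i1, i2, h1, h2, x, hx⟩ := hg
  obtain ⟨q, rfl⟩ := h
  exact ⟨k₁, i1, i2, h1, h2, x, by rw [Polynomial.map_mul, Polynomial.eval_mul, hx, zero_mul]⟩

theorem HasRootInExt.of_comp {p : ℕ} {k : Type u} [Field k] {f g : (HahnSeries Γ k)[X]}
    (hg : HasRootInExt p (f.comp g)) : HasRootInExt p f := by
  obtain ⟨k₁, i1, i2, h1, h2, x, hx⟩ := hg
  exact ⟨k₁, i1, i2, h1, h2, _, by rwa [Polynomial.map_comp, Polynomial.eval_comp] at hx⟩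

theorem HasRootInExt.of_map {p : ℕ} {k k' : Type u} [Field k] [Field k'] [Algebra k k']
    [FiniteDimensional k k'] (hk' : (finrank k k').Coprime p) {f : (HahnSeries Γ k)[X]}
    (hf : HasRootInExt p (f.map (mapRingHom Γ (algebraMap k k')))) : HasRootInExt p f := by
  obtain ⟨k₁, i1, i2, h1, h2, x, hx⟩ := hf
  let _ : Algebra k k₁ := ((algebraMap k' k₁).comp (algebraMap k k')).toAlgebra
  have : IsScalarTower k k' k₁ := IsScalarTower.of_algebraMap_eq fun _ => rfl
  refine ⟨k₁, i1, inferInstance, FiniteDimensional.trans k k' k₁, ?_, x, ?_⟩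
  · rw [← finrank_mul_finrank k k' k₁]
    exact Nat.Coprime.mul_left hk' h2
  · rw [Polynomial.map_map] at hx
    exact hx

theorem HasRootInExt.of_eval {p : ℕ} {k : Type u} [Field k] {f : (HahnSeries Γ k)[X]}
    {x : HahnSeries Γ k} (hx : f.eval x = 0) : HasRootInExt p f := by
  refine ⟨k, inferInstance, inferInstance, inferInstance, by simp, x, ?_⟩
  have : mapRingHom Γ (algebraMap k k) = RingHom.id (HahnSeries Γ k) := by ext; rfl
  rw [this, Polynomial.map_id, hx]

theorem PolyGE.comp {t : WithTop Γ} {k : Type u} [Field k] {P Q : (HahnSeries Γ k)[X]}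
    (hP : PolyGE t P) (hQ : PolyGE 0 Q) : PolyGE t (P.comp Q) := by
  rw [Polynomial.comp_eq_sum_left, Polynomial.sum_def]
  exact PolyGE.sum _ _ _ fun i _ => (PolyGE.C (hP i)).mul_right (hQ.pow i)

/-- The dependence on `r` is affine with slope `n + 1` times the leading coefficient. So when `n +
1` is invertible a shift removes the second coefficient, and only one shift does. -/
theorem _root_.Polynomial.taylor_coeff_pred {R : Type*} [CommRing R] {f : R[X]} {n : ℕ}
    (hf : f.natDegree = n + 1) (r : R) :
    (taylor r f).coeff n = f.coeff n + (n + 1 : ℕ) * f.coeff (n + 1) * r := by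
  rw [Polynomial.taylor_coeff, Polynomial.eval_eq_sum_range' (n := 2)]
  · simp only [Finset.sum_range_succ, Finset.sum_range_zero, Polynomial.hasseDeriv_coeff]
    have h1 : (1 + n).choose n = n + 1 := by rw [add_comm, Nat.choose_succ_self_right]
    rw [h1]
    simp [add_comm 1 n]
  · refine lt_of_le_of_lt (Polynomial.natDegree_hasseDeriv_le f n) ?_
    omega

variable {p : ℕ} [hp : Fact p.Prime]

/-- A proper factorization of a polynomial of degree prime to `p` has a factor of degree
prime to `p`. -/
theorem hasRootInExt_of_dvd_of_lt {k : Type u} [Field k] {n : ℕ} (hn : n.Coprime p)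
    (ih : ∀ g : (HahnSeries Γ k)[X], g.natDegree < n → g.natDegree.Coprime p → HasRootInExt p g)
    {f g : (HahnSeries Γ k)[X]} (hf0 : f ≠ 0) (hf : f.natDegree = n) (hgf : g ∣ f)
    (hg0 : 0 < g.natDegree) (hgn : g.natDegree < n) : HasRootInExt p f := by
  obtain ⟨h, rfl⟩ := hgf
  have hg : g ≠ 0 := left_ne_zero_of_mul hf0
  have hh : h ≠ 0 := right_ne_zero_of_mul hf0
  rw [Polynomial.natDegree_mul hg hh] at hf
  by_cases hgp : g.natDegree.Coprime p
  · exact (ih g hgn hgp).of_dvd (dvd_mul_right _ _)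
  · have hpg : p ∣ g.natDegree := by
      rwa [Nat.coprime_comm, ← (hp.out).dvd_iff_not_coprime] at hgp
    refine (ih h (by omega) ?_).of_dvd (dvd_mul_left _ _)
    rw [Nat.coprime_comm, (hp.out).coprime_iff_not_dvd] at hn ⊢
    rw [← hf] at hn
    exact fun h' => hn (dvd_add hpg h')

theorem orderTop_single_mul {k : Type*} [Field k] (γ : Γ) (x : HahnSeries Γ k) :
    (single γ (1 : k) * x).orderTop = γ + x.orderTop := by
  rw [orderTop_mul, orderTop_single one_ne_zero]

omit [IsOrderedAddMonoid Γ] in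
theorem orderTop_eq_zero_iff {k : Type*} [Field k] {x : HahnSeries Γ k} (hx : 0 ≤ x.orderTop) :
    x.orderTop = 0 ↔ x.coeff 0 ≠ 0 := by
  constructor
  · intro h
    exact coeff_orderTop_ne h
  · intro h
    exact le_antisymm (orderTop_le_of_coeff_ne_zero h) hx

theorem lt_orderTop_of_coeff_eq_zero {k : Type*} [Field k] {x : HahnSeries Γ k}
    (hx : 0 ≤ x.orderTop) (h : x.coeff 0 = 0) : 0 < x.orderTop :=
  lt_of_le_of_ne hx fun h' => (orderTop_eq_zero_iff hx).1 h'.symm h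

/-- The case of a polynomial whose coefficients are integral, with vanishing second coefficient
and unit constant coefficient. -/
theorem hasRootInExt_of_integral {n : ℕ} (hn : (n + 1).Coprime p)
    {k : Type u} [Field k] [CharP k p]
    (ih : ∀ (k' : Type u) [Field k'] [CharP k' p] (g : (HahnSeries Γ k')[X]),
      g.natDegree < n + 1 → g.natDegree.Coprime p → HasRootInExt p g)
    {f : (HahnSeries Γ k)[X]} (hf : f.natDegree = n + 1) (hlead : f.coeff (n + 1) = 1)
    (hsecond : f.coeff n = 0) (hconst : (f.coeff 0).orderTop = 0) (hge : PolyGE 0 f) :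
    HasRootInExt p f := by
  classical
  -- the residue polynomial
  let fb : k[X] := ∑ i ∈ Finset.range (n + 2), Polynomial.C ((f.coeff i).coeff 0) * X ^ i
  have hfb : ∀ i, fb.coeff i = (f.coeff i).coeff 0 := by
    intro i
    simp only [fb, Polynomial.finsetSum_coeff, Polynomial.coeff_C_mul, Polynomial.coeff_X_pow,
      mul_ite, mul_one, mul_zero, Finset.sum_ite_eq, Finset.mem_range]
    split_ifs with h
    · rfl
    · rw [Polynomial.coeff_eq_zero_of_natDegree_lt (by omega)]
      simp
  have hfbdeg : fb.natDegree = n + 1 := by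
    refine le_antisymm ?_ (Polynomial.le_natDegree_of_ne_zero ?_)
    · refine Polynomial.natDegree_le_iff_coeff_eq_zero.2 fun i hi => ?_
      rw [hfb, Polynomial.coeff_eq_zero_of_natDegree_lt (by omega), coeff_zero]
    · rw [hfb, hlead]
      simp
  obtain ⟨q, hq, hqf, hqp⟩ := Polynomial.exists_irreducible_dvd_natDegree_coprime fb
    (hfbdeg ▸ hn)
  have : Fact (Irreducible q) := ⟨hq⟩
  have : FiniteDimensional k (AdjoinRoot q) := (AdjoinRoot.powerBasis hq.ne_zero).finite
  have hrank : (finrank k (AdjoinRoot q)).Coprime p := by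
    rw [(AdjoinRoot.powerBasis hq.ne_zero).finrank, AdjoinRoot.powerBasis_dim]
    exact hqp
  have : CharP (AdjoinRoot q) p := charP_of_injective_algebraMap
    (algebraMap k (AdjoinRoot q)).injective p
  set k₁ := AdjoinRoot q
  set c : k₁ := AdjoinRoot.root q
  have hroot : (fb.map (algebraMap k k₁)).eval c = 0 := by
    obtain ⟨h, hh⟩ := hqf
    rw [Polynomial.eval_map, AdjoinRoot.algebraMap_eq, hh, Polynomial.eval₂_mul,
      AdjoinRoot.eval₂_root, zero_mul]
  refine HasRootInExt.of_map (k' := k₁) hrank ?_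
  set f₁ := f.map (mapRingHom Γ (algebraMap k k₁)) with hf₁
  have hf₁c : ∀ i, f₁.coeff i = mapRingHom Γ (algebraMap k k₁) (f.coeff i) := fun i => by
    rw [hf₁, Polynomial.coeff_map]
  have hf₁deg : f₁.natDegree = n + 1 := by
    rw [hf₁, Polynomial.natDegree_map]
    exact hf
  have hf₁ge : PolyGE 0 f₁ := fun i => le_orderTop_iff_forall.2 fun j hj => by
    rw [hf₁c, coeff_mapRingHom, coeff_eq_zero_of_lt_orderTop (lt_of_lt_of_le hj (hge i)), map_zero]
  let F : k₁[X] := taylor c (fb.map (algebraMap k k₁))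
  have hFdeg : F.natDegree = n + 1 := by
    simp only [F, Polynomial.natDegree_taylor, Polynomial.natDegree_map, hfbdeg]
  let G := taylor (HahnSeries.C c) f₁
  have hGdeg : G.natDegree = n + 1 := by simp only [G, Polynomial.natDegree_taylor, hf₁deg]
  have hCge : ∀ a : k₁, 0 ≤ (HahnSeries.C a : HahnSeries Γ k₁).orderTop := fun a =>
    orderTop_single_le
  have hlin : PolyGE 0 (X + Polynomial.C (HahnSeries.C c) : (HahnSeries Γ k₁)[X]) := by
    refine PolyGE.add ?_ (PolyGE.C (hCge c))
    simpa using PolyGE.X_pow (Γ := Γ) (k := k₁) 1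
  have hGge : PolyGE 0 G := by
    simp only [G, Polynomial.taylor_apply]
    exact hf₁ge.comp hlin
  have hGF : ∀ i, (G.coeff i).coeff 0 = F.coeff i := by
    let ε := f₁ - (fb.map (algebraMap k k₁)).map HahnSeries.C
    have hε : PolyGT 0 ε := fun i => by
      refine lt_orderTop_of_coeff_eq_zero ?_ ?_
      · rw [Polynomial.coeff_sub]
        refine (le_min (hf₁ge i) ?_).trans min_orderTop_le_orderTop_sub
        rw [Polynomial.coeff_map]
        exact hCge _
      · rw [Polynomial.coeff_sub, hf₁c, Polynomial.coeff_map, Polynomial.coeff_map, hfb,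
          coeff_sub, coeff_mapRingHom, HahnSeries.C_apply, coeff_single_same, sub_self]
    have hG : G = F.map HahnSeries.C + ε.comp (X + Polynomial.C (HahnSeries.C c)) := by
      simp only [G, F, ε, Polynomial.taylor_apply, Polynomial.sub_comp, Polynomial.map_comp,
        Polynomial.map_add, Polynomial.map_X, Polynomial.map_C]
      ring
    obtain ⟨s, hs, hεs⟩ := (polyGT_iff (by simp)).1 hε
    intro i
    rw [hG, Polynomial.coeff_add, coeff_add, Polynomial.coeff_map,
      HahnSeries.C_apply, coeff_single_same,
      coeff_eq_zero_of_lt_orderTop (lt_of_lt_of_le hs (hεs.comp hlin i)), add_zero]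
  suffices HasRootInExt p G by
    simp only [G, Polynomial.taylor_apply] at this
    exact this.of_comp
  have hF0 : F.coeff 0 = 0 := by
    simp only [F, Polynomial.taylor_coeff_zero, hroot]
  have hex : ∃ m, F.coeff m ≠ 0 := ⟨n + 1, by
    rw [← hFdeg, Polynomial.coeff_natDegree, Polynomial.leadingCoeff_ne_zero]
    rintro h
    rw [h] at hFdeg
    simp at hFdeg⟩
  have hm := Nat.find_spec hex
  have hmin : ∀ i < Nat.find hex, F.coeff i = 0 := fun i hi => not_not.1 (Nat.find_min hex hi)
  set m := Nat.find hex with hm_def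
  have hm0 : m ≠ 0 := fun h => hm (h ▸ hF0)
  have hmle : m ≤ n + 1 := by
    rw [← hFdeg]
    exact Polynomial.le_natDegree_of_ne_zero hm
  -- If `c` were a root of multiplicity `n + 1`, then both the residue polynomial and its shift by
  -- `c` would have vanishing second coefficient. As `n + 1` is nonzero in `k₁`, this forces `c =
  -- 0`, against the unit constant coefficient.
  have hmn : m < n + 1 := by
    refine lt_of_le_of_ne hmle fun hmn => ?_
    have h1 : F.coeff n = 0 := hmin n (by omega)
    have h2 := Polynomial.taylor_coeff_pred (f := fb.map (algebraMap k k₁)) (n := n)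
      (by rw [Polynomial.natDegree_map, hfbdeg]) c
    rw [show taylor c (fb.map (algebraMap k k₁)) = F from rfl, h1, Polynomial.coeff_map,
      Polynomial.coeff_map, hfb, hfb, hsecond, hlead, coeff_zero, map_zero, zero_add, coeff_one,
      if_pos rfl, map_one, mul_one] at h2
    have hn0 : ((n + 1 : ℕ) : k₁) ≠ 0 := by
      rw [Ne, CharP.cast_eq_zero_iff k₁ p]
      rw [Nat.coprime_comm, (hp.out).coprime_iff_not_dvd] at hn
      exact hn
    have hc0 : c = 0 := (mul_eq_zero.1 h2.symm).resolve_left hn0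
    have h3 : F = fb.map (algebraMap k k₁) := by
      simp only [F, hc0, Polynomial.taylor_zero]
    rw [h3, Polynomial.coeff_map, hfb] at hF0
    refine (orderTop_eq_zero_iff (hge 0)).1 hconst ?_
    exact (map_eq_zero _).1 hF0
  -- After the shift the residue polynomial vanishes at `0` to order exactly `m` with `0 < m < n +
  -- 1`, so preparation gives a proper factor and the induction on the degree applies.
  obtain ⟨g, hgm, hgdeg, hgG⟩ := exists_monic_dvd (m := m) hGge
    (fun i hi => lt_orderTop_of_coeff_eq_zero (hGge i) (by rw [hGF, hmin i hi]))
    ((orderTop_eq_zero_iff (hGge m)).2 (by rw [hGF]; exact hm))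
  exact hasRootInExt_of_dvd_of_lt hn (fun g => ih k₁ g) (by
    rintro h; rw [h] at hGdeg; simp at hGdeg) hGdeg hgG (by omega) (by omega)

/-- Suppose that some coefficient is not integral, and rescale by the least order of a coefficient.
The constant and the leading coefficient had order `0`, so both now have positive order. The residue
polynomial is thus divisible exactly by `X ^ r` with `0 < r < n + 1`, and preparation splits off a
proper factor. -/
theorem hasRootInExt_of_normalized {n : ℕ} (hn : (n + 1).Coprime p)
    {k : Type u} [Field k] [CharP k p]
    (ih : ∀ (k' : Type u) [Field k'] [CharP k' p] (g : (HahnSeries Γ k')[X]),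
      g.natDegree < n + 1 → g.natDegree.Coprime p → HasRootInExt p g)
    {f : (HahnSeries Γ k)[X]} (hf : f.natDegree = n + 1) (hlead : f.coeff (n + 1) = 1)
    (hsecond : f.coeff n = 0) (hconst : (f.coeff 0).orderTop = 0) :
    HasRootInExt p f := by
  classical
  by_cases hge : PolyGE 0 f
  · exact hasRootInExt_of_integral hn ih hf hlead hsecond hconst hge
  have hf0 : f ≠ 0 := by rintro rfl; simp at hf
  obtain ⟨i₀, hi₀⟩ : ∃ i, (f.coeff i).orderTop < 0 := by
    simpa [PolyGE] using hge
  obtain ⟨i₁, hi₁, hmin⟩ := Finset.exists_min_image f.support (fun i => (f.coeff i).orderTop)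
    (Polynomial.support_nonempty.2 hf0)
  have hmin' : ∀ i, (f.coeff i₁).orderTop ≤ (f.coeff i).orderTop := fun i => by
    by_cases hi : i ∈ f.support
    · exact hmin i hi
    · rw [Polynomial.notMem_support_iff.1 hi]
      simp
  have hneg : (f.coeff i₁).orderTop < 0 := lt_of_le_of_lt (hmin' i₀) hi₀
  have hex : ∃ r, (f.coeff r).orderTop = (f.coeff i₁).orderTop := ⟨i₁, rfl⟩
  have hr := Nat.find_spec hex
  have hrmin : ∀ i < Nat.find hex, (f.coeff i₁).orderTop < (f.coeff i).orderTop := fun i hi =>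
    lt_of_le_of_ne (hmin' i) (Ne.symm (Nat.find_min hex hi))
  set r := Nat.find hex
  obtain ⟨γ, hγ⟩ := WithTop.ne_top_iff_exists.1 (hneg.trans_le le_top).ne
  rw [← hγ] at hr hneg hmin' hrmin
  let f₂ := Polynomial.C (single (-γ) (1 : k)) * f
  have hf₂ : ∀ i, (f₂.coeff i).orderTop = ((-γ : Γ) : WithTop Γ) + (f.coeff i).orderTop :=
    fun i => by rw [Polynomial.coeff_C_mul, orderTop_single_mul]
  have hzero : ((-γ : Γ) : WithTop Γ) + (γ : WithTop Γ) = 0 := by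
    rw [← WithTop.coe_add, neg_add_cancel, WithTop.coe_zero]
  obtain ⟨g, hgm, hgdeg, hgf⟩ := exists_monic_dvd (m := r) (f := f₂)
    (fun i => by
      rw [hf₂, ← hzero]
      exact add_le_add le_rfl (hmin' i))
    (fun i hi => by
      rw [hf₂, ← hzero]
      exact WithTop.add_lt_add_left WithTop.coe_ne_top (hrmin i hi))
    (by rw [hf₂, hr, hzero])
  have hr0 : r ≠ 0 := by
    intro h
    rw [h, hconst] at hr
    exact hneg.ne hr.symm
  have hrn : r < n + 1 := by
    by_contra hcon
    rcases (not_lt.1 hcon).eq_or_lt with h | h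
    · rw [← h, hlead, orderTop_one] at hr
      exact hneg.ne hr.symm
    · rw [Polynomial.coeff_eq_zero_of_natDegree_lt (by omega), orderTop_zero] at hr
      exact WithTop.coe_ne_top hr.symm
  have hunit : f₂ ∣ f := by
    refine ⟨Polynomial.C (single γ (1 : k)), ?_⟩
    rw [mul_right_comm, ← Polynomial.C_mul, single_mul_single, neg_add_cancel, mul_one]
    simp
  exact hasRootInExt_of_dvd_of_lt hn (fun g => ih k g) hf0 hf (hgf.trans hunit) (by omega)
    (by omega)

/-- Over `k((Γ))`, where `Γ` is divisible by all integers prime to `p = char k`, a polynomial of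
degree prime to `p` has a root in `k₁((Γ))` for some finite `k₁/k` of degree prime to `p`. -/
theorem hasRootInExt_of_coprime
    (hdiv : ∀ n : ℕ, n.Coprime p → ∀ γ : Γ, ∃ δ : Γ, n • δ = γ)
    (k : Type u) [Field k] [CharP k p] (f : (HahnSeries Γ k)[X]) (hf : f.natDegree.Coprime p) :
    HasRootInExt p f := by
  induction hn : f.natDegree using Nat.strong_induction_on generalizing k f with
  | _ n ih =>
    rw [hn] at hf
    obtain _ | n := n
    · rw [Nat.coprime_zero_left] at hf
      exact absurd hf hp.out.one_lt.ne'
    have ih' : ∀ (k' : Type u) [Field k'] [CharP k' p] (g : (HahnSeries Γ k')[X]),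
        g.natDegree < n + 1 → g.natDegree.Coprime p → HasRootInExt p g :=
      fun k' _ _ g h1 h2 => ih g.natDegree h1 k' g h2 rfl
    have hf0 : f ≠ 0 := by rintro rfl; simp at hn
    -- make `f` monic and remove the second coefficient
    let f₁ := Polynomial.C f.leadingCoeff⁻¹ * f
    have hl : f.leadingCoeff ≠ 0 := Polynomial.leadingCoeff_ne_zero.2 hf0
    have hf₁f : f₁ ∣ f := ⟨Polynomial.C f.leadingCoeff, by
      rw [mul_right_comm, ← Polynomial.C_mul, inv_mul_cancel₀ hl, Polynomial.C_1, one_mul]⟩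
    have hf₁deg : f₁.natDegree = n + 1 := by
      rw [Polynomial.natDegree_C_mul (inv_ne_zero hl), hn]
    have hf₁lead : f₁.coeff (n + 1) = 1 := by
      rw [Polynomial.coeff_C_mul, ← hn, Polynomial.coeff_natDegree, inv_mul_cancel₀ hl]
    have hnk : ((n + 1 : ℕ) : k) ≠ 0 := by
      rw [Ne, CharP.cast_eq_zero_iff k p]
      rw [Nat.coprime_comm, (hp.out).coprime_iff_not_dvd] at hf
      exact hf
    have hnΩ : ((n + 1 : ℕ) : HahnSeries Γ k) ≠ 0 := by
      rw [← map_natCast (HahnSeries.C : k →+* HahnSeries Γ k)]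
      exact HahnSeries.C_ne_zero hnk
    let b := -(f₁.coeff n) / ((n + 1 : ℕ) : HahnSeries Γ k)
    let f₂ := taylor b f₁
    have hf₂deg : f₂.natDegree = n + 1 := by simp only [f₂, Polynomial.natDegree_taylor, hf₁deg]
    have hf₂second : f₂.coeff n = 0 := by
      simp only [f₂, Polynomial.taylor_coeff_pred hf₁deg, hf₁lead, b]
      field_simp
      ring
    have hf₂lead : f₂.coeff (n + 1) = 1 := by
      have h1 : f₁.Monic := by
        rw [Polynomial.Monic, Polynomial.leadingCoeff, hf₁deg, hf₁lead]
      have h2 : f₂.Monic := by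
        simp only [f₂, Polynomial.taylor_apply]
        exact h1.comp_X_add_C b
      rw [← hf₂deg]
      exact h2
    suffices HasRootInExt p f₂ by
      simp only [f₂, Polynomial.taylor_apply] at this
      exact this.of_comp.of_dvd hf₁f
    by_cases hc : f₂.coeff 0 = 0
    · exact HasRootInExt.of_eval (x := 0) (by rw [← Polynomial.coeff_zero_eq_eval_zero, hc])
    obtain ⟨γ, hγ⟩ := WithTop.ne_top_iff_exists.1 (orderTop_ne_top.2 hc)
    -- Divisibility of `Γ` is used here: rescaling the variable by exponent `δ` and the polynomial
    -- by `-γ` gives the constant coefficient order `0` and keeps the leading coefficient `1`.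
    obtain ⟨δ, hδ⟩ := hdiv (n + 1) hf γ
    let f₃ := Polynomial.C (single (-γ) (1 : k)) *
      f₂.comp (Polynomial.C (single δ (1 : k)) * X)
    have hf₃ : ∀ i, f₃.coeff i = single (-γ + i • δ) (1 : k) * f₂.coeff i := by
      intro i
      simp only [f₃, Polynomial.coeff_C_mul, Polynomial.comp_C_mul_X_coeff, single_pow, one_pow]
      rw [mul_comm (f₂.coeff i), ← mul_assoc, single_mul_single, one_mul]
    have hf₃lead : f₃.coeff (n + 1) = 1 := by
      rw [hf₃, hδ, hf₂lead, neg_add_cancel]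
      simp
    have hf₃deg : f₃.natDegree = n + 1 := by
      refine le_antisymm ?_ (Polynomial.le_natDegree_of_ne_zero (by rw [hf₃lead]; exact one_ne_zero))
      refine Polynomial.natDegree_le_iff_coeff_eq_zero.2 fun i hi => ?_
      rw [hf₃, Polynomial.coeff_eq_zero_of_natDegree_lt (by omega), mul_zero]
    have hroot : HasRootInExt p f₃ := hasRootInExt_of_normalized hf ih' hf₃deg hf₃lead
      (by rw [hf₃, hf₂second, mul_zero])
      (by rw [hf₃, zero_smul, add_zero, orderTop_single_mul, ← hγ, ← WithTop.coe_add,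
        neg_add_cancel, WithTop.coe_zero])
    have hdvd : f₃ ∣ f₂.comp (Polynomial.C (single δ (1 : k)) * X) := by
      refine ⟨Polynomial.C (single γ (1 : k)), ?_⟩
      rw [mul_right_comm, ← Polynomial.C_mul, single_mul_single, neg_add_cancel, mul_one]
      simp
    exact (hroot.of_dvd hdvd).of_comp

end Root

end HahnSeries

-- An inseparable irreducible polynomial is a polynomial in `X ^ p`, so `p` divides its degree,
-- which in turn divides the degree of the extension.
open Polynomial Module in
theorem isSeparable_of_finrank_coprime {F₀ E : Type*} [Field F₀] [Field E] [Algebra F₀ E]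
    [FiniteDimensional F₀ E] (p : ℕ) [hp : Fact p.Prime] [CharP F₀ p]
    (h : (finrank F₀ E).Coprime p) : Algebra.IsSeparable F₀ E := by
  refine ⟨fun x => ?_⟩
  have hirr := minpoly.irreducible (Algebra.IsIntegral.isIntegral (R := F₀) x)
  rcases Polynomial.separable_or p hirr with hs | ⟨-, g, -, hg⟩
  · exact hs
  · exfalso
    have h1 : p ∣ (minpoly F₀ x).natDegree := by
      rw [← hg, Polynomial.natDegree_expand]
      exact dvd_mul_left _ _
    have h2 := h1.trans (minpoly.degree_dvd (Algebra.IsIntegral.isIntegral x))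
    rw [Nat.coprime_comm, (hp.out).coprime_iff_not_dvd] at h
    exact h h2

namespace HahnSeries

open Polynomial Module

/-- A finite extension of degree prime to `p` of a subfield of `k((Γ))` embeds into `k₁((Γ))` for
some finite extension `k₁/k` of degree prime to `p`. -/
theorem exists_extension_of_coprime {Γ : Type v} [AddCommGroup Γ] [LinearOrder Γ]
    [IsOrderedAddMonoid Γ] {p : ℕ} [hp : Fact p.Prime]
    (hdiv : ∀ n : ℕ, n.Coprime p → ∀ γ : Γ, ∃ δ : Γ, n • δ = γ)
    (k : Type u) [Field k] [CharP k p] {F₀ E : Type*} [Field F₀] [Field E] [Algebra F₀ E]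
    [FiniteDimensional F₀ E] (h : (finrank F₀ E).Coprime p) (j : F₀ →+* HahnSeries Γ k) :
    ∃ (k₁ : Type u) (_ : Field k₁) (_ : Algebra k k₁), FiniteDimensional k k₁ ∧
      (finrank k k₁).Coprime p ∧ ∃ J : E →+* HahnSeries Γ k₁,
        J.comp (algebraMap F₀ E) = (mapRingHom Γ (algebraMap k k₁)).comp j := by
  have : CharP (HahnSeries Γ k) p :=
    charP_of_injective_ringHom (HahnSeries.C_injective (Γ := Γ) (R := k)) p
  have : CharP F₀ p := (RingHom.charP_iff j j.injective p).2 this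
  have := isSeparable_of_finrank_coprime p h
  let pb := Field.powerBasisOfFiniteOfSeparable F₀ E
  obtain ⟨k₁, i1, i2, h1, h2, x, hx⟩ := hasRootInExt_of_coprime hdiv k
    ((minpoly F₀ pb.gen).map j) (by
      rw [Polynomial.natDegree_map, pb.natDegree_minpoly, ← pb.finrank]
      exact h)
  let _ : Algebra F₀ (HahnSeries Γ k₁) := ((mapRingHom Γ (algebraMap k k₁)).comp j).toAlgebra
  rw [Polynomial.map_map, Polynomial.eval_map] at hx
  refine ⟨k₁, i1, i2, h1, h2, (pb.lift x ?_ : E →+* HahnSeries Γ k₁), ?_⟩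
  · exact hx
  · ext1 y
    exact (pb.lift x hx).commutes y

end HahnSeries

/-! ### Homogeneous components of a ring containing `K'`. -/

section Component

variable {k K' R : Type*} [Field k] [Field K'] [Algebra k K'] [Ring R]

/-- The elements `d` of a ring `R ⊇ K'` with `d κ = τ(κ) d` for all `κ` in `K'`. -/
def homComponent (ι : K' →+* R) (τ : K' ≃ₐ[k] K') : AddSubgroup R where
  carrier := {d | ∀ κ, d * ι κ = ι (τ κ) * d}
  zero_mem' κ := by simp
  add_mem' ha hb κ := by rw [add_mul, ha, hb, mul_add]
  neg_mem' ha κ := by rw [neg_mul, ha, mul_neg]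

variable (k) in
/-- Every component `homComponent ι τ` is `K' z` for a unit `z`. -/
def HasUnitComponents (ι : K' →+* R) : Prop :=
  ∀ τ : K' ≃ₐ[k] K', ∃ z : Rˣ, (z : R) ∈ homComponent ι τ ∧
    ∀ d ∈ homComponent ι τ, ∃ c, d = ι c * z

variable {ι : K' →+* R}

theorem mul_mem_homComponent {τ ρ : K' ≃ₐ[k] K'} {a b : R} (ha : a ∈ homComponent ι τ)
    (hb : b ∈ homComponent ι ρ) : a * b ∈ homComponent ι (τ * ρ) := fun κ => by
  rw [mul_assoc, hb κ, ← mul_assoc, ha, mul_assoc, AlgEquiv.mul_apply]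

theorem map_mem_homComponent (c : K') : ι c ∈ homComponent ι (1 : K' ≃ₐ[k] K') := fun κ => by
  rw [AlgEquiv.one_apply, ← map_mul, ← map_mul, mul_comm]

theorem one_mem_homComponent : (1 : R) ∈ homComponent ι (1 : K' ≃ₐ[k] K') := by
  rw [← map_one ι]
  exact map_mem_homComponent 1

theorem pow_mem_homComponent {τ : K' ≃ₐ[k] K'} {a : R} (ha : a ∈ homComponent ι τ) (n : ℕ) :
    a ^ n ∈ homComponent ι (τ ^ n) := by
  induction n with
  | zero => simpa using one_mem_homComponent
  | succ n ih => rw [pow_succ, pow_succ]; exact mul_mem_homComponent ih ha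

/-- The component of `1` is `K' z` and contains `1 = ι c₀ * z`. So `z` itself lies in `K'`, and with
it the whole component. -/
theorem HasUnitComponents.exists_eq_map (h : HasUnitComponents k ι) {d : R}
    (hd : d ∈ homComponent ι (1 : K' ≃ₐ[k] K')) : ∃ c, d = ι c := by
  obtain ⟨z, -, hz⟩ := h 1
  obtain ⟨c₀, hc₀⟩ := hz 1 one_mem_homComponent
  obtain ⟨c, hc⟩ := hz d hd
  cases subsingleton_or_nontrivial R with
  | inl _ => exact ⟨0, Subsingleton.elim _ _⟩
  | inr _ =>
    have h0 : c₀ ≠ 0 := by rintro rfl; simp at hc₀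
    refine ⟨c * c₀⁻¹, ?_⟩
    have : (z : R) = ι c₀⁻¹ := by
      calc (z : R) = ι (c₀⁻¹ * c₀) * z := by rw [inv_mul_cancel₀ h0]; simp
        _ = ι c₀⁻¹ * (ι c₀ * z) := by rw [map_mul, mul_assoc]
        _ = ι c₀⁻¹ := by rw [← hc₀, mul_one]
    rw [hc, this, map_mul]

theorem HasUnitComponents.isUnit (h : HasUnitComponents k ι) {τ : K' ≃ₐ[k] K'} {d : R}
    (hd : d ∈ homComponent ι τ) (hd0 : d ≠ 0) : IsUnit d := by
  obtain ⟨z, -, hz⟩ := h τ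
  obtain ⟨c, rfl⟩ := hz d hd
  have hc : c ≠ 0 := by rintro rfl; simp at hd0
  exact ((isUnit_iff_ne_zero.2 hc).map ι).mul z.isUnit

theorem HasUnitComponents.mul_ne_zero [Nontrivial R] (h : HasUnitComponents k ι)
    {τ ρ : K' ≃ₐ[k] K'} {a b : R} (ha : a ∈ homComponent ι τ) (hb : b ∈ homComponent ι ρ)
    (ha0 : a ≠ 0) (hb0 : b ≠ 0) : a * b ≠ 0 :=
  ((h.isUnit ha ha0).mul (h.isUnit hb hb0)).ne_zero

/-- There is no unit `d` in a component of order `p` with `d ^ p` in `k`. -/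
def NoCentralPower (p : ℕ) (k : Type*) {K' R : Type*} [Field k] [Field K'] [Algebra k K'] [Ring R]
    (ι : K' →+* R) : Prop :=
  ∀ τ : K' ≃ₐ[k] K', orderOf τ = p → ∀ d ∈ homComponent ι τ, d ≠ 0 →
    ∀ x : k, d ^ p ≠ ι (algebraMap k K' x)

/-- Such an element is purely inseparable over `k`, while `K'/k` is separable. -/
theorem mem_range_of_pow_char_pow_mem {p : ℕ} [Fact p.Prime] [CharP k p]
    [Algebra.IsSeparable k K'] {c : K'} {s : ℕ} (h : c ^ p ^ s ∈ (algebraMap k K').range) :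
    c ∈ (algebraMap k K').range := by
  have h1 : c ∈ perfectClosure k K' := (mem_perfectClosure_iff_pow_mem p).2 ⟨s, h⟩
  rw [perfectClosure.eq_bot_of_isSeparable] at h1
  exact IntermediateField.mem_bot.1 h1

/-- If `τ` has order `p ^ (a + 1)`, then `d ^ p ^ a` lies in a component of order `p`, and its
`p`-th power is an element of `K'` with a `p`-power power in `k`. By separability it lies in `k`,
which is excluded. -/
theorem NoCentralPower.eq_one {p : ℕ} [hp : Fact p.Prime] [CharP k p] [Nontrivial R]
    [Algebra.IsSeparable k K'] (hQ : IsPGroup p (K' ≃ₐ[k] K')) (hι : HasUnitComponents k ι)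
    (h : NoCentralPower p k ι) {τ : K' ≃ₐ[k] K'} {d : R} (hd : d ∈ homComponent ι τ)
    (hd0 : d ≠ 0) {s : ℕ} {x : k} (hx : d ^ p ^ s = ι (algebraMap k K' x)) : τ = 1 := by
  obtain ⟨a, ha⟩ := IsPGroup.iff_orderOf.1 hQ τ
  obtain _ | a := a
  · rwa [pow_zero, orderOf_eq_one_iff] at ha
  exfalso
  have hu := hι.isUnit hd hd0
  have hord : orderOf (τ ^ p ^ a) = p := by
    rw [orderOf_pow_of_dvd (pow_ne_zero _ hp.out.ne_zero) (by rw [ha, pow_succ]; exact dvd_mul_right _ _),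
      ha, pow_succ, Nat.mul_div_cancel_left _ (pow_pos hp.out.pos _)]
  have hmem : (d ^ p ^ a) ^ p ∈ homComponent ι (1 : K' ≃ₐ[k] K') := by
    have := pow_mem_homComponent (pow_mem_homComponent hd (p ^ a)) p
    have h1 : (τ ^ p ^ a) ^ p = 1 := orderOf_dvd_iff_pow_eq_one.1 hord.dvd
    rwa [h1] at this
  obtain ⟨c, hc⟩ := hι.exists_eq_map hmem
  have hcs : c ^ p ^ s ∈ (algebraMap k K').range := by
    refine ⟨x ^ p ^ (a + 1), ι.injective ?_⟩
    rw [map_pow, map_pow, ← hx, map_pow, ← hc, ← pow_mul, ← pow_mul, ← pow_mul]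
    congr 1
    ring
  obtain ⟨y, hy⟩ := mem_range_of_pow_char_pow_mem hcs
  exact h _ hord _ (pow_mem_homComponent hd _) (hu.pow _).ne_zero y (by rw [hc, hy])

end Component

/-! ### The graded ring of Hahn series. -/

namespace HahnSeries

section GradedSubring

variable {k K' R : Type*} [Field k] [Field K'] [Algebra k K'] [Ring R]
variable {Γ : Type*} [AddCommGroup Γ] [LinearOrder Γ] [IsOrderedAddMonoid Γ]

/-- The Hahn series with coefficient at `γ` in the component of `g γ`. -/
def gradedSubring (ι : K' →+* R) (g : Γ →+ Additive (K' ≃ₐ[k] K')) :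
    Subring (HahnSeries Γ R) where
  carrier := {f | ∀ γ, f.coeff γ ∈ homComponent ι (g γ).toMul}
  zero_mem' γ := by simp
  one_mem' γ := by
    rw [coeff_one]
    split_ifs with h
    · rw [h, map_zero, toMul_zero]
      exact one_mem_homComponent
    · exact zero_mem _
  add_mem' ha hb γ := by
    rw [coeff_add]
    exact add_mem (ha γ) (hb γ)
  neg_mem' ha γ := by
    rw [coeff_neg]
    exact neg_mem (ha γ)
  mul_mem' {a b} ha hb γ := by
    rw [coeff_mul]
    refine sum_mem fun x hx => ?_
    rw [Finset.mem_antidiagonal] at hx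
    rw [← hx.2.2, map_add, toMul_add]
    exact mul_mem_homComponent (ha _) (hb _)

variable {ι : K' →+* R} {g : Γ →+ Additive (K' ≃ₐ[k] K')}

/-- Leading coefficients are homogeneous, and nonzero homogeneous elements are units; `R` itself may
have zero divisors. This makes the order a valuation. -/
theorem leadingCoeff_mul_ne_zero [Nontrivial R] (hι : HasUnitComponents k ι)
    {x y : HahnSeries Γ R} (hx : x ∈ gradedSubring ι g) (hy : y ∈ gradedSubring ι g)
    (hx0 : x ≠ 0) (hy0 : y ≠ 0) : x.leadingCoeff * y.leadingCoeff ≠ 0 := by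
  rw [leadingCoeff_eq, leadingCoeff_eq]
  exact hι.mul_ne_zero (hx _) (hy _) (mt coeff_order_eq_zero.1 hx0) (mt coeff_order_eq_zero.1 hy0)

theorem orderTop_mul_of_mem [Nontrivial R] (hι : HasUnitComponents k ι)
    {x y : HahnSeries Γ R} (hx : x ∈ gradedSubring ι g) (hy : y ∈ gradedSubring ι g) :
    (x * y).orderTop = x.orderTop + y.orderTop := by
  by_cases hx0 : x = 0
  · simp [hx0]
  by_cases hy0 : y = 0
  · simp [hy0]
  exact orderTop_mul_of_ne_zero (leadingCoeff_mul_ne_zero hι hx hy hx0 hy0)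

theorem leadingCoeff_mul_of_mem [Nontrivial R] (hι : HasUnitComponents k ι)
    {x y : HahnSeries Γ R} (hx : x ∈ gradedSubring ι g) (hy : y ∈ gradedSubring ι g) :
    (x * y).leadingCoeff = x.leadingCoeff * y.leadingCoeff := by
  by_cases hx0 : x = 0
  · simp [hx0]
  by_cases hy0 : y = 0
  · simp [hy0]
  exact leadingCoeff_mul_of_ne_zero (leadingCoeff_mul_ne_zero hι hx hy hx0 hy0)

theorem noZeroDivisors_gradedSubring [Nontrivial R] (hι : HasUnitComponents k ι) :
    NoZeroDivisors (gradedSubring ι g) where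
  eq_zero_or_eq_zero_of_mul_eq_zero := by
    rintro ⟨x, hx⟩ ⟨y, hy⟩ h
    have h' : x * y = 0 := congrArg Subtype.val h
    have := orderTop_mul_of_mem hι hx hy
    rw [h', orderTop_zero] at this
    rcases WithTop.add_eq_top.1 this.symm with h | h
    · exact Or.inl (Subtype.ext (orderTop_eq_top.1 h))
    · exact Or.inr (Subtype.ext (orderTop_eq_top.1 h))

theorem coeff_zero_mul_of_nonneg {x y : HahnSeries Γ R} (hx : 0 ≤ x.orderTop)
    (hy : 0 ≤ y.orderTop) : (x * y).coeff 0 = x.coeff 0 * y.coeff 0 := by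
  rw [coeff_mul]
  have hnn : ∀ {z : HahnSeries Γ R}, 0 ≤ z.orderTop → ∀ i ∈ z.support, 0 ≤ i := fun hz i hi =>
    WithTop.coe_le_coe.1 (hz.trans (orderTop_le_of_coeff_ne_zero hi))
  refine Finset.sum_eq_single (0, 0) ?_ ?_
  · rintro ⟨a, b⟩ hab hne
    rw [Finset.mem_antidiagonal] at hab
    exfalso
    have h1 := hnn hx a hab.1
    have h2 := hnn hy b hab.2.1
    obtain ⟨h3, h4⟩ := (add_eq_zero_iff_of_nonneg h1 h2).1 hab.2.2
    exact hne (Prod.ext h3 h4)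
  · intro h
    rw [Finset.mem_antidiagonal] at h
    by_contra hcon
    exact h ⟨left_ne_zero_of_mul hcon, right_ne_zero_of_mul hcon, add_zero 0⟩

/-- The embedding of `k((ker g))` in the center of `gradedSubring ι g`. -/
noncomputable def centerHom (ι : K' →+* R) (g : Γ →+ Additive (K' ≃ₐ[k] K')) :
    HahnSeries g.ker k →+* HahnSeries Γ R :=
  (embDomainRingHom g.ker.subtype Subtype.coe_injective
    fun _ _ => Iff.rfl).comp
    (mapRingHom g.ker (ι.comp (algebraMap k K')))

theorem coeff_centerHom_of_mem (ω : HahnSeries g.ker k) (γ : g.ker) :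
    (centerHom ι g ω).coeff γ = ι (algebraMap k K' (ω.coeff γ)) :=
  embDomain_coeff (f := ⟨⟨g.ker.subtype, Subtype.coe_injective⟩, Iff.rfl⟩)
    (x := mapRingHom g.ker (ι.comp (algebraMap k K')) ω) (a := γ)

theorem coeff_centerHom_of_notMem (ω : HahnSeries g.ker k) {γ : Γ} (hγ : γ ∉ g.ker) :
    (centerHom ι g ω).coeff γ = 0 :=
  embDomain_of_notMem_range (f := ⟨⟨g.ker.subtype, Subtype.coe_injective⟩, Iff.rfl⟩)
    (x := mapRingHom g.ker (ι.comp (algebraMap k K')) ω) (by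
      rintro ⟨γ', rfl⟩
      exact hγ γ'.2)

theorem centerHom_mem (ω : HahnSeries g.ker k) : centerHom ι g ω ∈ gradedSubring ι g := by
  intro γ
  by_cases hγ : γ ∈ g.ker
  · rw [coeff_centerHom_of_mem ω ⟨γ, hγ⟩, (AddMonoidHom.mem_ker).1 hγ]
    exact map_mem_homComponent _
  · rw [coeff_centerHom_of_notMem ω hγ]
    exact zero_mem _

theorem orderTop_centerHom [Nontrivial R] (ω : HahnSeries g.ker k) :
    (centerHom ι g ω).orderTop = ω.orderTop.map (fun γ : g.ker => (γ : Γ)) := by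
  have hinj : Function.Injective (ι.comp (algebraMap k K')) := RingHom.injective _
  have h1 := orderTop_embDomain (f := (⟨⟨g.ker.subtype, Subtype.coe_injective⟩, Iff.rfl⟩ : g.ker ↪o Γ))
    (x := mapRingHom g.ker (ι.comp (algebraMap k K')) ω)
  have h2 : (mapRingHom g.ker (ι.comp (algebraMap k K')) ω).orderTop = ω.orderTop := by
    refine le_antisymm ?_ ?_ <;> refine le_orderTop_iff_forall.2 fun γ hγ => ?_
    · have := coeff_eq_zero_of_lt_orderTop hγ
      rw [coeff_mapRingHom] at this
      exact hinj (this.trans (map_zero _).symm)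
    · rw [coeff_mapRingHom, coeff_eq_zero_of_lt_orderTop hγ, map_zero]
  rw [h2] at h1
  exact h1

theorem commute_map_of_mem {x : HahnSeries Γ R} (hx : x ∈ gradedSubring ι g) (c : k) (γ : Γ) :
    x.coeff γ * ι (algebraMap k K' c) = ι (algebraMap k K' c) * x.coeff γ := by
  have := hx γ (algebraMap k K' c)
  rwa [AlgEquiv.commutes] at this

theorem centerHom_commute (ω : HahnSeries g.ker k) {x : HahnSeries Γ R}
    (hx : x ∈ gradedSubring ι g) : centerHom ι g ω * x = x * centerHom ι g ω := by
  ext γ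
  rw [coeff_mul, coeff_mul]
  refine Finset.sum_nbij' Prod.swap Prod.swap ?_ ?_ (fun _ _ => rfl) (fun _ _ => rfl) ?_
  · rintro ⟨a, b⟩ h
    rw [Finset.mem_antidiagonal] at h ⊢
    exact ⟨h.2.1, h.1, (add_comm _ _).trans h.2.2⟩
  · rintro ⟨a, b⟩ h
    rw [Finset.mem_antidiagonal] at h ⊢
    exact ⟨h.2.1, h.1, (add_comm _ _).trans h.2.2⟩
  · rintro ⟨a, b⟩ -
    by_cases ha : a ∈ g.ker
    · simp only [Prod.swap, coeff_centerHom_of_mem ω ⟨a, ha⟩, commute_map_of_mem hx]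
    · simp only [Prod.swap, coeff_centerHom_of_notMem ω ha, zero_mul, mul_zero]

end GradedSubring

end HahnSeries

/-! ### Valuation, residue field and Galois action on a subfield of the graded ring. -/

/-- Hilbert's Theorem 90. -/
theorem exists_unit_of_cocycle {k M : Type*} [Field k] [Field M] [Algebra k M] [FiniteDimensional k M]
    (f : (M ≃ₐ[k] M) → Mˣ) (hf : ∀ σ τ, (f (σ * τ) : M) = σ (f τ : M) * f σ) :
    ∃ β : Mˣ, ∀ σ, (f σ : M) * β = σ (β : M) := by
  have hfc : groupCohomology.IsMulCocycle₁ f := fun σ τ => Units.ext (hf σ τ)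
  obtain ⟨β, hβ⟩ := groupCohomology.isMulCoboundary₁_of_isMulCocycle₁_of_aut_to_units f hfc
  exact ⟨β, fun σ => (congrArg Units.val (div_eq_iff_eq_mul.1 (hβ σ))).symm⟩

namespace HahnSeries

variable {k K' R : Type*} [Field k] [Field K'] [Algebra k K'] [Ring R]
variable {Γ : Type*} [AddCommGroup Γ] [LinearOrder Γ] [IsOrderedAddMonoid Γ]

/-- An embedding of an extension `L` of `k((ker g))` into `gradedSubring ι g`, such that the
automorphisms of `L` preserve the order of series. -/
structure GradedEmbedding (ι : K' →+* R) (g : Γ →+ Additive (K' ≃ₐ[k] K')) (L : Type*) [Field L]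
    [Algebra (HahnSeries g.ker k) L] where
  toRingHom : L →+* HahnSeries Γ R
  mem : ∀ a, toRingHom a ∈ gradedSubring ι g
  comm : ∀ ω, toRingHom (algebraMap _ L ω) = centerHom ι g ω
  orderTop_aut : ∀ (h : L ≃ₐ[HahnSeries g.ker k] L) (a : L),
    (toRingHom (h a)).orderTop = (toRingHom a).orderTop

namespace GradedEmbedding

variable {ι : K' →+* R} {g : Γ →+ Additive (K' ≃ₐ[k] K')} {L : Type*} [Field L]
  [Algebra (HahnSeries g.ker k) L] (ψ : GradedEmbedding ι g L)

/-- The order of the image of an element of `L`. -/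
noncomputable def val (a : L) : WithTop Γ := (ψ.toRingHom a).orderTop

theorem val_zero : ψ.val 0 = ⊤ := by rw [val, map_zero, orderTop_zero]

theorem val_eq_top [Nontrivial R] {a : L} : ψ.val a = ⊤ ↔ a = 0 := by
  rw [val, orderTop_eq_top, map_eq_zero_iff _ ψ.toRingHom.injective]

theorem val_add (a b : L) : min (ψ.val a) (ψ.val b) ≤ ψ.val (a + b) := by
  rw [val, val, val, map_add]
  exact min_orderTop_le_orderTop_add

theorem val_neg (a : L) : ψ.val (-a) = ψ.val a := by
  rw [val, val, map_neg, orderTop_neg]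

theorem val_sub (a b : L) : min (ψ.val a) (ψ.val b) ≤ ψ.val (a - b) := by
  rw [sub_eq_add_neg, ← ψ.val_neg b]
  exact ψ.val_add a (-b)

theorem le_val_sum {α : Type*} (s : Finset α) (f : α → L) (t : WithTop Γ)
    (h : ∀ i ∈ s, t ≤ ψ.val (f i)) : t ≤ ψ.val (∑ i ∈ s, f i) := by
  classical
  induction s using Finset.induction_on with
  | empty => simp [val_zero]
  | insert a s ha ih =>
    rw [Finset.sum_insert ha]
    exact (le_min (h a (Finset.mem_insert_self _ _))
      (ih fun i hi => h i (Finset.mem_insert_of_mem hi))).trans (ψ.val_add _ _)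

theorem val_aut (h : L ≃ₐ[HahnSeries g.ker k] L) (a : L) : ψ.val (h a) = ψ.val a :=
  ψ.orderTop_aut h a

variable [Nontrivial R] (hι : HasUnitComponents k ι)

include hι in
theorem val_mul (a b : L) : ψ.val (a * b) = ψ.val a + ψ.val b := by
  rw [val, val, val, map_mul]
  exact orderTop_mul_of_mem hι (ψ.mem a) (ψ.mem b)

theorem val_one : ψ.val 1 = 0 := by
  rw [val, map_one, orderTop_one]

theorem val_algebraMap (ω : HahnSeries g.ker k) :
    ψ.val (algebraMap _ L ω) = ω.orderTop.map (fun γ : g.ker => (γ : Γ)) := by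
  rw [val, ψ.comm, orderTop_centerHom]

theorem val_algebraMap_nonneg {ω : HahnSeries g.ker k} (h : 0 ≤ ω.orderTop) :
    0 ≤ ψ.val (algebraMap _ L ω) := by
  rw [val_algebraMap]
  have : (0 : WithTop Γ) = (0 : WithTop g.ker).map (fun γ : g.ker => (γ : Γ)) := by simp
  rw [this]
  exact Monotone.withTop_map (f := fun γ : g.ker => (γ : Γ)) (fun _ _ h => h) h

include hι in
omit [Nontrivial R] in
theorem exists_res (a : L) : ∃ c : K', (ψ.toRingHom a).coeff 0 = ι c := by
  have := ψ.mem a 0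
  rw [map_zero, toMul_zero] at this
  exact hι.exists_eq_map this

/-- The residue of an element of `L`, which is meaningful for elements of nonnegative order. -/
noncomputable def res (a : L) : K' := (ψ.exists_res hι a).choose

omit [Nontrivial R] in
theorem map_res (a : L) : ι (ψ.res hι a) = (ψ.toRingHom a).coeff 0 :=
  (ψ.exists_res hι a).choose_spec.symm

theorem res_eq_iff {a : L} {c : K'} : ψ.res hι a = c ↔ (ψ.toRingHom a).coeff 0 = ι c := by
  rw [← map_res ψ hι, ι.injective.eq_iff]

theorem res_add (a b : L) : ψ.res hι (a + b) = ψ.res hι a + ψ.res hι b := by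
  rw [res_eq_iff, map_add, map_add, coeff_add, map_res, map_res]

theorem res_neg (a : L) : ψ.res hι (-a) = -ψ.res hι a := by
  rw [res_eq_iff, map_neg, map_neg, coeff_neg, map_res]

theorem res_sub (a b : L) : ψ.res hι (a - b) = ψ.res hι a - ψ.res hι b := by
  rw [sub_eq_add_neg, res_add, res_neg, sub_eq_add_neg]

theorem res_zero : ψ.res hι 0 = 0 := by
  rw [res_eq_iff, map_zero, map_zero, coeff_zero]

theorem res_one : ψ.res hι 1 = 1 := by
  rw [res_eq_iff, map_one, map_one, coeff_one, if_pos rfl]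

theorem res_mul {a b : L} (ha : 0 ≤ ψ.val a) (hb : 0 ≤ ψ.val b) :
    ψ.res hι (a * b) = ψ.res hι a * ψ.res hι b := by
  rw [res_eq_iff, map_mul, map_mul, coeff_zero_mul_of_nonneg ha hb, map_res, map_res]

theorem res_algebraMap (ω : HahnSeries g.ker k) :
    ψ.res hι (algebraMap _ L ω) = algebraMap k K' (ω.coeff 0) := by
  rw [res_eq_iff, ψ.comm]
  exact coeff_centerHom_of_mem ω 0

theorem val_pos_iff {a : L} (ha : 0 ≤ ψ.val a) : 0 < ψ.val a ↔ ψ.res hι a = 0 := by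
  rw [res_eq_iff, map_zero]
  constructor
  · exact fun h => coeff_eq_zero_of_lt_orderTop h
  · intro h
    exact lt_of_le_of_ne ha fun h' => orderTop_ne_of_coeff_eq_zero h h'.symm

theorem val_eq_zero_of_res_ne_zero {a : L} (ha : 0 ≤ ψ.val a) (h : ψ.res hι a ≠ 0) :
    ψ.val a = 0 :=
  le_antisymm (not_lt.1 fun h' => h ((ψ.val_pos_iff hι ha).1 h')) ha

theorem res_ne_zero_of_val_eq_zero {a : L} (ha : ψ.val a = 0) : ψ.res hι a ≠ 0 := fun h =>
  ((ψ.val_pos_iff hι ha.ge).2 h).ne' ha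

include hι in
theorem val_mul_nonneg {a b : L} (ha : 0 ≤ ψ.val a) (hb : 0 ≤ ψ.val b) : 0 ≤ ψ.val (a * b) := by
  rw [val_mul ψ hι]
  exact add_nonneg ha hb

include hι in
theorem val_inv_of_val_eq_zero {a : L} (ha : ψ.val a = 0) : ψ.val a⁻¹ = 0 := by
  have ha0 : a ≠ 0 := by
    rintro rfl
    rw [val_zero] at ha
    exact WithTop.top_ne_zero ha
  have := ψ.val_mul hι a a⁻¹
  rw [mul_inv_cancel₀ ha0, val_one, ha, zero_add] at this
  exact this.symm

include hι in
theorem val_div_of_val_eq {a b : L} (hb : b ≠ 0) (h : ψ.val a = ψ.val b) : ψ.val (a / b) = 0 := by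
  have h1 := ψ.val_mul hι (a / b) b
  rw [div_mul_cancel₀ _ hb, h] at h1
  have hne : ψ.val b ≠ ⊤ := mt ψ.val_eq_top.1 hb
  obtain ⟨γ, hγ⟩ := WithTop.ne_top_iff_exists.1 hne
  rw [← hγ] at h1
  cases hx : ψ.val (a / b) with
  | top => rw [hx] at h1; simp at h1
  | coe x =>
    rw [hx, ← WithTop.coe_add, WithTop.coe_inj] at h1
    simpa using h1

theorem res_prod {α : Type*} (s : Finset α) (f : α → L) (h : ∀ i ∈ s, 0 ≤ ψ.val (f i)) :
    0 ≤ ψ.val (∏ i ∈ s, f i) ∧ ψ.res hι (∏ i ∈ s, f i) = ∏ i ∈ s, ψ.res hι (f i) := by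
  classical
  induction s using Finset.induction_on with
  | empty => simp [val_one, res_one]
  | insert a s ha ih =>
    have h1 := ih fun i hi => h i (Finset.mem_insert_of_mem hi)
    have h2 := h a (Finset.mem_insert_self _ _)
    rw [Finset.prod_insert ha, Finset.prod_insert ha, res_mul ψ hι h2 h1.1, h1.2]
    exact ⟨ψ.val_mul_nonneg hι h2 h1.1, rfl⟩

/-- The residue field of `L`, as a subfield of `K'`. -/
noncomputable def residueField : IntermediateField k K' where
  carrier := {c | ∃ a, 0 ≤ ψ.val a ∧ ψ.res hι a = c}
  mul_mem' := by
    rintro _ _ ⟨a, ha, rfl⟩ ⟨b, hb, rfl⟩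
    exact ⟨a * b, ψ.val_mul_nonneg hι ha hb, ψ.res_mul hι ha hb⟩
  add_mem' := by
    rintro _ _ ⟨a, ha, rfl⟩ ⟨b, hb, rfl⟩
    exact ⟨a + b, (le_min ha hb).trans (ψ.val_add a b), ψ.res_add hι a b⟩
  algebraMap_mem' x := ⟨algebraMap _ L (HahnSeries.C x),
    ψ.val_algebraMap_nonneg orderTop_single_le, by
      rw [res_algebraMap, HahnSeries.C_apply, coeff_single_same]⟩
  inv_mem' := by
    rintro _ ⟨a, ha, rfl⟩
    by_cases h : ψ.res hι a = 0
    · exact ⟨0, by rw [val_zero]; exact le_top, by rw [h, inv_zero, res_zero]⟩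
    · have h0 := ψ.val_eq_zero_of_res_ne_zero hι ha h
      have h1 := ψ.val_inv_of_val_eq_zero hι h0
      refine ⟨a⁻¹, h1.ge, eq_inv_of_mul_eq_one_left ?_⟩
      have ha0 : a ≠ 0 := by
        rintro rfl
        exact h (ψ.res_zero hι)
      rw [← ψ.res_mul hι h1.ge ha, inv_mul_cancel₀ ha0, res_one]

theorem mem_residueField {c : K'} :
    c ∈ ψ.residueField hι ↔ ∃ a, 0 ≤ ψ.val a ∧ ψ.res hι a = c := Iff.rfl

/-- A lift of an element of the residue field. -/
noncomputable def lift (x : ψ.residueField hι) : L := ((ψ.mem_residueField hι).1 x.2).choose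

theorem val_lift (x : ψ.residueField hι) : 0 ≤ ψ.val (ψ.lift hι x) :=
  ((ψ.mem_residueField hι).1 x.2).choose_spec.1

theorem res_lift (x : ψ.residueField hι) : ψ.res hι (ψ.lift hι x) = x :=
  ((ψ.mem_residueField hι).1 x.2).choose_spec.2

/-- The difference of the two elements has positive order, and automorphisms preserve the order. So
they pass to residues. -/
theorem res_aut_eq_of_res_eq (h : L ≃ₐ[HahnSeries g.ker k] L) {a b : L} (ha : 0 ≤ ψ.val a)
    (hb : 0 ≤ ψ.val b) (hab : ψ.res hι a = ψ.res hι b) : ψ.res hι (h a) = ψ.res hι (h b) := by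
  have h1 : 0 < ψ.val (a - b) := by
    rw [ψ.val_pos_iff hι ((le_min ha hb).trans (ψ.val_sub a b)), res_sub, hab, sub_self]
  rw [← ψ.val_aut h] at h1
  have h2 := (ψ.val_pos_iff hι h1.le).1 h1
  rwa [map_sub, res_sub, sub_eq_zero] at h2

/-- The map of residue fields induced by an automorphism. -/
noncomputable def resAutFun (h : L ≃ₐ[HahnSeries g.ker k] L) (x : ψ.residueField hι) :
    ψ.residueField hι :=
  ⟨ψ.res hι (h (ψ.lift hι x)), h (ψ.lift hι x), by rw [ψ.val_aut]; exact ψ.val_lift hι x, rfl⟩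

theorem coe_resAutFun (h : L ≃ₐ[HahnSeries g.ker k] L) (x : ψ.residueField hι) {a : L}
    (ha : 0 ≤ ψ.val a) (hax : ψ.res hι a = x) :
    (ψ.resAutFun hι h x : K') = ψ.res hι (h a) :=
  ψ.res_aut_eq_of_res_eq hι h (ψ.val_lift hι x) ha ((ψ.res_lift hι x).trans hax.symm)

theorem resAutFun_mul (h h' : L ≃ₐ[HahnSeries g.ker k] L) (x : ψ.residueField hι) :
    ψ.resAutFun hι (h * h') x = ψ.resAutFun hι h (ψ.resAutFun hι h' x) := by
  refine Subtype.ext ?_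
  rw [ψ.coe_resAutFun hι (h * h') x (ψ.val_lift hι x) (ψ.res_lift hι x),
    ψ.coe_resAutFun hι h (ψ.resAutFun hι h' x) (a := h' (ψ.lift hι x))
      (by rw [ψ.val_aut]; exact ψ.val_lift hι x) rfl, AlgEquiv.mul_apply]

theorem resAutFun_one (x : ψ.residueField hι) : ψ.resAutFun hι 1 x = x := by
  refine Subtype.ext ?_
  rw [ψ.coe_resAutFun hι 1 x (ψ.val_lift hι x) (ψ.res_lift hι x), AlgEquiv.one_apply, res_lift]

/-- The homomorphism of residue fields induced by an automorphism. -/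
noncomputable def resAlgHom (h : L ≃ₐ[HahnSeries g.ker k] L) :
    ψ.residueField hι →ₐ[k] ψ.residueField hι where
  toFun := ψ.resAutFun hι h
  map_one' := Subtype.ext (by
    rw [ψ.coe_resAutFun hι h 1 (a := 1) (by rw [val_one]) (by rw [res_one]; rfl), map_one, res_one]
    rfl)
  map_mul' x y := Subtype.ext (by
    have hx := ψ.val_lift hι x
    have hy := ψ.val_lift hι y
    rw [ψ.coe_resAutFun hι h (x * y) (a := ψ.lift hι x * ψ.lift hι y) (ψ.val_mul_nonneg hι hx hy)
      (by rw [ψ.res_mul hι hx hy, res_lift, res_lift]; rfl), map_mul,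
      ψ.res_mul hι (by rwa [ψ.val_aut]) (by rwa [ψ.val_aut])]
    rfl)
  map_zero' := Subtype.ext (by
    rw [ψ.coe_resAutFun hι h 0 (a := 0) (by rw [val_zero]; exact le_top) (by rw [res_zero]; rfl),
      map_zero, res_zero]
    rfl)
  map_add' x y := Subtype.ext (by
    have hx := ψ.val_lift hι x
    have hy := ψ.val_lift hι y
    rw [ψ.coe_resAutFun hι h (x + y) (a := ψ.lift hι x + ψ.lift hι y)
      ((le_min hx hy).trans (ψ.val_add _ _))
      (by rw [ψ.res_add hι, res_lift, res_lift]; rfl), map_add, ψ.res_add hι]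
    rfl)
  commutes' x := Subtype.ext (by
    rw [ψ.coe_resAutFun hι h _ (a := algebraMap _ L (HahnSeries.C x))
      (ψ.val_algebraMap_nonneg orderTop_single_le)
      (by rw [res_algebraMap, HahnSeries.C_apply, coeff_single_same]; rfl),
      AlgEquiv.commutes, res_algebraMap, HahnSeries.C_apply, coeff_single_same]
    rfl)

/-- The action of the automorphisms of `L` on the residue field. -/
noncomputable def resAut :
    (L ≃ₐ[HahnSeries g.ker k] L) →* (ψ.residueField hι ≃ₐ[k] ψ.residueField hι) where
  toFun h := AlgEquiv.ofAlgHom (ψ.resAlgHom hι h) (ψ.resAlgHom hι h⁻¹)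
    (AlgHom.ext fun x => by
      change ψ.resAutFun hι h (ψ.resAutFun hι h⁻¹ x) = x
      rw [← resAutFun_mul, mul_inv_cancel, resAutFun_one])
    (AlgHom.ext fun x => by
      change ψ.resAutFun hι h⁻¹ (ψ.resAutFun hι h x) = x
      rw [← resAutFun_mul, inv_mul_cancel, resAutFun_one])
  map_one' := AlgEquiv.ext fun x => ψ.resAutFun_one hι x
  map_mul' h h' := AlgEquiv.ext fun x => ψ.resAutFun_mul hι h h' x

theorem coe_resAut (h : L ≃ₐ[HahnSeries g.ker k] L) (x : ψ.residueField hι) {a : L}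
    (ha : 0 ≤ ψ.val a) (hax : ψ.res hι a = x) : (ψ.resAut hι h x : K') = ψ.res hι (h a) :=
  ψ.coe_resAutFun hι h x ha hax

variable {p : ℕ} [hp : Fact p.Prime] [CharP k p]
  [FiniteDimensional (HahnSeries g.ker k) L] [IsGalois (HahnSeries g.ker k) L]

/-- All conjugates of a lift of `x` have residue `x`, so its norm has residue `x ^ p ^ s`. The norm
lies in `k((ker g))`, hence `x ^ p ^ s` is in `k`, and `x` is in `k` by separability. -/
theorem mem_bot_of_resAut_eq [Algebra.IsSeparable k K'] {s : ℕ}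
    (hs : Nat.card (L ≃ₐ[HahnSeries g.ker k] L) = p ^ s) (x : ψ.residueField hι)
    (hx : ∀ h, ψ.resAut hι h x = x) : x ∈ (⊥ : IntermediateField k (ψ.residueField hι)) := by
  classical
  have hnorm := Algebra.norm_eq_prod_automorphisms (HahnSeries g.ker k) (ψ.lift hι x)
  have h1 := ψ.res_prod hι Finset.univ
    (fun h : L ≃ₐ[HahnSeries g.ker k] L => h (ψ.lift hι x))
    fun h _ => by rw [ψ.val_aut]; exact ψ.val_lift hι x
  have h2 : ∀ h : L ≃ₐ[HahnSeries g.ker k] L, ψ.res hι (h (ψ.lift hι x)) = x := fun h => by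
    rw [← ψ.coe_resAut hι h x (ψ.val_lift hι x) (ψ.res_lift hι x), hx]
  rw [← hnorm, res_algebraMap] at h1
  simp only [h2, Finset.prod_const, Finset.card_univ] at h1
  rw [← Nat.card_eq_fintype_card, hs] at h1
  obtain ⟨y, hy⟩ := mem_range_of_pow_char_pow_mem (p := p) (c := (x : K')) (s := s) ⟨_, h1.2⟩
  exact IntermediateField.mem_bot.2 ⟨y, Subtype.ext hy⟩

theorem fixedField_range_resAut [Algebra.IsSeparable k K'] {s : ℕ}
    (hs : Nat.card (L ≃ₐ[HahnSeries g.ker k] L) = p ^ s) :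
    IntermediateField.fixedField (ψ.resAut hι).range = ⊥ := by
  refine le_antisymm (fun x hx => ?_) bot_le
  refine ψ.mem_bot_of_resAut_eq hι hs x fun h => ?_
  exact (IntermediateField.mem_fixedField_iff _ _).1 hx _ ⟨h, rfl⟩

variable [FiniteDimensional k K']

theorem resAut_surjective [Algebra.IsSeparable k K'] {s : ℕ}
    (hs : Nat.card (L ≃ₐ[HahnSeries g.ker k] L) = p ^ s) :
    Function.Surjective (ψ.resAut hι) := by
  rw [← MonoidHom.range_eq_top, ← IntermediateField.fixingSubgroup_fixedField (ψ.resAut hι).range,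
    ψ.fixedField_range_resAut hι hs, IntermediateField.fixingSubgroup_bot]

theorem isGalois_residueField [Algebra.IsSeparable k K'] {s : ℕ}
    (hs : Nat.card (L ≃ₐ[HahnSeries g.ker k] L) = p ^ s) : IsGalois k (ψ.residueField hι) := by
  refine IsGalois.of_fixedField_eq_bot _ _ ?_
  rw [← MonoidHom.range_eq_top.2 (ψ.resAut_surjective hι hs), ψ.fixedField_range_resAut hι hs]

/-- Multiplying by a unit makes the leading term of an element invariant. -/
theorem exists_invariant [Algebra.IsSeparable k K'] {s : ℕ}
    (hs : Nat.card (L ≃ₐ[HahnSeries g.ker k] L) = p ^ s) {θ : L} (hθ : θ ≠ 0) :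
    ∃ θ' : L, θ' ≠ 0 ∧ ψ.val θ' = ψ.val θ ∧
      ∀ h : L ≃ₐ[HahnSeries g.ker k] L, ψ.val (h θ' / θ') = 0 ∧ ψ.res hι (h θ' / θ') = 1 := by
  classical
  have hv : ∀ h : L ≃ₐ[HahnSeries g.ker k] L, ψ.val (h θ / θ) = 0 := fun h =>
    ψ.val_div_of_val_eq hι hθ (ψ.val_aut h θ)
  -- The residues of `h θ / θ` form a 1-cocycle for the action on the residue field.
  let c : (L ≃ₐ[HahnSeries g.ker k] L) → ψ.residueField hι := fun h =>
    ⟨ψ.res hι (h θ / θ), _, (hv h).ge, rfl⟩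
  have hc0 : ∀ h, c h ≠ 0 := fun h h0 =>
    ψ.res_ne_zero_of_val_eq_zero hι (hv h) (congrArg Subtype.val h0)
  have hcoc : ∀ h h', c (h * h') = ψ.resAut hι h (c h') * c h := by
    intro h h'
    refine Subtype.ext ?_
    change ψ.res hι ((h * h') θ / θ) = (ψ.resAut hι h (c h') : K') * ψ.res hι (h θ / θ)
    rw [ψ.coe_resAut hι h (c h') (a := h' θ / θ) (hv h').ge rfl,
      ← ψ.res_mul hι (by rw [ψ.val_aut]; exact (hv h').ge) (hv h).ge, map_div₀,
      AlgEquiv.mul_apply, div_mul_div_cancel₀ (by simpa using hθ)]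
  have hc1 : c 1 = 1 := Subtype.ext (by
    change ψ.res hι ((1 : L ≃ₐ[HahnSeries g.ker k] L) θ / θ) = 1
    rw [AlgEquiv.one_apply, div_self hθ, res_one])
  -- On automorphisms acting trivially on residues the cocycle is multiplicative, so its values are
  -- `p ^ s`-th roots of unity, which are trivial in characteristic `p`.
  have hker : ∀ h, ψ.resAut hι h = 1 → c h = 1 := by
    intro h hh
    have hpow : ∀ n : ℕ, c (h ^ n) = c h ^ n := by
      intro n
      induction n with
      | zero => rw [pow_zero, pow_zero, hc1]
      | succ n ih => rw [pow_succ', pow_succ', hcoc, hh, ih, AlgEquiv.one_apply, mul_comm]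
    have h1 : c h ^ p ^ s = 1 := by rw [← hpow, ← hs, pow_card_eq_one', hc1]
    have : CharP (ψ.residueField hι) p :=
      charP_of_injective_algebraMap (algebraMap k (ψ.residueField hι)).injective p
    have h2 : (c h - 1) ^ p ^ s = 0 := by
      rw [sub_pow_char_pow, h1, one_pow, sub_self]
    exact sub_eq_zero.1 (pow_eq_zero_iff (pow_ne_zero _ hp.out.ne_zero) |>.1 h2)
  have hwell : ∀ h h', ψ.resAut hι h = ψ.resAut hι h' → c h = c h' := by
    intro h h' hh
    have h1 := hcoc h' (h'⁻¹ * h)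
    rw [hker (h'⁻¹ * h) (by rw [map_mul, map_inv, hh, inv_mul_cancel]), mul_inv_cancel_left,
      map_one, one_mul] at h1
    exact h1
  have hsurj := ψ.resAut_surjective hι hs
  -- By `hwell` the cocycle descends to the Galois group of the residue field, where Hilbert 90
  -- writes it as `σ β / β`.
  let f : (ψ.residueField hι ≃ₐ[k] ψ.residueField hι) → (ψ.residueField hι)ˣ := fun σ =>
    Units.mk0 (c (hsurj σ).choose) (hc0 _)
  have hf : ∀ h, f (ψ.resAut hι h) = Units.mk0 (c h) (hc0 h) := fun h =>
    Units.ext (hwell _ _ (hsurj (ψ.resAut hι h)).choose_spec)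
  obtain ⟨β, hβ'⟩ := exists_unit_of_cocycle f (by
    intro σ τ
    obtain ⟨h, rfl⟩ := hsurj σ
    obtain ⟨h', rfl⟩ := hsurj τ
    rw [← map_mul, hf, hf, hf]
    exact hcoc h h')
  -- Dividing `θ` by a lift of `β` divides every residue `c h` by the residue of `h b / b`, which is
  -- `c h` again.
  let b := ψ.lift hι β
  have hbv : ψ.val b = 0 := ψ.val_eq_zero_of_res_ne_zero hι (ψ.val_lift hι _) (by
    rw [res_lift]
    exact fun h => β.ne_zero (Subtype.ext h))
  have hb0 : b ≠ 0 := by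
    intro h
    rw [h, val_zero] at hbv
    exact WithTop.top_ne_zero hbv
  have hbinv := ψ.val_inv_of_val_eq_zero hι hbv
  refine ⟨θ / b, div_ne_zero hθ hb0, by rw [div_eq_mul_inv, ψ.val_mul hι, hbinv, add_zero],
    fun h => ⟨ψ.val_div_of_val_eq hι (div_ne_zero hθ hb0) (ψ.val_aut h _), ?_⟩⟩
  have hhb : ψ.val (h b / b) = 0 := ψ.val_div_of_val_eq hι hb0 (ψ.val_aut h b)
  have h1 : h (θ / b) / (θ / b) * (h b / b) = h θ / θ := by
    have : h b ≠ 0 := by simpa using hb0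
    rw [map_div₀]
    field_simp
  have h2 : ψ.res hι (h b / b) = ψ.res hι (h θ / θ) := by
    have h3 : ψ.res hι (h θ / θ) * (β : ψ.residueField hι) =
        (ψ.resAut hι h (β : ψ.residueField hι) : K') := by
      rw [← hβ', hf]
      rfl
    have h4 : ψ.res hι (h b / b) * (β : ψ.residueField hι) =
        (ψ.resAut hι h (β : ψ.residueField hι) : K') := by
      have h5 := ψ.res_mul hι hhb.ge hbv.ge
      rw [div_mul_cancel₀ _ hb0, ψ.res_lift hι, ← ψ.coe_resAut hι h β (ψ.val_lift hι _)
        (ψ.res_lift hι _)] at h5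
      exact h5.symm
    have hβ0 : ((β : ψ.residueField hι) : K') ≠ 0 := fun h => β.ne_zero (Subtype.ext h)
    exact mul_right_cancel₀ hβ0 (h4.trans h3.symm)
  have h3 := ψ.res_mul hι (ψ.val_div_of_val_eq hι (div_ne_zero hθ hb0) (ψ.val_aut h (θ / b))).ge
    hhb.ge
  rw [h1, h2] at h3
  exact (mul_eq_right₀ (ψ.res_ne_zero_of_val_eq_zero hι (hv h))).1 h3.symm

end GradedEmbedding

end HahnSeries

/-! ### Absence of ramification and comparison of Galois groups. -/

namespace HahnSeries

variable {k K' R : Type*} [Field k] [Field K'] [Algebra k K'] [Ring R]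
variable {Γ : Type*} [AddCommGroup Γ] [LinearOrder Γ] [IsOrderedAddMonoid Γ]

theorem leadingCoeff_eq_coeff_of_orderTop_eq {R Γ : Type*} [Zero R] [PartialOrder Γ]
    {x : HahnSeries Γ R} {γ : Γ} (h : x.orderTop = γ) : x.leadingCoeff = x.coeff γ := by
  rw [leadingCoeff, h]
  rfl

theorem leadingCoeff_pow_of_mem [Nontrivial R] {ι : K' →+* R}
    {g : Γ →+ Additive (K' ≃ₐ[k] K')} (hι : HasUnitComponents k ι) {x : HahnSeries Γ R}
    (hx : x ∈ gradedSubring ι g) (n : ℕ) : (x ^ n).leadingCoeff = x.leadingCoeff ^ n := by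
  induction n with
  | zero => simp
  | succ n ih => rw [pow_succ, pow_succ, leadingCoeff_mul_of_mem hι (pow_mem hx n) hx, ih]

namespace GradedEmbedding

variable {ι : K' →+* R} {g : Γ →+ Additive (K' ≃ₐ[k] K')} {L : Type*} [Field L]
  [Algebra (HahnSeries g.ker k) L] (ψ : GradedEmbedding ι g L)
  [Nontrivial R] (hι : HasUnitComponents k ι)
  {p : ℕ} [hp : Fact p.Prime] [CharP k p]
  [FiniteDimensional (HahnSeries g.ker k) L] [IsGalois (HahnSeries g.ker k) L]
  [FiniteDimensional k K'] [Algebra.IsSeparable k K']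

include hι in
/-- The extension `L` is unramified. -/
theorem exists_val_eq_coe_ker (hQ : IsPGroup p (K' ≃ₐ[k] K')) (hND : NoCentralPower p k ι) {s : ℕ}
    (hs : Nat.card (L ≃ₐ[HahnSeries g.ker k] L) = p ^ s) {θ : L} (hθ : θ ≠ 0) :
    ∃ γ : g.ker, ψ.val θ = (γ : Γ) := by
  classical
  obtain ⟨θ', hθ'0, hval, hθ'⟩ := ψ.exists_invariant hι hs hθ
  obtain ⟨γ, hγ⟩ := WithTop.ne_top_iff_exists.1 (mt ψ.val_eq_top.1 hθ'0)
  have hlc := leadingCoeff_eq_coeff_of_orderTop_eq hγ.symm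
  have hlcmem : (ψ.toRingHom θ').leadingCoeff ∈ homComponent ι (g γ).toMul := by
    rw [hlc]
    exact ψ.mem θ' γ
  have hlc0 : (ψ.toRingHom θ').leadingCoeff ≠ 0 := by
    rw [hlc]
    exact coeff_orderTop_ne hγ.symm
  -- The norm of `θ'` is `θ' ^ p ^ s * u`, and `u` has leading coefficient `1`. The norm has leading
  -- coefficient in `k`, hence so has `θ' ^ p ^ s`. With `hND` this puts the leading coefficient of
  -- `θ'` in the component of `1`, which means that its exponent is in `ker g`.
  let u := ∏ h : L ≃ₐ[HahnSeries g.ker k] L, h θ' / θ'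
  have hu := ψ.res_prod hι Finset.univ (fun h : L ≃ₐ[HahnSeries g.ker k] L => h θ' / θ')
    fun h _ => (hθ' h).1.ge
  have hures : ψ.res hι u = 1 := by
    rw [hu.2]
    exact Finset.prod_eq_one fun h _ => (hθ' h).2
  have huval : ψ.val u = 0 := ψ.val_eq_zero_of_res_ne_zero hι hu.1 (by
    rw [hures]; exact one_ne_zero)
  have hlcu : (ψ.toRingHom u).leadingCoeff = 1 := by
    rw [leadingCoeff_eq_coeff_of_orderTop_eq (γ := 0) huval, ← ψ.map_res hι, hures, map_one]
  have hnorm := Algebra.norm_eq_prod_automorphisms (HahnSeries g.ker k) θ'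
  have hprod : ∏ h : L ≃ₐ[HahnSeries g.ker k] L, h θ' = θ' ^ p ^ s * u := by
    rw [← hs, Nat.card_eq_fintype_card, ← Finset.card_univ, ← Finset.prod_const,
      ← Finset.prod_mul_distrib]
    exact Finset.prod_congr rfl fun h _ => (mul_div_cancel₀ _ hθ'0).symm
  rw [hprod] at hnorm
  set ω := Algebra.norm (HahnSeries g.ker k) θ'
  have h1 : (ψ.toRingHom θ').leadingCoeff ^ p ^ s = (centerHom ι g ω).leadingCoeff := by
    rw [← ψ.comm, hnorm, map_mul, map_pow, leadingCoeff_mul_of_mem hι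
      (pow_mem (ψ.mem θ') _) (ψ.mem u), hlcu, mul_one, leadingCoeff_pow_of_mem hι (ψ.mem θ')]
  obtain ⟨x, hx⟩ : ∃ x : k, (centerHom ι g ω).leadingCoeff = ι (algebraMap k K' x) := by
    rw [leadingCoeff_eq]
    by_cases hmem : (centerHom ι g ω).order ∈ g.ker
    · exact ⟨_, coeff_centerHom_of_mem ω ⟨_, hmem⟩⟩
    · exact ⟨0, by rw [coeff_centerHom_of_notMem ω hmem, map_zero, map_zero]⟩
  have h2 := hND.eq_one hQ hι hlcmem hlc0 (h1.trans hx)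
  exact ⟨⟨γ, h2⟩, by rw [← hval]; exact hγ.symm⟩

-- Lifts of a `k`-basis of the residue field span `L`. Every value lies in `ker g`, so a remainder
-- can be rescaled by a scalar to value `0` and its residue expanded in the basis, which increases
-- the value of the remainder. Spherical completeness turns these improvements into an exact
-- expansion.
open Module in
theorem finrank_le (hQ : IsPGroup p (K' ≃ₐ[k] K')) (hND : NoCentralPower p k ι) {s : ℕ}
    (hs : Nat.card (L ≃ₐ[HahnSeries g.ker k] L) = p ^ s) :
    finrank (HahnSeries g.ker k) L ≤ finrank k (ψ.residueField hι) := by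
  classical
  -- The coordinates are series with exponents in `ker g`, so the error has to be measured there;
  -- this is possible because there is no ramification.
  have hker : ∀ a : L, ∃ t : WithTop g.ker, ψ.val a = t.map (fun γ : g.ker => (γ : Γ)) := by
    intro a
    by_cases ha : a = 0
    · exact ⟨⊤, by rw [ha, val_zero]; rfl⟩
    · obtain ⟨γ, hγ⟩ := ψ.exists_val_eq_coe_ker hι hQ hND hs ha
      exact ⟨γ, by rw [hγ]; rfl⟩
  choose vk hvk using hker
  have hle : ∀ s t : WithTop g.ker, s.map (fun γ : g.ker => (γ : Γ)) ≤
      t.map (fun γ : g.ker => (γ : Γ)) ↔ s ≤ t := fun s t =>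
    WithTop.map_le_iff (fun γ : g.ker => (γ : Γ)) Iff.rfl
  have hlt : ∀ s t : WithTop g.ker, s.map (fun γ : g.ker => (γ : Γ)) <
      t.map (fun γ : g.ker => (γ : Γ)) ↔ s < t := fun s t => by
    rw [← not_le, hle, not_le]
  let B := Module.finBasis k (ψ.residueField hι)
  let e := fun i => ψ.lift hι (B i)
  let S : (Fin (finrank k (ψ.residueField hι)) → HahnSeries g.ker k) →ₗ[HahnSeries g.ker k] L :=
    Fintype.linearCombination (HahnSeries g.ker k) e
  have hS : ∀ w, S w = ∑ i, algebraMap (HahnSeries g.ker k) L (w i) * e i := fun w => by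
    simp only [S, Fintype.linearCombination_apply, Algebra.smul_def]
  have hSval : ∀ (w : Fin (finrank k (ψ.residueField hι)) → HahnSeries g.ker k)
      (t : WithTop g.ker), (∀ i, t ≤ (w i).orderTop) →
      t.map (fun γ : g.ker => (γ : Γ)) ≤ ψ.val (S w) := by
    intro w t ht
    rw [hS]
    refine ψ.le_val_sum _ _ _ fun i _ => ?_
    rw [ψ.val_mul hι, ψ.val_algebraMap]
    exact ((hle _ _).2 (ht i)).trans (le_add_of_nonneg_right (ψ.val_lift hι _))
  have hsurj : Function.Surjective S := by
    intro a
    obtain ⟨w, -, hw⟩ := exists_eq_top_of_improve (Γ := g.ker) (R := k)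
      (Set.univ : Set (Fin (finrank k (ψ.residueField hι)) → HahnSeries g.ker k)) ⟨0, trivial⟩
      (fun w => vk (a - S w)) (by
        intro x _ y hxy
        refine ⟨trivial, ?_⟩
        rw [← hle, ← hvk, ← hvk]
        have h1 : a - S y = (a - S x) - S (y - x) := by rw [map_sub]; ring
        rw [h1]
        refine (le_min le_rfl ?_).trans (ψ.val_sub _ _)
        rw [hvk]
        exact hSval _ _ hxy) (by
        intro w _ htop
        have hne : a - S w ≠ 0 := by
          intro h
          have := hvk (a - S w)
          rw [ψ.val_eq_top.2 h] at this
          cases hx : vk (a - S w) with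
          | top => exact htop hx
          | coe x => rw [hx] at this; simp at this
        obtain ⟨γ, hγ⟩ := ψ.exists_val_eq_coe_ker hι hQ hND hs hne
        have hvkγ : vk (a - S w) = γ := by
          refine le_antisymm ((hle _ _).1 ?_) ((hle _ _).1 ?_) <;> rw [← hvk, hγ] <;> exact le_rfl
        let T : g.ker → L := fun γ => algebraMap (HahnSeries g.ker k) L (single γ 1)
        have hT : ∀ γ, ψ.val (T γ) = (γ : Γ) := fun γ => by
          rw [ψ.val_algebraMap, orderTop_single one_ne_zero]
          rfl
        have hTT : T γ * T (-γ) = 1 := by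
          simp only [T]
          rw [← map_mul, single_mul_single, add_neg_cancel, mul_one, single_zero_one, map_one]
        let r₀ := T (-γ) * (a - S w)
        have hr₀ : ψ.val r₀ = 0 := by
          simp only [r₀]
          rw [ψ.val_mul hι, hT, hγ, ← WithTop.coe_add, NegMemClass.coe_neg, neg_add_cancel,
            WithTop.coe_zero]
        let c := B.repr ⟨ψ.res hι r₀, r₀, hr₀.ge, rfl⟩
        let w' : Fin (finrank k (ψ.residueField hι)) → HahnSeries g.ker k :=
          fun i => HahnSeries.C (c i)
        have hw'nn : 0 ≤ ψ.val (S w') := by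
          have := hSval w' 0 fun i => orderTop_single_le
          simpa using this
        have hw'res : ψ.res hι (S w') = ψ.res hι r₀ := by
          have h1 : ψ.res hι (S w') = ∑ i, algebraMap k K' (c i) * (B i : K') := by
            rw [hS]
            have : ∀ t : Finset (Fin (finrank k (ψ.residueField hι))),
                ψ.res hι (∑ i ∈ t, algebraMap (HahnSeries g.ker k) L (w' i) * e i) =
                ∑ i ∈ t, algebraMap k K' (c i) * (B i : K') := by
              intro t
              induction t using Finset.induction_on with
              | empty => simp [res_zero]
              | insert i t hi ih =>
                have hmul : ψ.res hι (algebraMap (HahnSeries g.ker k) L (w' i) * e i) =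
                    ψ.res hι (algebraMap (HahnSeries g.ker k) L (w' i)) * ψ.res hι (e i) :=
                  ψ.res_mul hι (ψ.val_algebraMap_nonneg orderTop_single_le) (ψ.val_lift hι _)
                rw [Finset.sum_insert hi, Finset.sum_insert hi, res_add, ih, hmul,
                  res_algebraMap, ψ.res_lift hι]
                simp only [w', HahnSeries.C_apply, coeff_single_same]
            exact this _
          have h2 := congrArg Subtype.val (B.sum_repr ⟨ψ.res hι r₀, r₀, hr₀.ge, rfl⟩)
          rw [h1]
          refine Eq.trans ?_ h2
          rw [AddSubmonoidClass.coe_finsetSum]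
          exact Finset.sum_congr rfl fun i _ => (Algebra.smul_def (c i) (B i : K')).symm
        have hdiff : 0 < ψ.val (r₀ - S w') := by
          rw [ψ.val_pos_iff hι ((le_min hr₀.ge hw'nn).trans (ψ.val_sub _ _)), res_sub, hw'res,
            sub_self]
        refine ⟨w + (single γ (1 : k)) • w', fun i => ?_, ?_⟩
        · have : (w + (single γ (1 : k)) • w') i - w i = single γ 1 * w' i := by
            simp
          rw [this, hvkγ, orderTop_single_mul]
          exact le_add_of_nonneg_right orderTop_single_le
        · rw [← hlt, ← hvk, ← hvk, hγ]
          have h1 : a - S (w + (single γ (1 : k)) • w') = T γ * (r₀ - S w') := by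
            rw [map_add, map_smul, Algebra.smul_def]
            simp only [r₀]
            rw [mul_sub, ← mul_assoc, hTT]
            ring
          rw [h1, ψ.val_mul hι, hT]
          calc ((γ : Γ) : WithTop Γ) = (γ : Γ) + 0 := (add_zero _).symm
            _ < _ := WithTop.add_lt_add_left WithTop.coe_ne_top hdiff)
    refine ⟨w, ?_⟩
    have h1 := hvk (a - S w)
    rw [hw, WithTop.map_top, ψ.val_eq_top, sub_eq_zero] at h1
    exact h1.symm
  have h1 := LinearMap.finrank_le_finrank_of_surjective hsurj
  simpa using h1

include ψ hι in
/-- If `L` is a Galois extension of `k((ker g))` that embeds into `gradedSubring ι g`, then its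
Galois group is a quotient of that of `K'/k`. -/
theorem exists_surjective [Normal k K'] (hQ : IsPGroup p (K' ≃ₐ[k] K'))
    (hND : NoCentralPower p k ι) {s : ℕ}
    (hs : Nat.card (L ≃ₐ[HahnSeries g.ker k] L) = p ^ s) :
    ∃ f : (K' ≃ₐ[k] K') →* (L ≃ₐ[HahnSeries g.ker k] L), Function.Surjective f := by
  have := ψ.isGalois_residueField hι hs
  have hsurj := ψ.resAut_surjective hι hs
  -- Both Galois groups have the order of the corresponding degree, so `finrank_le` makes the
  -- surjection bijective.
  have hbij : Function.Bijective (ψ.resAut hι) := by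
    refine hsurj.bijective_of_nat_card_le ?_
    rw [IsGalois.card_aut_eq_finrank, IsGalois.card_aut_eq_finrank]
    exact ψ.finrank_le hι hQ hND hs
  let E := MulEquiv.ofBijective (ψ.resAut hι) hbij
  refine ⟨E.symm.toMonoidHom.comp (AlgEquiv.restrictNormalHom (ψ.residueField hι)), ?_⟩
  exact E.symm.surjective.comp (AlgEquiv.restrictNormalHom_surjective K')

end GradedEmbedding

end HahnSeries

/-! ### Conjugacy in finite-dimensional central division algebras. -/

section Intertwiner

variable {Ω B : Type*} [Field Ω] [Ring B] [NoZeroDivisors B] [Nontrivial B] [Algebra Ω B]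
  [FiniteDimensional Ω B]

/-- In a finite-dimensional central division algebra, linearly independent elements act
independently by multiplication on the right, with coefficients on the left. -/
theorem eq_zero_of_forall_sum_mul_mul_eq_zero
    (hcen : ∀ b : B, (∀ x, b * x = x * b) → ∃ ω, b = algebraMap Ω B ω)
    {α : Type*} {e : α → B} (he : LinearIndependent Ω e) (s : Finset α) (q : α → B)
    (h : ∀ x, ∑ j ∈ s, q j * x * e j = 0) : ∀ j ∈ s, q j = 0 := by
  classical
  induction s using Finset.induction_on generalizing q with
  | empty => simp
  | insert j₀ s hj₀ ih =>
    have h0 : q j₀ = 0 := by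
      -- Normalize the coefficient of `e j₀` to `1`. The relation at `d * x` minus `d` times the
      -- relation at `x` no longer involves `j₀` and has the commutators of the `q' j` with `d` as
      -- coefficients. By induction these vanish, so all `q' j` are scalars, and `x = 1` contradicts
      -- linear independence.
      by_contra hne
      have hinj : Function.Injective (LinearMap.mulRight Ω (q j₀)) := by
        rw [← LinearMap.ker_eq_bot, LinearMap.ker_eq_bot']
        intro m hm
        exact (mul_eq_zero.1 hm).resolve_right hne
      obtain ⟨y, hy⟩ := (LinearMap.injective_iff_surjective.1 hinj) 1
      replace hy : y * q j₀ = 1 := hy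
      let q' := fun j => y * q j
      have h' : ∀ x, ∑ j ∈ insert j₀ s, q' j * x * e j = 0 := fun x => by
        simp only [q', mul_assoc, ← Finset.mul_sum]
        simp only [← mul_assoc, h, mul_zero]
      have hq'0 : q' j₀ = 1 := hy
      have hcomm : ∀ j ∈ s, ∀ d, q' j * d = d * q' j := by
        intro j hj d
        have h1 := ih (fun j => q' j * d - d * q' j) (fun x => by
          have e1 := h' (d * x)
          have e2 := congrArg (fun t => d * t) (h' x)
          simp only [mul_zero, Finset.mul_sum] at e2
          rw [Finset.sum_insert hj₀, hq'0] at e1 e2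
          have e3 := congrArg₂ (fun u v => u - v) e1 e2
          simp only [one_mul, mul_assoc, sub_self, add_sub_add_left_eq_sub,
            ← Finset.sum_sub_distrib] at e3
          rw [← e3]
          exact Finset.sum_congr rfl fun j _ => by noncomm_ring) j hj
        exact sub_eq_zero.1 h1
      have hω : ∀ j ∈ insert j₀ s, ∃ ω, q' j = algebraMap Ω B ω := by
        intro j hj
        rcases Finset.mem_insert.1 hj with rfl | hj
        · exact ⟨1, by rw [hq'0, map_one]⟩
        · exact hcen _ (hcomm j hj)
      choose! ω hω using hω
      have h2 := h' 1
      rw [Finset.sum_congr rfl (g := fun j => ω j • e j) fun j hj => by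
        rw [mul_one, hω j hj, Algebra.smul_def]] at h2
      have h3 := linearIndependent_iff'.1 he _ ω h2 j₀ (Finset.mem_insert_self _ _)
      have h4 := hω j₀ (Finset.mem_insert_self _ _)
      rw [h3, hq'0, map_zero] at h4
      exact one_ne_zero h4
    intro j hj
    rcases Finset.mem_insert.1 hj with rfl | hj
    · exact h0
    · refine ih q (fun x => ?_) j hj
      have := h x
      rwa [Finset.sum_insert hj₀, h0, zero_mul, zero_mul, zero_add] at this

theorem Polynomial.coeff_divX_iterate {R : Type*} [Semiring R] (f : Polynomial R) (l i : ℕ) :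
    (Polynomial.divX^[l] f).coeff i = f.coeff (i + l) := by
  induction l generalizing i with
  | zero => rfl
  | succ l ih =>
    rw [Function.iterate_succ_apply', Polynomial.coeff_divX, ih]
    congr 1
    ring

/-- A noncommutative form of the factorization of `f(b) - f(a)`. It telescopes by Horner's rule,
since `divX^[l] f` is `divX^[l + 1] f * X` plus the coefficient of index `l`. -/
theorem sum_aeval_divX_mul_mul {Ω B : Type*} [Field Ω] [Ring B] [Algebra Ω B]
    (f : Polynomial Ω) (a b x : B) (N : ℕ) :
    ∑ l ∈ Finset.range N, Polynomial.aeval b (Polynomial.divX^[l + 1] f) * (b * x - x * a) * a ^ l =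
      Polynomial.aeval b f * x - Polynomial.aeval b (Polynomial.divX^[N] f) * x * a ^ N -
        x * ∑ l ∈ Finset.range N, algebraMap Ω B (f.coeff l) * a ^ l := by
  induction N with
  | zero => simp
  | succ N ih =>
    have h := congrArg (Polynomial.aeval b) (Polynomial.divX_mul_X_add (Polynomial.divX^[N] f))
    rw [map_add, map_mul, Polynomial.aeval_X, Polynomial.aeval_C, Polynomial.coeff_divX_iterate,
      zero_add, ← Function.iterate_succ_apply' Polynomial.divX] at h
    have hc := Algebra.commutes (f.coeff N) x
    rw [Finset.sum_range_succ, Finset.sum_range_succ, ih, ← h, mul_add x, ← mul_assoc x,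
      ← hc, pow_succ']
    noncomm_ring

/-- In a finite-dimensional central division algebra, elements with the same minimal polynomial
are conjugate. -/
theorem exists_ne_zero_mul_eq_mul
    (hcen : ∀ b : B, (∀ x, b * x = x * b) → ∃ ω, b = algebraMap Ω B ω) {a b : B}
    (h : minpoly Ω a = minpoly Ω b) : ∃ x : B, x ≠ 0 ∧ b * x = x * a := by
  by_contra hcon
  push Not at hcon
  -- Without an intertwiner `D` is injective, hence surjective, so every `y` has the form `b * x - x
  -- * a`. The telescoping identity then gives a relation valid for all `y`, in which the
  -- coefficient of the highest power of `a` is `1`. That contradicts the independence of the powers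
  -- of `a` below the degree of its minimal polynomial.
  let D : B →ₗ[Ω] B := LinearMap.mulLeft Ω b - LinearMap.mulRight Ω a
  have hD : ∀ x, D x = b * x - x * a := fun x => rfl
  have hinj : Function.Injective D := by
    rw [← LinearMap.ker_eq_bot, LinearMap.ker_eq_bot']
    intro x hx
    by_contra hne
    exact hcon x hne (sub_eq_zero.1 hx)
  have hsurj := LinearMap.injective_iff_surjective.1 hinj
  set f := minpoly Ω a with hf
  have hint : IsIntegral Ω a := Algebra.IsIntegral.isIntegral a
  have hmonic := minpoly.monic hint
  have hfn : Polynomial.divX^[f.natDegree] f = 1 := by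
    ext i
    rw [Polynomial.coeff_divX_iterate, Polynomial.coeff_one]
    split_ifs with hi
    · rw [hi, zero_add]
      exact hmonic
    · exact Polynomial.coeff_eq_zero_of_natDegree_lt (by omega)
  have hzero : ∀ y, ∑ l : Fin f.natDegree,
      Polynomial.aeval b (Polynomial.divX^[(l : ℕ) + 1] f) * y * a ^ (l : ℕ) = 0 := by
    intro y
    obtain ⟨x, rfl⟩ := hsurj y
    rw [hD, Fin.sum_univ_eq_sum_range
      (fun l => Polynomial.aeval b (Polynomial.divX^[l + 1] f) * (b * x - x * a) * a ^ l),
      sum_aeval_divX_mul_mul, hfn, map_one, one_mul]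
    have h1 : Polynomial.aeval b f = 0 := by rw [h]; exact minpoly.aeval _ _
    have h2 : Polynomial.aeval a f = 0 := minpoly.aeval _ _
    have hlead : f.coeff f.natDegree = 1 := hmonic
    rw [Polynomial.aeval_eq_sum_range, Finset.sum_range_succ, hlead, one_smul] at h2
    simp only [Algebra.smul_def] at h2
    rw [h1, zero_mul, zero_sub, ← neg_add', ← mul_add, add_comm, h2, mul_zero, neg_zero]
  have hpos : 0 < f.natDegree := minpoly.natDegree_pos hint
  have h3 := eq_zero_of_forall_sum_mul_mul_eq_zero hcen (linearIndependent_pow a) Finset.univ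
    _ hzero ⟨f.natDegree - 1, Nat.sub_lt hpos Nat.one_pos⟩ (Finset.mem_univ _)
  simp only [Nat.sub_add_cancel hpos, hfn, map_one] at h3
  exact one_ne_zero h3

end Intertwiner

/-! ### Iterated Laurent series as Hahn series. -/

namespace HahnSeries

/-- Iterated Hahn series are Hahn series on the lexicographic product, as a ring homomorphism. -/
noncomputable def ofIterateRingHom (Γ Γ' R : Type*) [AddCommGroup Γ] [LinearOrder Γ]
    [IsOrderedAddMonoid Γ] [AddCommGroup Γ'] [LinearOrder Γ'] [IsOrderedAddMonoid Γ'] [Semiring R] :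
    HahnSeries Γ (HahnSeries Γ' R) →+* HahnSeries (Γ ×ₗ Γ') R where
  toFun := ofIterate
  map_zero' := rfl
  map_add' _ _ := rfl
  map_one' := by
    ext ⟨a, b⟩
    change ((1 : HahnSeries Γ (HahnSeries Γ' R)).coeff a).coeff b =
      (1 : HahnSeries (Γ ×ₗ Γ') R).coeff (toLex (a, b))
    rw [coeff_one, coeff_one]
    by_cases ha : a = 0
    · by_cases hb : b = 0
      · rw [if_pos ha, if_pos (by rw [ha, hb]; rfl), coeff_one, if_pos hb]
      · rw [if_pos ha, coeff_one, if_neg hb, if_neg]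
        intro h
        exact hb (congrArg (fun t => (ofLex t).2) h)
    · rw [if_neg ha, coeff_zero, if_neg]
      intro h
      exact ha (congrArg (fun t => (ofLex t).1) h)
  map_mul' x y := by
    classical
    ext ⟨a, b⟩
    change ((x * y).coeff a).coeff b = (ofIterate x * ofIterate y).coeff (toLex (a, b))
    rw [coeff_mul, coeff_sum, coeff_mul]
    simp only [coeff_mul]
    rw [Finset.sum_sigma']
    refine Finset.sum_nbij'
      (fun s => (toLex (s.1.1, s.2.1), toLex (s.1.2, s.2.2)))
      (fun t => ⟨((ofLex t.1).1, (ofLex t.2).1), ((ofLex t.1).2, (ofLex t.2).2)⟩)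
      ?_ ?_ (fun _ _ => rfl) (fun _ _ => rfl) (fun _ _ => rfl)
    · rintro ⟨⟨a₁, a₂⟩, b₁, b₂⟩ h
      simp only [Finset.mem_sigma, Finset.mem_antidiagonal] at h ⊢
      refine ⟨h.2.1, h.2.2.1, ?_⟩
      exact congrArg toLex (Prod.ext h.1.2.2 h.2.2.2)
    · rintro ⟨t₁, t₂⟩ h
      simp only [Finset.mem_sigma, Finset.mem_antidiagonal] at h ⊢
      refine ⟨⟨?_, ?_, congrArg (fun t => (ofLex t).1) h.2.2⟩, h.1, h.2.1,
        congrArg (fun t => (ofLex t).2) h.2.2⟩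
      · exact ne_zero_of_coeff_ne_zero h.1
      · exact ne_zero_of_coeff_ne_zero h.2.1

theorem mapRingHom_embDomainRingHom {Γ Γ' R S : Type*} [AddCommGroup Γ] [LinearOrder Γ]
    [IsOrderedAddMonoid Γ] [AddCommGroup Γ'] [LinearOrder Γ'] [IsOrderedAddMonoid Γ'] [Semiring R]
    [Semiring S] (f : R →+* S) (e : Γ →+ Γ') (hinj : Function.Injective e)
    (hle : ∀ a b, e a ≤ e b ↔ a ≤ b) (x : HahnSeries Γ R) :
    mapRingHom Γ' f (embDomainRingHom e hinj hle x) =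
      embDomainRingHom e hinj hle (mapRingHom Γ f x) := by
  ext γ
  rw [coeff_mapRingHom]
  by_cases h : γ ∈ Set.range e
  · obtain ⟨a, rfl⟩ := h
    exact (congrArg f (embDomain_coeff (f := ⟨⟨e, hinj⟩, hle _ _⟩) (x := x) (a := a))).trans
      (embDomain_coeff (f := ⟨⟨e, hinj⟩, hle _ _⟩) (x := mapRingHom Γ f x) (a := a)).symm
  · exact (congrArg f (embDomain_of_notMem_range (f := ⟨⟨e, hinj⟩, hle _ _⟩) (x := x) h)).trans
      ((map_zero f).trans
      (embDomain_of_notMem_range (f := ⟨⟨e, hinj⟩, hle _ _⟩) (x := mapRingHom Γ f x) h).symm)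

theorem embDomainRingHom_single {Γ Γ' R : Type*} [AddCommGroup Γ] [LinearOrder Γ]
    [IsOrderedAddMonoid Γ] [AddCommGroup Γ'] [LinearOrder Γ'] [IsOrderedAddMonoid Γ'] [Semiring R]
    (e : Γ →+ Γ') (hinj : Function.Injective e)
    (hle : ∀ a b, e a ≤ e b ↔ a ≤ b) (γ : Γ) (c : R) :
    embDomainRingHom e hinj hle (single γ c) = single (e γ) c :=
  embDomain_single (f := ⟨⟨e, hinj⟩, hle _ _⟩)

end HahnSeries

/-- Appending a last, least significant, coordinate. -/
def lexSnoc (Λ : Type*) [AddCommGroup Λ] (r : ℕ) :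
    Lex (Fin r → Λ) ×ₗ Λ →+ Lex (Fin (r + 1) → Λ) where
  toFun x := toLex (Fin.snoc (α := fun _ => Λ) (ofLex (ofLex x).1) (ofLex x).2)
  map_zero' := by
    refine congrArg toLex (funext fun i => ?_)
    refine Fin.lastCases ?_ (fun i => ?_) i
    · simp
    · simp
  map_add' x y := by
    refine congrArg toLex (funext fun i => ?_)
    refine Fin.lastCases ?_ (fun i => ?_) i
    · simp
    · simp

theorem lexSnoc_castSucc (Λ : Type*) [AddCommGroup Λ] (r : ℕ) (x : Lex (Fin r → Λ) ×ₗ Λ)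
    (i : Fin r) : lexSnoc Λ r x i.castSucc = (ofLex x).1 i :=
  Fin.snoc_castSucc (α := fun _ => Λ) _ _ i

theorem lexSnoc_last (Λ : Type*) [AddCommGroup Λ] (r : ℕ) (x : Lex (Fin r → Λ) ×ₗ Λ) :
    lexSnoc Λ r x (Fin.last r) = (ofLex x).2 :=
  Fin.snoc_last (α := fun _ => Λ) _ _

theorem lexSnoc_strictMono (Λ : Type*) [AddCommGroup Λ] [LinearOrder Λ] (r : ℕ) :
    StrictMono (lexSnoc Λ r) := by
  intro x y hxy
  rcases Prod.Lex.lt_iff.1 hxy with h | ⟨h1, h2⟩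
  · obtain ⟨i, hi, hlt⟩ := h
    refine ⟨i.castSucc, fun j hj => ?_, ?_⟩
    · obtain ⟨j, rfl⟩ := Fin.exists_castSucc_eq.2 (ne_of_lt (hj.trans (Fin.castSucc_lt_last i)))
      exact (lexSnoc_castSucc Λ r x j).trans
        ((hi j (by simpa using hj)).trans (lexSnoc_castSucc Λ r y j).symm)
    · exact (lexSnoc_castSucc Λ r x i).trans_lt (hlt.trans_eq (lexSnoc_castSucc Λ r y i).symm)
  · refine ⟨Fin.last r, fun j hj => ?_, ?_⟩
    · obtain ⟨j, rfl⟩ := Fin.exists_castSucc_eq.2 hj.ne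
      exact (lexSnoc_castSucc Λ r x j).trans
        ((congrFun (congrArg ofLex h1) j).trans (lexSnoc_castSucc Λ r y j).symm)
    · exact (lexSnoc_last Λ r x).trans_lt (h2.trans_eq (lexSnoc_last Λ r y).symm)

namespace IterLaurent

open HahnSeries

/-- Iterated Laurent series as Hahn series with lexicographically ordered exponents. -/
noncomputable def toHahn : (r : ℕ) → (F : Type u) → [Field F] →
    (IterLaurent r F →+* HahnSeries (Lex (Fin r → ℤ)) F)
  | 0, _, _ => HahnSeries.C
  | r + 1, F, _ => (embDomainRingHom (lexSnoc ℤ r) (lexSnoc_strictMono ℤ r).injective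
      fun _ _ => (lexSnoc_strictMono ℤ r).le_iff_le).comp
        ((ofIterateRingHom (Lex (Fin r → ℤ)) ℤ F).comp (toHahn r (LaurentSeries F)))

theorem mapRingHom_toHahn (r : ℕ) {F : Type u} {K : Type v} [Field F] [Field K] (f : F →+* K)
    (x : IterLaurent r F) :
    mapRingHom (Lex (Fin r → ℤ)) f (toHahn r F x) = toHahn r K (map r f x) := by
  induction r generalizing F K with
  | zero => exact mapRingHom_single f 0 x
  | succ r ih =>
    refine (mapRingHom_embDomainRingHom f _ _ _ _).trans ?_
    refine congrArg (embDomainRingHom (lexSnoc ℤ r) (lexSnoc_strictMono ℤ r).injective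
      fun _ _ => (lexSnoc_strictMono ℤ r).le_iff_le) ?_
    exact congrArg (ofIterateRingHom (Lex (Fin r → ℤ)) ℤ K) (ih (mapLaurent f) x)

theorem toHahn_succ (r : ℕ) {F : Type u} [Field F] (x : IterLaurent (r + 1) F) :
    toHahn (r + 1) F x = embDomainRingHom (lexSnoc ℤ r) (lexSnoc_strictMono ℤ r).injective
      (fun _ _ => (lexSnoc_strictMono ℤ r).le_iff_le)
      (ofIterateRingHom (Lex (Fin r → ℤ)) ℤ F (toHahn r (LaurentSeries F) x)) := rfl

theorem ofIterateRingHom_single {Γ Γ' R : Type*} [AddCommGroup Γ] [LinearOrder Γ]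
    [IsOrderedAddMonoid Γ] [AddCommGroup Γ'] [LinearOrder Γ'] [IsOrderedAddMonoid Γ'] [Semiring R]
    (γ : Γ) (δ : Γ') (c : R) :
    ofIterateRingHom Γ Γ' R (single γ (single δ c)) = single (toLex (γ, δ)) c := by
  ext ⟨a, b⟩
  change ((single γ (single δ c)).coeff a).coeff b = (single (toLex (γ, δ)) c).coeff (toLex (a, b))
  by_cases h1 : a = γ
  · by_cases h2 : b = δ
    · rw [h1, h2, coeff_single_same, coeff_single_same, coeff_single_same]
    · rw [h1, coeff_single_same, coeff_single_of_ne h2, coeff_single_of_ne]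
      intro h
      exact h2 (congrArg (fun t => (ofLex t).2) h)
  · rw [coeff_single_of_ne h1, coeff_single_of_ne, coeff_zero]
    intro h
    exact h1 (congrArg (fun t => (ofLex t).1) h)

theorem toHahn_C (r : ℕ) {F : Type u} [Field F] (c : F) :
    toHahn r F (C r F c) = HahnSeries.C c := by
  induction r generalizing F with
  | zero => rfl
  | succ r ih =>
    have h1 : C (r + 1) F c = C r (LaurentSeries F) (HahnSeries.C c) := rfl
    rw [toHahn_succ, h1, ih]
    refine (congrArg _ (ofIterateRingHom_single 0 0 c)).trans ?_
    refine (embDomainRingHom_single _ _ _ _ _).trans ?_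
    exact congrArg (fun t => single t c) (map_zero (lexSnoc ℤ r))

/-- The indices are reversed because the variable adjoined first occupies the last, least
significant coordinate. -/
theorem toHahn_X (r : ℕ) {F : Type u} [Field F] (i : Fin r) :
    toHahn r F (X r F i) = single (toLex (Pi.single i.rev 1)) 1 := by
  induction r generalizing F with
  | zero => exact i.elim0
  | succ r ih =>
    rw [toHahn_succ]
    refine Fin.cases ?_ (fun j => ?_) i
    · have h1 : X (r + 1) F 0 = C r (LaurentSeries F) (single 1 1) := rfl
      rw [h1, toHahn_C]
      refine (congrArg _ (ofIterateRingHom_single 0 1 1)).trans ?_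
      refine (embDomainRingHom_single _ _ _ _ _).trans ?_
      refine congrArg (fun t => single t 1) (funext fun l => ?_)
      rw [Fin.rev_zero]
      refine Fin.lastCases ?_ (fun l => ?_) l
      · exact (lexSnoc_last ℤ r _).trans (Pi.single_eq_same (M := fun _ => ℤ) (Fin.last r) 1).symm
      · exact (lexSnoc_castSucc ℤ r _ l).trans
          (Pi.single_eq_of_ne (M := fun _ => ℤ) (Fin.castSucc_lt_last l).ne 1).symm
    · have h1 : X (r + 1) F j.succ = X r (LaurentSeries F) j := rfl
      rw [h1, ih]
      refine (congrArg _ (ofIterateRingHom_single _ 0 1)).trans ?_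
      refine (embDomainRingHom_single _ _ _ _ _).trans ?_
      refine congrArg (fun t => single t 1) (funext fun l => ?_)
      rw [Fin.rev_succ]
      refine Fin.lastCases ?_ (fun l => ?_) l
      · exact (lexSnoc_last ℤ r _).trans
          (Pi.single_eq_of_ne (M := fun _ => ℤ) (Fin.castSucc_lt_last j.rev).ne' 1).symm
      · refine (lexSnoc_castSucc ℤ r _ l).trans ?_
        change Pi.single (M := fun _ => ℤ) j.rev 1 l = Pi.single (M := fun _ => ℤ) j.rev.castSucc 1 l.castSucc
        by_cases h : l = j.rev
        · rw [h, Pi.single_eq_same, Pi.single_eq_same]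
        · rw [Pi.single_eq_of_ne h, Pi.single_eq_of_ne]
          exact fun h' => h (Fin.castSucc_injective _ h')

end IterLaurent

/-! ### The group of exponents. -/

section Exponents

variable (p : ℕ) [hp : Fact p.Prime]

/-- The localization of `ℤ` at the prime `p`. -/
noncomputable def rationalPadicInt : Subring ℚ := (PadicInt.subring p).comap (Rat.castHom ℚ_[p])

theorem exists_nsmul_eq_rationalPadicInt {n : ℕ} (hn : n.Coprime p) (q : rationalPadicInt p) :
    ∃ q', n • q' = q := by
  have h0 : (n : ℚ) ≠ 0 := by
    rintro h
    rw [Nat.cast_eq_zero] at h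
    subst h
    exact hp.out.one_lt.ne' (Nat.coprime_zero_left p |>.1 hn)
  have hq : ‖((q : ℚ) : ℚ_[p])‖ ≤ 1 := q.2
  refine ⟨⟨(q : ℚ) / n, ?_⟩, Subtype.ext ?_⟩
  · change ‖(((q : ℚ) / n : ℚ) : ℚ_[p])‖ ≤ 1
    have h1 : ‖(n : ℚ_[p])‖ = 1 := by
      rw [Padic.norm_natCast_eq_one_iff]
      exact hn.symm
    rw [Rat.cast_div, norm_div, Rat.cast_natCast, h1, div_one]
    exact hq
  · change n • ((q : ℚ) / n) = q
    rw [nsmul_eq_mul]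
    field_simp

/-- The homomorphism from the localization of `ℤ` at `p` that sends `1` to an element `a` of
`p`-power order. -/
theorem exists_hom_rationalPadicInt {A : Type*} [AddCommGroup A] {a : A} {n : ℕ}
    (ha : p ^ n • a = 0) : ∃ f : rationalPadicInt p →+ A, f 1 = a := by
  let i : rationalPadicInt p →+* ℤ_[p] := ((Rat.castHom ℚ_[p]).comp
    (rationalPadicInt p).subtype).codRestrict (PadicInt.subring p) fun q => q.2
  let f : ZMod (p ^ n) →+ A := ZMod.lift (p ^ n) ⟨zmultiplesHom A a, by
    rw [zmultiplesHom_apply, natCast_zsmul]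
    exact ha⟩
  refine ⟨f.comp ((PadicInt.toZModPow n).comp i).toAddMonoidHom, ?_⟩
  have h1 : (PadicInt.toZModPow n).comp i 1 = ((1 : ℤ) : ZMod (p ^ n)) := by simp
  refine (congrArg f h1).trans ?_
  rw [ZMod.lift_coe]
  simp

/-- An ordered group `Λ` with a homomorphism `g` to a given abelian `p`-group, such that the kernel
of `g` is divisible by all numbers prime to `p`, and such that `ℤ ^ r` with the lexicographic order
embeds into the kernel. -/
theorem exists_exponents {A : Type*} [AddCommGroup A] (hA : ∀ a : A, ∃ n : ℕ, p ^ n • a = 0) {r : ℕ}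
    (a : Fin r → A) (N : Fin r → ℕ) (hN : ∀ i, 0 < N i) :
    ∃ (Λ : Type) (_ : AddCommGroup Λ) (_ : LinearOrder Λ) (_ : IsOrderedAddMonoid Λ)
      (g : Λ →+ A) (e : Fin r → Λ) (ε : Lex (Fin r → ℤ) →+ Λ), StrictMono ε ∧
      (∀ i, g (e i) = a i) ∧ (∀ i, ε (toLex (Pi.single i.rev 1)) = N i • e i) ∧
      ∀ n : ℕ, n.Coprime p → ∀ γ ∈ g.ker, ∃ δ ∈ g.ker, n • δ = γ := by
  classical
  have h1 : ∀ i, ∃ f : rationalPadicInt p →+ A, f 1 = a i := fun i => by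
    obtain ⟨n, hn⟩ := hA (a i)
    exact exists_hom_rationalPadicInt p hn
  choose f hf using h1
  let g : Lex (Fin r → rationalPadicInt p) →+ A :=
    { toFun := fun x => ∑ i, f i (ofLex x i.rev)
      map_zero' := Finset.sum_eq_zero fun i _ => map_zero (f i)
      map_add' := fun x y => by
        rw [← Finset.sum_add_distrib]
        exact Finset.sum_congr rfl fun i _ => map_add (f i) _ _ }
  -- The coordinate belonging to `x_i` is stretched by `N i`, so that the unit vector `e i` is the
  -- `N i`-th part of the value of `x_i`.
  let ε : Lex (Fin r → ℤ) →+ Lex (Fin r → rationalPadicInt p) :=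
    { toFun := fun x => toLex fun i => (N i.rev • (ofLex x i : ℤ) : rationalPadicInt p)
      map_zero' := by
        refine congrArg toLex (funext fun i => ?_)
        change (N i.rev • ((0 : ℤ) : rationalPadicInt p)) = 0
        simp
      map_add' := fun x y => by
        refine congrArg toLex (funext fun i => ?_)
        change (N i.rev • ((ofLex x i + ofLex y i : ℤ) : rationalPadicInt p)) =
          N i.rev • (ofLex x i : rationalPadicInt p) + N i.rev • (ofLex y i : rationalPadicInt p)
        rw [Int.cast_add, smul_add] }
  refine ⟨Lex (Fin r → rationalPadicInt p), inferInstance, inferInstance, inferInstance, g,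
    fun i => toLex (Pi.single i.rev 1), ε, ?_, ?_, ?_, ?_⟩
  · rintro x y ⟨i, hi, hlt⟩
    refine ⟨i, fun j hj => ?_, ?_⟩
    · change (N j.rev • (ofLex x j : ℤ) : rationalPadicInt p) = N j.rev • (ofLex y j : ℤ)
      exact congrArg (fun t : ℤ => (N j.rev • (t : rationalPadicInt p))) (hi j hj)
    · change (N i.rev • (ofLex x i : ℤ) : rationalPadicInt p) < N i.rev • (ofLex y i : ℤ)
      refine nsmul_lt_nsmul_right (hN _).ne' ?_
      exact_mod_cast hlt
  · intro i
    change ∑ j, f j (Pi.single (M := fun _ => rationalPadicInt p) i.rev 1 j.rev) = a i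
    rw [Finset.sum_eq_single i, Pi.single_eq_same, hf]
    · intro j _ hj
      rw [Pi.single_eq_of_ne (fun h => hj (Fin.rev_injective h)), map_zero]
    · simp
  · intro i
    refine congrArg toLex (funext fun j => ?_)
    change N j.rev • ((Pi.single (M := fun _ => ℤ) i.rev 1 j : ℤ) : rationalPadicInt p) =
      N i • Pi.single (M := fun _ => rationalPadicInt p) i.rev 1 j
    by_cases h : j = i.rev
    · subst h
      simp
    · rw [Pi.single_eq_of_ne h, Pi.single_eq_of_ne h]
      simp
  · intro n hn γ hγ
    choose δ hδ using fun i => exists_nsmul_eq_rationalPadicInt p hn (ofLex γ i)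
    have h2 : n • (toLex δ : Lex (Fin r → rationalPadicInt p)) = γ :=
      congrArg toLex (funext fun i => hδ i)
    refine ⟨toLex δ, ?_, h2⟩
    rw [AddMonoidHom.mem_ker] at hγ ⊢
    have h3 : n • g (toLex δ) = 0 := by rw [← map_nsmul, h2, hγ]
    obtain ⟨m, hm⟩ := hA (g (toLex δ))
    -- The image of `δ` under `g` is killed by `n` and by a power of `p`, hence vanishes: the kernel
    -- inherits the divisibility.
    have h4 := Nat.dvd_gcd (addOrderOf_dvd_of_nsmul_eq_zero h3) (addOrderOf_dvd_of_nsmul_eq_zero hm)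
    rw [(Nat.Coprime.pow_right m hn : Nat.gcd n (p ^ m) = 1), Nat.dvd_one,
      AddMonoid.addOrderOf_eq_one_iff] at h4
    exact h4

end Exponents

/-! ### Ordered monomials and crossed product structures. -/

theorem map_orderedMonomial {M N : Type*} [Monoid M] [Monoid N] (f : M →* N) {r : ℕ} (a : Fin r → M)
    (m : Fin r → ℕ) : f (orderedMonomial a m) = orderedMonomial (fun i => f (a i)) m := by
  rw [orderedMonomial, map_list_prod, List.map_ofFn]
  exact congrArg List.prod (congrArg List.ofFn (funext fun i => map_pow f _ _))

theorem orderedMonomial_zero {M : Type*} [Monoid M] {r : ℕ} (a : Fin r → M) :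
    orderedMonomial a 0 = 1 := by
  rw [orderedMonomial]
  refine List.prod_eq_one fun x hx => ?_
  obtain ⟨i, rfl⟩ := List.mem_ofFn.1 hx
  simp

theorem orderedMonomial_succ {M : Type*} [Monoid M] {r : ℕ} (a : Fin (r + 1) → M)
    (m : Fin (r + 1) → ℕ) : orderedMonomial a m =
      a 0 ^ m 0 * orderedMonomial (fun i : Fin r => a i.succ) fun i => m i.succ := by
  rw [orderedMonomial, List.ofFn_succ, List.prod_cons]
  rfl

theorem orderedMonomial_single {M : Type*} [Monoid M] {r : ℕ} (a : Fin r → M) (i : Fin r) (n : ℕ) :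
    orderedMonomial a (Pi.single i n) = a i ^ n := by
  induction r with
  | zero => exact i.elim0
  | succ r ih =>
    rw [orderedMonomial_succ]
    refine Fin.cases ?_ (fun i => ?_) i
    · have : (fun j : Fin r => (Pi.single 0 n : Fin (r + 1) → ℕ) j.succ) = 0 :=
        funext fun j => Pi.single_eq_of_ne (Fin.succ_ne_zero j) _
      rw [this, orderedMonomial_zero, mul_one, Pi.single_eq_same]
    · have : (fun j : Fin r => (Pi.single i.succ n : Fin (r + 1) → ℕ) j.succ) = Pi.single i n := by
        funext j
        by_cases h : j = i
        · rw [h, Pi.single_eq_same, Pi.single_eq_same]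
        · rw [Pi.single_eq_of_ne h, Pi.single_eq_of_ne fun h' => h (Fin.succ_injective _ h')]
      rw [this, ih, Pi.single_eq_of_ne (Fin.succ_ne_zero i).symm, pow_zero, one_mul]

theorem isUnit_orderedMonomial {M : Type*} [Monoid M] {r : ℕ} {a : Fin r → M}
    (ha : ∀ i, IsUnit (a i)) (m : Fin r → ℕ) : IsUnit (orderedMonomial a m) := by
  induction r with
  | zero => simp [orderedMonomial]
  | succ r ih =>
    rw [orderedMonomial_succ]
    exact ((ha 0).pow _).mul (ih (fun i => ha i.succ) _)

/-- The relations between a field `K'`, elements `zᵢ` and automorphisms `σᵢ` in an abelian crossed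
product `R = ⨁ K' z ^ m`, the sum being over all `m` with `0 ≤ mᵢ < nᵢ`. -/
structure IsCrossed {k K' R : Type*} [Field k] [Field K'] [Algebra k K'] [Ring R] (ι : K' →+* R)
    {r : ℕ} (σ : Fin r → (K' ≃ₐ[k] K')) (z : Fin r → R) (n : Fin r → ℕ) : Prop where
  z_mem : ∀ i, z i ∈ homComponent ι (σ i)
  z_isUnit : ∀ i, IsUnit (z i)
  surjective : Function.Surjective
    fun m : (i : Fin r) → Fin (n i) => orderedMonomial σ fun i => (m i : ℕ)
  exists_eq_sum : ∀ a : R, ∃ c : ((i : Fin r) → Fin (n i)) → K',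
    a = ∑ m, ι (c m) * orderedMonomial z fun i => (m i : ℕ)
  eq_zero : ∀ c : ((i : Fin r) → Fin (n i)) → K',
    ∑ m, ι (c m) * orderedMonomial z (fun i => (m i : ℕ)) = 0 → c = 0

section Crossed

variable {k K' R : Type*} [Field k] [Field K'] [Algebra k K'] [Ring R] {ι : K' →+* R}
  {r : ℕ} {σ : Fin r → (K' ≃ₐ[k] K')} {z : Fin r → R} {n : Fin r → ℕ}

theorem orderedMonomial_mem_homComponent (hz : ∀ i, z i ∈ homComponent ι (σ i)) (m : Fin r → ℕ) :
    orderedMonomial z m ∈ homComponent ι (orderedMonomial σ m) := by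
  induction r with
  | zero =>
    have h1 : orderedMonomial z m = 1 := by simp [orderedMonomial]
    have h2 : orderedMonomial σ m = 1 := by simp [orderedMonomial]
    rw [h1, h2]
    exact one_mem_homComponent
  | succ r ih =>
    rw [orderedMonomial_succ, orderedMonomial_succ]
    exact mul_mem_homComponent (pow_mem_homComponent (hz 0) _)
      (ih (fun i => hz i.succ) fun i => m i.succ)

/-- Comparing the coefficients of `z ^ l` in `d κ = σ ^ m (κ) d` gives `c_l (σ ^ l (κ) - σ ^ m (κ))
= 0` for all `κ`. As distinct exponents give distinct automorphisms, only `l = m` survives. -/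
theorem IsCrossed.exists_eq_mul (h : IsCrossed ι σ z n) (m : (i : Fin r) → Fin (n i)) {d : R}
    (hd : d ∈ homComponent ι (orderedMonomial σ fun i => (m i : ℕ)))
    (hinj : Function.Injective
      fun m : (i : Fin r) → Fin (n i) => orderedMonomial σ fun i => (m i : ℕ)) :
    ∃ c, d = ι c * orderedMonomial z fun i => (m i : ℕ) := by
  obtain ⟨c, hc⟩ := h.exists_eq_sum d
  refine ⟨c m, hc.trans (Finset.sum_eq_single m (fun m' _ hm' => ?_) (by simp))⟩
  suffices c m' = 0 by rw [this, map_zero, zero_mul]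
  by_contra hne
  refine hm' (hinj (AlgEquiv.ext fun κ => ?_))
  have h0 := h.eq_zero (fun l => c l * (orderedMonomial σ (fun i => (l i : ℕ)) κ -
    orderedMonomial σ (fun i => (m i : ℕ)) κ)) (by
      have h1 := hd κ
      rw [hc, Finset.sum_mul, Finset.mul_sum, ← sub_eq_zero, ← Finset.sum_sub_distrib] at h1
      rw [← h1]
      refine Finset.sum_congr rfl fun l _ => ?_
      rw [mul_assoc, orderedMonomial_mem_homComponent h.z_mem _ κ, ← mul_assoc, ← mul_assoc,
        ← map_mul, ← map_mul, ← sub_mul, ← map_sub]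
      congr 2
      ring)
  have h1 := congrFun h0 m'
  rcases mul_eq_zero.1 h1 with h2 | h2
  · exact absurd h2 hne
  · exact sub_eq_zero.1 h2

theorem IsCrossed.hasUnitComponents (h : IsCrossed ι σ z n)
    (hinj : Function.Injective
      fun m : (i : Fin r) → Fin (n i) => orderedMonomial σ fun i => (m i : ℕ)) :
    HasUnitComponents k ι := by
  intro τ
  obtain ⟨m, rfl⟩ := h.surjective τ
  obtain ⟨z', hz'⟩ := isUnit_orderedMonomial h.z_isUnit fun i => (m i : ℕ)
  refine ⟨z', ?_, fun d hd => ?_⟩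
  · rw [hz']
    exact orderedMonomial_mem_homComponent h.z_mem _
  · rw [hz']
    exact h.exists_eq_mul m hd hinj

end Crossed

/-! ### Base change of Galois extensions. -/

section CommonExtension

theorem exists_field_algEquiv (Ω : Type*) {A : Type v} [Field Ω] [CommRing A] [Algebra Ω A]
    [FiniteDimensional Ω A] [IsDomain A] :
    ∃ (L : Type v) (_ : Field L) (_ : Algebra Ω L), Nonempty (A ≃ₐ[Ω] L) := by
  have h : IsField A := isField_of_isIntegral_of_isField' (R := Ω) (Field.toIsField Ω)
  exact ⟨A, h.toField, inferInstanceAs (Algebra Ω A), ⟨AlgEquiv.refl⟩⟩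

variable {E : Type*} {L : Type*} {Ω : Type*} {L' : Type*} [Field E] [Field L] [Field Ω] [Field L']
  [Algebra E L] [Algebra E Ω] [Algebra Ω L'] (e : Ω ⊗[E] L ≃ₐ[Ω] L')

/-- The extension of automorphisms of `L/E` to the field `L' ≃ Ω ⊗ L`. -/
noncomputable def baseChangeAut : (L ≃ₐ[E] L) →* (L' ≃ₐ[Ω] L') where
  toFun τ := (e.symm.trans (Algebra.TensorProduct.congr AlgEquiv.refl τ)).trans e
  map_one' := by
    ext x
    have : (Algebra.TensorProduct.congr (AlgEquiv.refl (R := Ω) (A₁ := Ω)) (1 : L ≃ₐ[E] L) :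
        Ω ⊗[E] L ≃ₐ[Ω] Ω ⊗[E] L) = AlgEquiv.refl := Algebra.TensorProduct.congr_refl
    simp [this]
  map_mul' σ τ := by
    ext x
    obtain ⟨x, rfl⟩ := e.surjective x
    simp only [AlgEquiv.trans_apply, AlgEquiv.mul_apply, AlgEquiv.symm_apply_apply]
    congr 1
    induction x with
    | zero => simp
    | add a b ha hb => simp only [map_add, ha, hb]
    | tmul a b => simp

theorem baseChangeAut_tmul (τ : L ≃ₐ[E] L) (a : Ω) (b : L) :
    baseChangeAut e τ (e (a ⊗ₜ b)) = e (a ⊗ₜ τ b) := by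
  simp [baseChangeAut]

theorem baseChangeAut_injective : Function.Injective (baseChangeAut e) := by
  intro σ τ h
  ext b
  have h1 := congrArg (fun f => f (e (1 ⊗ₜ b))) h
  simp only [baseChangeAut_tmul] at h1
  exact Algebra.TensorProduct.includeRight_injective (A := Ω) (B := L) (FaithfulSMul.algebraMap_injective E Ω) (e.injective h1)

include e in
theorem finrank_of_tensorProduct_algEquiv : Module.finrank Ω L' = Module.finrank E L := by
  rw [← e.toLinearEquiv.finrank_eq, Module.finrank_baseChange]

-- The extended automorphisms already number `[L : E] = [L' : Ω]`, the largest possible order of the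
-- automorphism group of `L'`. So `L'` is Galois and has no others.
include e in
theorem isGalois_of_tensorProduct_algEquiv [FiniteDimensional E L] [IsGalois E L] :
    FiniteDimensional Ω L' ∧ IsGalois Ω L' ∧ Function.Bijective (baseChangeAut e) := by
  have hfin : FiniteDimensional Ω L' := Module.Finite.equiv e.toLinearEquiv
  have h1 := IsGalois.card_aut_eq_finrank E L
  have h2 : Nat.card (L' ≃ₐ[Ω] L') ≤ Module.finrank Ω L' := by
    rw [Nat.card_eq_fintype_card]
    exact AlgEquiv.card_le
  have h3 := Nat.card_le_card_of_injective _ (baseChangeAut_injective e)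
  rw [finrank_of_tensorProduct_algEquiv e] at h2
  refine ⟨hfin, IsGalois.of_card_aut_eq_finrank Ω L' ?_,
    (baseChangeAut_injective e).bijective_of_nat_card_le (by omega)⟩
  rw [finrank_of_tensorProduct_algEquiv e]
  omega

-- The quotient of `k ⊗ K` by a maximal ideal contains copies of both fields. Since their degrees
-- are coprime, its degree over `k` is a multiple of `[K : F]`, the dimension of `k ⊗ K` over `k`,
-- so nothing was divided out.
open Module in
theorem exists_compositum_of_coprime {F : Type*} {k : Type u} {K : Type v} [Field F] [Field k] [Field K]
    [Algebra F k] [Algebra F K] [FiniteDimensional F k] [FiniteDimensional F K]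
    (h : (finrank F k).Coprime (finrank F K)) :
    ∃ (K' : Type (max u v)) (_ : Field K') (_ : Algebra k K'), Nonempty (k ⊗[F] K ≃ₐ[k] K') := by
  obtain ⟨I, hI⟩ := Ideal.exists_maximal (k ⊗[F] K)
  let : Field ((k ⊗[F] K) ⧸ I) := Ideal.Quotient.field I
  let q : k ⊗[F] K →ₐ[k] (k ⊗[F] K) ⧸ I := Ideal.Quotient.mkₐ k I
  have hq : Function.Surjective q := Ideal.Quotient.mkₐ_surjective k I
  let : Algebra K ((k ⊗[F] K) ⧸ I) :=
    ((q : k ⊗[F] K →+* _).comp (Algebra.TensorProduct.includeRight (R := F) (A := k)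
      (B := K) : K →+* k ⊗[F] K)).toAlgebra
  let : IsScalarTower F K ((k ⊗[F] K) ⧸ I) := IsScalarTower.of_algebraMap_eq fun x => by
    change _ = q (1 ⊗ₜ algebraMap F K x)
    rw [← Algebra.TensorProduct.tmul_one_eq_one_tmul]
    rfl
  have h1 : finrank k ((k ⊗[F] K) ⧸ I) ≤ finrank F K := by
    rw [← finrank_baseChange (R := k) (M' := K)]
    exact LinearMap.finrank_le_finrank_of_surjective (f := q.toLinearMap) hq
  have h2 : finrank F K ∣ finrank F k * finrank k ((k ⊗[F] K) ⧸ I) := by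
    rw [finrank_mul_finrank, ← finrank_mul_finrank F K ((k ⊗[F] K) ⧸ I)]
    exact dvd_mul_right _ _
  have h3 := Nat.le_of_dvd finrank_pos (h.symm.dvd_of_dvd_mul_left h2)
  have h4 : Function.Injective q := by
    refine (LinearMap.injective_iff_surjective_of_finrank_eq_finrank (f := q.toLinearMap) ?_).2 hq
    rw [finrank_baseChange]
    omega
  exact ⟨_, inferInstance, inferInstance, ⟨AlgEquiv.ofBijective q ⟨h4, hq⟩⟩⟩

end CommonExtension

/-! ### Normal forms and the universal property of the crossed product algebra. -/

section Monomials

variable {k K' R : Type*} [Field k] [Field K'] [Algebra k K'] [Ring R] {ι : K' →+* R} {r : ℕ}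
  {σ : Fin r → (K' ≃ₐ[k] K')} {z : Fin r → R}

theorem exists_mul_pow_eq {ρ : K' ≃ₐ[k] K'} {x y : R} (hy : y ∈ homComponent ι ρ) {u : K'} (hu : x * y = ι u * (y * x)) (n : ℕ) :
    ∃ c, x * y ^ n = ι c * (y ^ n * x) := by
  induction n with
  | zero => exact ⟨1, by simp⟩
  | succ n ih =>
    obtain ⟨c, hc⟩ := ih
    refine ⟨c * (ρ ^ n) u, ?_⟩
    rw [pow_succ, ← mul_assoc, hc, mul_assoc, mul_assoc, hu, ← mul_assoc (y ^ n),
      pow_mem_homComponent hy n u, map_mul]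
    simp only [mul_assoc]

theorem exists_mul_orderedMonomial_eq (hz : ∀ i, z i ∈ homComponent ι (σ i))
    {x : R} {u : Fin r → K'} (hu : ∀ j, x * z j = ι (u j) * (z j * x))
    (m : Fin r → ℕ) :
    ∃ c, x * orderedMonomial z m = ι c * (orderedMonomial z m * x) := by
  induction r with
  | zero => exact ⟨1, by simp [orderedMonomial]⟩
  | succ r ih =>
    obtain ⟨c, hc⟩ := exists_mul_pow_eq (hz 0) (hu 0) (m 0)
    obtain ⟨c', hc'⟩ := ih (fun i => hz i.succ) (fun i => hu i.succ) fun i => m i.succ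
    refine ⟨c * (σ 0 ^ m 0) c', ?_⟩
    rw [orderedMonomial_succ, ← mul_assoc, hc, mul_assoc, mul_assoc, hc', ← mul_assoc (z 0 ^ m 0),
      pow_mem_homComponent (hz 0) _ c', map_mul]
    simp only [mul_assoc]

theorem exists_mul_orderedMonomial_eq_add_single (hz : ∀ i, z i ∈ homComponent ι (σ i))
    {u : Fin r → Fin r → K'} (hu : ∀ i j, z i * z j = ι (u i j) * (z j * z i)) (i : Fin r)
    (m : Fin r → ℕ) :
    ∃ c, z i * orderedMonomial z m = ι c * orderedMonomial z (m + Pi.single i 1) := by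
  induction r with
  | zero => exact i.elim0
  | succ r ih =>
    simp only [orderedMonomial_succ]
    refine Fin.cases ?_ (fun i => ?_) i
    · refine ⟨1, ?_⟩
      have : (fun j : Fin r => (m + Pi.single 0 1 : Fin (r + 1) → ℕ) j.succ) = fun j => m j.succ :=
        funext fun j => by simp
      rw [this, Pi.add_apply, Pi.single_eq_same, pow_succ', map_one, one_mul, mul_assoc]
    · obtain ⟨c, hc⟩ := exists_mul_pow_eq (hz 0) (hu i.succ 0) (m 0)
      obtain ⟨c', hc'⟩ := ih (fun i => hz i.succ) (fun i j => hu i.succ j.succ) i fun i => m i.succ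
      have : (fun j : Fin r => (m + Pi.single i.succ 1 : Fin (r + 1) → ℕ) j.succ) =
          (fun j => m j.succ) + Pi.single i 1 := by
        funext j
        rw [Pi.add_apply, Pi.add_apply]
        by_cases h : j = i
        · rw [h, Pi.single_eq_same, Pi.single_eq_same]
        · rw [Pi.single_eq_of_ne h, Pi.single_eq_of_ne fun h' => h (Fin.succ_injective _ h')]
      refine ⟨c * (σ 0 ^ m 0) c', ?_⟩
      rw [this, Pi.add_apply, Pi.single_eq_of_ne (Fin.succ_ne_zero i).symm, add_zero, ← mul_assoc,
        hc, mul_assoc, mul_assoc, hc', ← mul_assoc (z 0 ^ m 0), pow_mem_homComponent (hz 0) _ c',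
        map_mul]
      simp only [mul_assoc]

theorem exists_orderedMonomial_eq_update (hz : ∀ i, z i ∈ homComponent ι (σ i)) {n : ℕ} {b : K'}
    (i : Fin r) (hb : z i ^ n = ι b) {m : Fin r → ℕ} (hm : m i = n) :
    ∃ c, orderedMonomial z m = ι c * orderedMonomial z (Function.update m i 0) := by
  induction r with
  | zero => exact i.elim0
  | succ r ih =>
    simp only [orderedMonomial_succ]
    revert hb hm
    refine Fin.cases ?_ (fun i => ?_) i
    · intro hb hm
      refine ⟨b, ?_⟩
      have : (fun j : Fin r => (Function.update m 0 0) j.succ) = fun j => m j.succ :=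
        funext fun j => by simp
      rw [this, Function.update_self, pow_zero, one_mul, hm, hb]
    · intro hb hm
      obtain ⟨c, hc⟩ := ih (fun i => hz i.succ) i hb (m := fun j => m j.succ) hm
      refine ⟨(σ 0 ^ m 0) c, ?_⟩
      have : (fun j : Fin r => (Function.update m i.succ 0) j.succ) =
          Function.update (fun j => m j.succ) i 0 := by
        funext j
        by_cases h : j = i
        · rw [h, Function.update_self, Function.update_self]
        · rw [Function.update_of_ne h, Function.update_of_ne fun h' => h (Fin.succ_injective _ h')]
      rw [this, Function.update_of_ne (Fin.succ_ne_zero i).symm, hc, ← mul_assoc,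
        pow_mem_homComponent (hz 0) _ c, mul_assoc]

/-- The sum of the subgroups `K' z ^ m`, where `0 ≤ mᵢ < nᵢ`. -/
def monomialSpan (ι : K' →+* R) (z : Fin r → R) (n : Fin r → ℕ) : AddSubgroup R :=
  AddSubgroup.closure {a | ∃ (c : K') (m : (i : Fin r) → Fin (n i)),
    a = ι c * orderedMonomial z fun i => (m i : ℕ)}

variable {n : Fin r → ℕ}

theorem mul_mem_monomialSpan_of_generators {x : R}
    (h : ∀ (c : K') (m : (i : Fin r) → Fin (n i)),
      x * (ι c * orderedMonomial z fun i => (m i : ℕ)) ∈ monomialSpan ι z n)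
    {a : R} (ha : a ∈ monomialSpan ι z n) : x * a ∈ monomialSpan ι z n := by
  refine AddSubgroup.closure_induction (p := fun a _ => x * a ∈ monomialSpan ι z n) ?_ ?_ ?_ ?_ ha
  · rintro _ ⟨c, m, rfl⟩
    exact h c m
  · rw [mul_zero]
    exact zero_mem _
  · intro a b _ _ ha hb
    rw [mul_add]
    exact add_mem ha hb
  · intro a _ ha
    rw [mul_neg]
    exact neg_mem ha

theorem map_mul_orderedMonomial_mem_monomialSpan (c : K') {m : Fin r → ℕ} (hm : ∀ i, m i < n i) :
    ι c * orderedMonomial z m ∈ monomialSpan ι z n :=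
  AddSubgroup.subset_closure ⟨c, fun i => ⟨m i, hm i⟩, rfl⟩

theorem one_mem_monomialSpan (hn : ∀ i, 0 < n i) : (1 : R) ∈ monomialSpan ι z n := by
  have := map_mul_orderedMonomial_mem_monomialSpan (ι := ι) (z := z) (1 : K') (m := 0) hn
  rwa [map_one, one_mul, orderedMonomial_zero] at this

theorem map_mul_mem_monomialSpan (c : K') {a : R} (ha : a ∈ monomialSpan ι z n) :
    ι c * a ∈ monomialSpan ι z n :=
  mul_mem_monomialSpan_of_generators (fun c' m => by
    rw [← mul_assoc, ← map_mul]
    exact map_mul_orderedMonomial_mem_monomialSpan _ fun i => (m i).2) ha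

/-- Moving `z i` to its place in a monomial costs only a factor from `K'`. If its exponent then
reaches `n i`, the relation `z i ^ n i = ι (b i)` resets it to `0`. -/
theorem gen_mul_mem_monomialSpan (hz : ∀ i, z i ∈ homComponent ι (σ i))
    {u : Fin r → Fin r → K'} (hu : ∀ i j, z i * z j = ι (u i j) * (z j * z i)) {b : Fin r → K'}
    (hb : ∀ i, z i ^ n i = ι (b i)) (i : Fin r) {a : R} (ha : a ∈ monomialSpan ι z n) :
    z i * a ∈ monomialSpan ι z n :=
  mul_mem_monomialSpan_of_generators (fun c m => by
    obtain ⟨c₁, hc₁⟩ := exists_mul_orderedMonomial_eq_add_single hz hu i fun i => (m i : ℕ)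
    rw [← mul_assoc, hz i c, mul_assoc, hc₁]
    refine map_mul_mem_monomialSpan _ (map_mul_mem_monomialSpan _ ?_)
    have hne : ∀ j, j ≠ i → ((fun i => (m i : ℕ)) + Pi.single i 1 : Fin r → ℕ) j = m j := fun j hj => by
      rw [Pi.add_apply, Pi.single_eq_of_ne hj, add_zero]
    have heq : ((fun i => (m i : ℕ)) + Pi.single i 1 : Fin r → ℕ) i = (m i : ℕ) + 1 := by
      rw [Pi.add_apply, Pi.single_eq_same]
    rcases Nat.lt_or_ge ((m i : ℕ) + 1) (n i) with h | h
    · rw [← one_mul (orderedMonomial z _), ← map_one ι]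
      refine map_mul_orderedMonomial_mem_monomialSpan _ fun j => ?_
      by_cases hj : j = i
      · rw [hj, heq]
        exact h
      · rw [hne j hj]
        exact (m j).2
    · obtain ⟨c₂, hc₂⟩ := exists_orderedMonomial_eq_update hz i (hb i)
        (heq.trans (le_antisymm (m i).2 h))
      rw [hc₂]
      refine map_mul_orderedMonomial_mem_monomialSpan _ fun j => ?_
      by_cases hj : j = i
      · rw [hj, Function.update_self]
        exact (Nat.zero_le _).trans_lt (m i).2
      · rw [Function.update_of_ne hj, hne j hj]
        exact (m j).2) ha

end Monomials

namespace CrossedAlgebra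

variable {F : Type u} {K : Type v} [Field F] [Field K] [Algebra F K] {r : ℕ}
  (σ : Fin r → (K ≃ₐ[F] K)) (u : Fin r → Fin r → K) (b : Fin r → K)

/-- The field `K` in `(K/F, z_σ, u, b)`. -/
noncomputable def incl : K →+* CrossedAlgebra F σ u b where
  toFun x := RingQuot.mkAlgHom F (CrossedRel F σ u b) (FreeAlgebra.ι F (Sum.inl x))
  map_one' := by
    have h1 := RingQuot.mkAlgHom_rel F (CrossedRel.scalar (F := F) (σ := σ) (u := u) (b := b) 1)
    rwa [map_one, map_one, map_one] at h1
  map_zero' := by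
    have h1 := RingQuot.mkAlgHom_rel F (CrossedRel.scalar (F := F) (σ := σ) (u := u) (b := b) 0)
    rwa [map_zero, map_zero, map_zero] at h1
  map_add' x y := by
    rw [← map_add]
    exact RingQuot.mkAlgHom_rel F (CrossedRel.add x y)
  map_mul' x y := by
    rw [← map_mul]
    exact RingQuot.mkAlgHom_rel F (CrossedRel.mul x y)

/-- The generator `zᵢ` of `(K/F, z_σ, u, b)`. -/
noncomputable def gen (i : Fin r) : CrossedAlgebra F σ u b :=
  RingQuot.mkAlgHom F (CrossedRel F σ u b) (FreeAlgebra.ι F (Sum.inr i))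

theorem incl_algebraMap (c : F) :
    incl σ u b (algebraMap F K c) = algebraMap F (CrossedAlgebra F σ u b) c :=
  (RingQuot.mkAlgHom_rel F (CrossedRel.scalar c)).trans (AlgHom.commutes _ _)

theorem gen_mem (i : Fin r) : gen σ u b i ∈ homComponent (incl σ u b) (σ i) := fun x => by
  refine (map_mul _ _ _).symm.trans ((RingQuot.mkAlgHom_rel F (CrossedRel.z_mul i x)).trans ?_)
  exact map_mul _ _ _

theorem gen_mul_gen (i j : Fin r) : gen σ u b i * gen σ u b j =
    incl σ u b (u i j) * (gen σ u b j * gen σ u b i) := by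
  refine (map_mul _ _ _).symm.trans ((RingQuot.mkAlgHom_rel F (CrossedRel.z_mul_z i j)).trans ?_)
  rw [map_mul, map_mul]
  rfl

theorem gen_pow (i : Fin r) : gen σ u b i ^ orderOf (σ i) = incl σ u b (b i) :=
  (map_pow _ _ _).symm.trans (RingQuot.mkAlgHom_rel F (CrossedRel.z_pow i))

/-- The span contains `1` and is stable under left multiplication by all generators of the algebra.
-/
theorem mem_monomialSpan (hσ : ∀ i, 0 < orderOf (σ i)) (a : CrossedAlgebra F σ u b) :
    a ∈ monomialSpan (incl σ u b) (gen σ u b) fun i => orderOf (σ i) := by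
  have key : ∀ (a : FreeAlgebra F (K ⊕ Fin r)),
      ∀ s ∈ monomialSpan (incl σ u b) (gen σ u b) fun i => orderOf (σ i),
      RingQuot.mkAlgHom F (CrossedRel F σ u b) a * s ∈
        monomialSpan (incl σ u b) (gen σ u b) fun i => orderOf (σ i) := by
    intro a
    induction a using FreeAlgebra.induction with
    | grade0 c =>
      intro s hs
      rw [AlgHom.commutes, ← incl_algebraMap]
      exact map_mul_mem_monomialSpan _ hs
    | grade1 x =>
      intro s hs
      rcases x with x | i
      · exact map_mul_mem_monomialSpan x hs
      · exact gen_mul_mem_monomialSpan (gen_mem σ u b) (gen_mul_gen σ u b) (gen_pow σ u b) i hs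
    | mul a₁ a₂ h₁ h₂ =>
      intro s hs
      rw [map_mul, mul_assoc]
      exact h₁ _ (h₂ _ hs)
    | add a₁ a₂ h₁ h₂ =>
      intro s hs
      rw [map_add, add_mul]
      exact add_mem (h₁ _ hs) (h₂ _ hs)
  obtain ⟨a, rfl⟩ := RingQuot.mkAlgHom_surjective F (CrossedRel F σ u b) a
  have := key a 1 (one_mem_monomialSpan hσ)
  rwa [mul_one] at this

theorem span_eq_top (hσ : ∀ i, 0 < orderOf (σ i)) {J : Type*} [Fintype J] (κ : J → K)
    (hκ : ∀ x, ∃ c : J → F, x = ∑ j, algebraMap F K (c j) * κ j) :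
    Submodule.span F (Set.range fun t : J × ((i : Fin r) → Fin (orderOf (σ i))) =>
      incl σ u b (κ t.1) * orderedMonomial (gen σ u b) fun i => (t.2 i : ℕ)) = ⊤ := by
  refine Submodule.eq_top_iff'.2 fun a => ?_
  refine AddSubgroup.closure_induction ?_ ?_ ?_ ?_ (mem_monomialSpan σ u b hσ a)
  · rintro _ ⟨x, m, rfl⟩
    obtain ⟨c, rfl⟩ := hκ x
    rw [map_sum, Finset.sum_mul]
    refine sum_mem fun j _ => ?_
    rw [map_mul, incl_algebraMap, mul_assoc, ← Algebra.smul_def]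
    exact Submodule.smul_mem _ _ (Submodule.subset_span ⟨(j, m), rfl⟩)
  · exact zero_mem _
  · exact fun _ _ _ _ => add_mem
  · exact fun _ _ => neg_mem

/-- The universal property of `(K/F, z_σ, u, b)`. -/
theorem exists_lift {B : Type*} [Ring B] [Algebra F B] (f : K →ₐ[F] B) (z : Fin r → B)
    (hz : ∀ i, z i ∈ homComponent (f : K →+* B) (σ i))
    (hu : ∀ i j, z i * z j = f (u i j) * (z j * z i))
    (hb : ∀ i, z i ^ orderOf (σ i) = f (b i)) :
    ∃ φ : CrossedAlgebra F σ u b →ₐ[F] B, (∀ x, φ (incl σ u b x) = f x) ∧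
      ∀ i, φ (gen σ u b i) = z i := by
  refine ⟨RingQuot.liftAlgHom F ⟨FreeAlgebra.lift F (Sum.elim f z), ?_⟩, fun x => ?_, fun i => ?_⟩
  · intro x y h
    induction h with
    | add x y => simp
    | mul x y => simp
    | scalar c => simp
    | z_mul i x => simpa using hz i x
    | z_mul_z i j => simpa using hu i j
    | z_pow i => simpa using hb i
  · refine (RingQuot.liftAlgHom_mkAlgHom_apply F _ _ _).trans ?_
    simp
  · refine (RingQuot.liftAlgHom_mkAlgHom_apply F _ _ _).trans ?_
    simp

end CrossedAlgebra

/-! ### Coefficient maps on iterated Laurent series and presentation of `𝔸_Δ`. -/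

namespace IterLaurent

theorem exists_eq_sum_mapLaurent {F : Type u} {K : Type v} [Field F] [Field K] (f : F →+* K)
    {J : Type*} [Fintype J] (κ : J → K) (hκ : ∀ x, ∃ c : J → F, x = ∑ j, f (c j) * κ j)
    (x : LaurentSeries K) :
    ∃ c : J → LaurentSeries F, x = ∑ j, mapLaurent f (c j) * HahnSeries.C (κ j) := by
  classical
  choose c hc using hκ
  -- The chosen coordinates of `0` need not vanish, so they are set to `0` by hand; this keeps the
  -- supports inside that of `x`.
  refine ⟨fun j => ⟨fun n => if x.coeff n = 0 then 0 else c (x.coeff n) j,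
    x.isPWO_support.mono fun n hn h => hn (if_pos h)⟩, HahnSeries.ext (funext fun n => ?_)⟩
  rw [HahnSeries.coeff_sum]
  have h1 : ∀ j, (mapLaurent f (⟨fun n => if x.coeff n = 0 then 0 else c (x.coeff n) j,
      x.isPWO_support.mono fun n hn h => hn (if_pos h)⟩ : LaurentSeries F) *
      HahnSeries.C (κ j)).coeff n = f (if x.coeff n = 0 then 0 else c (x.coeff n) j) * κ j :=
    fun j => HahnSeries.coeff_mul_single_zero
  rw [Finset.sum_congr rfl fun j _ => h1 j]
  by_cases h : x.coeff n = 0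
  · simp [h]
  · simp only [if_neg h]
    exact hc _

theorem exists_eq_sum_map (r : ℕ) {F : Type u} {K : Type v} [Field F] [Field K] (f : F →+* K)
    {J : Type*} [Fintype J] (κ : J → K) (hκ : ∀ x, ∃ c : J → F, x = ∑ j, f (c j) * κ j)
    (x : IterLaurent r K) :
    ∃ c : J → IterLaurent r F, x = ∑ j, map r f (c j) * C r K (κ j) := by
  induction r generalizing F K with
  | zero => exact hκ x
  | succ r ih =>
    exact ih (mapLaurent f) (fun j => HahnSeries.C (κ j)) (exists_eq_sum_mapLaurent f κ hκ) x

theorem map_C (r : ℕ) {F : Type u} {K : Type v} [Field F] [Field K] (f : F →+* K) (c : F) :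
    map r f (C r F c) = C r K (f c) := by
  induction r generalizing F K with
  | zero => rfl
  | succ r ih =>
    refine (ih (mapLaurent f) (HahnSeries.C c)).trans ?_
    exact congrArg (C r (LaurentSeries K)) (HahnSeries.mapRingHom_single f 0 c)

section

attribute [local instance] algebra

variable (r : ℕ) {F : Type u} {K : Type v} [Field F] [Field K] [Algebra F K]

/-- `IterLaurent.mapAut` as a homomorphism of groups. -/
noncomputable def mapAutHom : (K ≃ₐ[F] K) →* (IterLaurent r K ≃ₐ[IterLaurent r F] IterLaurent r K) where
  toFun := mapAut r
  map_one' := AlgEquiv.ext fun x => map_id r x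
  map_mul' σ τ := AlgEquiv.ext fun x => (map_map r (τ : K →+* K) (σ : K →+* K) x).symm

theorem mapAutHom_injective : Function.Injective (mapAutHom r (F := F) (K := K)) := by
  intro σ τ h
  ext x
  have h1 : mapAut r σ (C r K x) = mapAut r τ (C r K x) := congrArg (fun f => f (C r K x)) h
  exact (C r K).injective ((map_C r (σ : K →+* K) x).symm.trans
    (h1.trans (map_C r (τ : K →+* K) x)))

theorem orderOf_mapAut (τ : K ≃ₐ[F] K) : orderOf (mapAut r τ) = orderOf τ :=
  orderOf_injective (mapAutHom r) (mapAutHom_injective r) τ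

end

end IterLaurent

namespace AbelianCrossedProduct

variable {F : Type u} {K : Type v} {Δ : Type w} [Field F] [Field K] [Algebra F K] [Ring Δ]
  [Algebra F Δ] {r : ℕ} (D : AbelianCrossedProduct F K Δ r)

namespace PowerSeriesGeneric

attribute [local instance] IterLaurent.algebra

/-- The field `K''` in `𝔸_Δ`. -/
noncomputable def incl : IterLaurent r K →+* D.PowerSeriesGeneric :=
  CrossedAlgebra.incl (F := IterLaurent r F) (fun i => IterLaurent.mapAut r (D.σ i))
    (fun i j => IterLaurent.C r K (D.u i j))
    (fun i => IterLaurent.C r K (D.b i) * IterLaurent.X r K i)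

/-- The generator `zᵢ` of `𝔸_Δ`. -/
noncomputable def gen (i : Fin r) : D.PowerSeriesGeneric :=
  CrossedAlgebra.gen (F := IterLaurent r F) (fun i => IterLaurent.mapAut r (D.σ i))
    (fun i j => IterLaurent.C r K (D.u i j))
    (fun i => IterLaurent.C r K (D.b i) * IterLaurent.X r K i) i

theorem span_eq_top [FiniteDimensional F K] {J : Type*} [Fintype J] (κ : Module.Basis J F K) :
    Submodule.span (IterLaurent r F)
      (Set.range fun t : J × ((i : Fin r) → Fin (orderOf (D.σ i))) =>
        incl D (IterLaurent.C r K (κ t.1)) *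
          orderedMonomial (gen D) fun i => (t.2 i : ℕ)) = ⊤ := by
  have h1 := CrossedAlgebra.span_eq_top (F := IterLaurent r F)
    (fun i => IterLaurent.mapAut r (D.σ i)) (fun i j => IterLaurent.C r K (D.u i j))
    (fun i => IterLaurent.C r K (D.b i) * IterLaurent.X r K i) (fun i => by
      rw [IterLaurent.orderOf_mapAut]
      exact orderOf_pos _) (fun j => IterLaurent.C r K (κ j))
      (IterLaurent.exists_eq_sum_map r (algebraMap F K) κ fun x => ⟨κ.repr x, by
        conv_lhs => rw [← κ.sum_repr x]
        simp only [Algebra.smul_def]⟩)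
  refine Submodule.eq_top_iff'.2 fun a => ?_
  have h2 : a ∈ (⊤ : Submodule (IterLaurent r F) D.PowerSeriesGeneric) := trivial
  refine Submodule.span_mono ?_ (h1.ge h2)
  rintro _ ⟨⟨j, m⟩, rfl⟩
  exact ⟨(j, fun i => (m i).cast (IterLaurent.orderOf_mapAut r (D.σ i))), rfl⟩

theorem exists_lift {B : Type*} [Ring B] [Algebra (IterLaurent r F) B]
    (f : IterLaurent r K →+* B)
    (hf : ∀ x, f (IterLaurent.map r (algebraMap F K) x) = algebraMap (IterLaurent r F) B x)
    (z : Fin r → B) (hz : ∀ i x, z i * f x = f (IterLaurent.mapAut r (D.σ i) x) * z i)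
    (hu : ∀ i j, z i * z j = f (IterLaurent.C r K (D.u i j)) * (z j * z i))
    (hb : ∀ i, z i ^ orderOf (D.σ i) =
      f (IterLaurent.C r K (D.b i)) * f (IterLaurent.X r K i)) :
    ∃ φ : D.PowerSeriesGeneric →ₐ[IterLaurent r F] B, (∀ x, φ (incl D x) = f x) ∧
      ∀ i, φ (gen D i) = z i := by
  let f' : IterLaurent r K →ₐ[IterLaurent r F] B := { f with commutes' := hf }
  exact CrossedAlgebra.exists_lift (F := IterLaurent r F) _ _ _ f' z (fun i x => hz i x) hu
    fun i => by
      rw [IterLaurent.orderOf_mapAut]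
      exact (hb i).trans (map_mul f _ _).symm

end PowerSeriesGeneric

end AbelianCrossedProduct

/-! ### Linear independence and center in the graded ring. -/

namespace HahnSeries

section

variable {k K' R : Type*} [Field k] [Field K'] [Algebra k K'] [Ring R]
variable {Γ : Type*} [AddCommGroup Γ] [LinearOrder Γ] [IsOrderedAddMonoid Γ]

/-- `gradedSubring ι g` as an algebra over `k((ker g))`. -/
@[reducible] noncomputable def gradedAlgebra (ι : K' →+* R)
    (g : Γ →+ Additive (K' ≃ₐ[k] K')) : Algebra (HahnSeries g.ker k) (gradedSubring ι g) :=
  ((centerHom ι g).codRestrict (gradedSubring ι g) centerHom_mem).toAlgebra'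
    fun ω x => Subtype.ext (centerHom_commute ω x.2)

variable {ι : K' →+* R} {g : Γ →+ Additive (K' ≃ₐ[k] K')}

theorem exists_coeff_centerHom (ω : HahnSeries g.ker k) (γ : Γ) :
    ∃ x : k, (centerHom ι g ω).coeff γ = ι (algebraMap k K' x) := by
  by_cases hmem : γ ∈ g.ker
  · exact ⟨_, coeff_centerHom_of_mem ω ⟨γ, hmem⟩⟩
  · exact ⟨0, by rw [coeff_centerHom_of_notMem ω hmem, map_zero, map_zero]⟩

theorem exists_orderedMonomial_single {r : ℕ} (e : Fin r → Γ) (z : Fin r → R) (m : Fin r → ℕ) :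
    ∃ γ, orderedMonomial (fun i => single (e i) (z i)) m = single γ (orderedMonomial z m) := by
  induction r with
  | zero => exact ⟨0, by simp [orderedMonomial]⟩
  | succ r ih =>
    obtain ⟨γ, hγ⟩ := ih (fun i => e i.succ) (fun i => z i.succ) fun i => m i.succ
    refine ⟨m 0 • e 0 + γ, ?_⟩
    rw [orderedMonomial_succ, orderedMonomial_succ, hγ, single_pow, single_mul_single]

variable {r : ℕ} {σ : Fin r → (K' ≃ₐ[k] K')} {z : Fin r → R} {n : Fin r → ℕ}

/-- At each exponent `δ` the relation becomes one between the monomials in `R`, with coefficients in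
`K'` written in the basis `β`. The exponents `γ m` only shift which coefficient of `ω` is seen. -/
theorem eq_zero_of_sum_centerHom_mul_eq_zero [Nontrivial R] (h : IsCrossed ι σ z n) {J : Type*}
    [Fintype J] (β : Module.Basis J k K') (γ : ((i : Fin r) → Fin (n i)) → Γ)
    (ω : J × ((i : Fin r) → Fin (n i)) → HahnSeries g.ker k)
    (hω : ∑ t, centerHom ι g (ω t) * (single 0 (ι (β t.1)) *
      single (γ t.2) (orderedMonomial z fun i => (t.2 i : ℕ))) = 0) : ω = 0 := by
  choose x hx using exists_coeff_centerHom (ι := ι) (g := g)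
  have h1 : ∀ δ j m, x (ω (j, m)) (δ - γ m) = 0 := by
    intro δ
    have h2 := congrArg (fun s => s.coeff δ) hω
    have h3 : ∀ t : J × ((i : Fin r) → Fin (n i)), (centerHom ι g (ω t) * (single 0 (ι (β t.1)) *
        single (γ t.2) (orderedMonomial z fun i => (t.2 i : ℕ)))).coeff δ =
        ι (x (ω t) (δ - γ t.2) • β t.1) * orderedMonomial z fun i => (t.2 i : ℕ) := by
      intro t
      rw [single_mul_single, zero_add]
      conv_lhs => rw [← sub_add_cancel δ (γ t.2)]
      rw [coeff_mul_single_add, hx, Algebra.smul_def, map_mul, mul_assoc]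
    simp only [coeff_sum, h3, coeff_zero] at h2
    rw [Fintype.sum_prod_type_right] at h2
    simp only [← Finset.sum_mul, ← map_sum] at h2
    have h4 := h.eq_zero (fun m => ∑ j, x (ω (j, m)) (δ - γ m) • β j) h2
    intro j m
    exact Fintype.linearIndependent_iff.1 β.linearIndependent _ (congrFun h4 m) j
  funext t
  refine HahnSeries.ext (funext fun δ => ?_)
  have h2 := h1 (δ + γ t.2) t.1 t.2
  rw [add_sub_cancel_right] at h2
  have h3 := hx (ω t) δ
  rw [h2, map_zero, map_zero, coeff_centerHom_of_mem, map_eq_zero, map_eq_zero] at h3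
  exact h3

/-- Commuting with `K'` removes the coefficients at `γ` with `g γ ≠ 1`. The remaining ones lie in
`K'`; commuting with the `z i` makes them invariant under all `σ i`, so they lie in `k`. -/
theorem exists_eq_centerHom [Nontrivial R] [FiniteDimensional k K'] [IsGalois k K']
    (h : IsCrossed ι σ z n) (hι : HasUnitComponents k ι) {J : Type*} [Fintype J]
    (β : Module.Basis J k K') (e : Fin r → Γ)
    {y : HahnSeries Γ R} (hy : y ∈ gradedSubring ι g)
    (hβ : ∀ j, y * single 0 (ι (β j)) = single 0 (ι (β j)) * y)
    (hz : ∀ i, y * single (e i) (z i) = single (e i) (z i) * y) :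
    ∃ ω, y = centerHom ι g ω := by
  have h1 : ∀ γ, y.coeff γ ≠ 0 → γ ∈ g.ker := by
    intro γ hγ
    have hu := hι.isUnit (hy γ) hγ
    rw [AddMonoidHom.mem_ker]
    refine Additive.toMul.injective ?_
    rw [toMul_zero]
    have h2 : ∀ j, (g γ).toMul (β j) = β j := by
      intro j
      have h3 := congrArg (fun s => s.coeff γ) (hβ j)
      simp only [coeff_mul_single_zero, coeff_single_zero_mul] at h3
      rw [hy γ (β j)] at h3
      exact ι.injective (hu.mul_right_cancel h3)
    refine AlgEquiv.ext fun x => ?_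
    have h4 : (g γ).toMul.toLinearMap = LinearMap.id := β.ext h2
    exact congrArg (fun f => f x) h4
  have h2 : ∀ γ, ∃ x : k, y.coeff γ = ι (algebraMap k K' x) := by
    intro γ
    by_cases hγ : y.coeff γ = 0
    · exact ⟨0, by rw [hγ, map_zero, map_zero]⟩
    have h3 := hy γ
    rw [(AddMonoidHom.mem_ker).1 (h1 γ hγ)] at h3
    obtain ⟨c, hc⟩ := hι.exists_eq_map h3
    suffices ∀ τ : K' ≃ₐ[k] K', τ c = c by
      obtain ⟨x, hx⟩ := (IsGalois.mem_range_algebraMap_iff_fixed c).2 this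
      exact ⟨x, by rw [hc, hx]⟩
    have h4 : ∀ i, σ i ∈ MulAction.stabilizer (K' ≃ₐ[k] K') c := by
      intro i
      have h5 := congrArg (fun s => s.coeff (γ + e i)) (hz i)
      simp only [coeff_mul_single_add] at h5
      rw [coeff_single_mul_add, hc, h.z_mem i c] at h5
      exact (ι.injective ((h.z_isUnit i).mul_right_cancel h5)).symm
    intro τ
    obtain ⟨m, rfl⟩ := h.surjective τ
    have h6 : orderedMonomial σ (fun i => (m i : ℕ)) ∈ MulAction.stabilizer (K' ≃ₐ[k] K') c := by
      refine Subgroup.list_prod_mem _ fun ρ hρ => ?_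
      obtain ⟨i, rfl⟩ := List.mem_ofFn.1 hρ
      exact Subgroup.pow_mem _ (h4 i) _
    exact h6
  choose x hx using h2
  have hx0 : ∀ γ, x γ ≠ 0 → y.coeff γ ≠ 0 := fun γ hγ h => by
    rw [hx, map_eq_zero, map_eq_zero] at h
    exact hγ h
  refine ⟨⟨fun γ => x γ, ?_⟩, HahnSeries.ext (funext fun γ => ?_)⟩
  · have h3 := y.isPWO_support
    intro f
    exact h3 fun n => ⟨((f n : g.ker) : Γ), hx0 _ (f n).2⟩
  · by_cases hγ : γ ∈ g.ker
    · rw [coeff_centerHom_of_mem _ ⟨γ, hγ⟩]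
      exact hx γ
    · rw [coeff_centerHom_of_notMem _ hγ]
      by_contra h
      exact hγ (h1 γ h)

end

end HahnSeries

/-! ### The embedding of `𝔸_Δ` into the graded ring. -/

section LaurentHom

open HahnSeries IterLaurent

variable {K : Type v} [Field K] {R : Type*} [Ring R] {r : ℕ}
variable {Γ : Type*} [AddCommGroup Γ] [LinearOrder Γ] [IsOrderedAddMonoid Γ]
variable {ε : Lex (Fin r → ℤ) →+ Γ} (hε : StrictMono ε)

/-- The homomorphism `K'' → R((Γ))` given by `f : K → R` and an embedding `ε : ℤ ^ r → Γ`. -/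
noncomputable def laurentHom (f : K →+* R) : IterLaurent r K →+* HahnSeries Γ R :=
  (embDomainRingHom ε hε.injective fun _ _ => hε.le_iff_le).comp
    ((mapRingHom (Lex (Fin r → ℤ)) f).comp (toHahn r K))

theorem laurentHom_apply (f : K →+* R) (x : IterLaurent r K) : laurentHom hε f x =
    embDomainRingHom ε hε.injective (fun _ _ => hε.le_iff_le)
      (mapRingHom (Lex (Fin r → ℤ)) f (toHahn r K x)) := rfl

theorem laurentHom_C (f : K →+* R) (c : K) : laurentHom hε f (C r K c) = single 0 (f c) := by
  rw [laurentHom_apply, toHahn_C, HahnSeries.C_apply, mapRingHom_single, embDomainRingHom_single,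
    map_zero]

theorem laurentHom_X (f : K →+* R) (i : Fin r) :
    laurentHom hε f (X r K i) = single (ε (toLex (Pi.single i.rev 1))) 1 := by
  rw [laurentHom_apply, toHahn_X, mapRingHom_single, embDomainRingHom_single, map_one]

theorem laurentHom_map {F : Type u} [Field F] (a : F →+* K) (f : K →+* R) (x : IterLaurent r F) :
    laurentHom hε f (map r a x) = laurentHom hε (f.comp a) x := by
  rw [laurentHom_apply, laurentHom_apply, ← mapRingHom_toHahn]
  rfl

theorem coeff_laurentHom_of_mem (f : K →+* R) (x : IterLaurent r K) (n : Lex (Fin r → ℤ)) :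
    (laurentHom hε f x).coeff (ε n) = f ((toHahn r K x).coeff n) :=
  embDomain_coeff (f := ⟨⟨ε, hε.injective⟩, hε.le_iff_le⟩)
    (x := mapRingHom (Lex (Fin r → ℤ)) f (toHahn r K x)) (a := n)

theorem coeff_laurentHom_of_notMem (f : K →+* R) (x : IterLaurent r K) {γ : Γ}
    (hγ : γ ∉ Set.range ε) : (laurentHom hε f x).coeff γ = 0 :=
  embDomain_of_notMem_range (f := ⟨⟨ε, hε.injective⟩, hε.le_iff_le⟩)
    (x := mapRingHom (Lex (Fin r → ℤ)) f (toHahn r K x)) hγ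

theorem single_mul_laurentHom {f f' : K →+* R} {z : R} (h : ∀ c, z * f c = f' c * z) (e : Γ)
    (x : IterLaurent r K) : single e z * laurentHom hε f x = laurentHom hε f' x * single e z := by
  ext γ
  rw [← sub_add_cancel γ e, coeff_single_mul_add, coeff_mul_single_add]
  by_cases hγ : γ - e ∈ Set.range ε
  · obtain ⟨n, hn⟩ := hγ
    rw [← hn, coeff_laurentHom_of_mem, coeff_laurentHom_of_mem, h]
  · rw [coeff_laurentHom_of_notMem hε _ _ hγ, coeff_laurentHom_of_notMem hε _ _ hγ, mul_zero,
      zero_mul]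

variable {k K' : Type*} [Field k] [Field K'] [Algebra k K'] {ι : K' →+* R}
  {g : Γ →+ Additive (K' ≃ₐ[k] K')}

theorem laurentHom_mem (hg : ∀ n, ε n ∈ g.ker) (a : K →+* K') (x : IterLaurent r K) :
    laurentHom hε (ι.comp a) x ∈ gradedSubring ι g := by
  intro γ
  by_cases hγ : γ ∈ Set.range ε
  · obtain ⟨n, rfl⟩ := hγ
    rw [coeff_laurentHom_of_mem, (AddMonoidHom.mem_ker).1 (hg n)]
    exact map_mem_homComponent _
  · rw [coeff_laurentHom_of_notMem hε _ _ hγ]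
    exact zero_mem _

end LaurentHom

namespace AbelianCrossedProduct

variable {F : Type u} {K : Type v} {Δ : Type w} [Field F] [Field K] [Algebra F K] [Ring Δ]
  [Algebra F Δ] {r : ℕ} (D : AbelianCrossedProduct F K Δ r)

/-- The ring `R ⊇ K' ⊇ K` is the abelian crossed product `(K'/k, σ, u, b)`, where the `σᵢ` extend
the automorphisms of `K/F`. -/
structure IsExtension {k K' R : Type*} [Field k] [Field K'] [Algebra k K'] [Ring R]
    (a : K →+* K') (ι : K' →+* R) (σ : Fin r → (K' ≃ₐ[k] K')) (z : Fin r → R) : Prop where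
  crossed : IsCrossed ι σ z fun i => orderOf (D.σ i)
  injective : Function.Injective
    fun m : (i : Fin r) → Fin (orderOf (D.σ i)) => orderedMonomial σ fun i => (m i : ℕ)
  map_σ : ∀ i x, σ i (a x) = a (D.σ i x)
  z_mul_z : ∀ i j, z i * z j = ι (a (D.u i j)) * (z j * z i)
  z_pow : ∀ i, z i ^ orderOf (D.σ i) = ι (a (D.b i))

open HahnSeries

variable [FiniteDimensional F K] {k K' R : Type*} [Field k] [Field K']
    [Algebra k K'] [Ring R] [Nontrivial R]
    {a : K →+* K'} {ι : K' →+* R} {σ : Fin r → (K' ≃ₐ[k] K')} {z : Fin r → R}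
    {J : Type*} [Fintype J] (κ : Module.Basis J F K)
    (β : Module.Basis J k K')
    {Γ : Type*} [AddCommGroup Γ] [LinearOrder Γ] [IsOrderedAddMonoid Γ]
    {g : Γ →+ Additive (K' ≃ₐ[k] K')} {e : Fin r → Γ} {ε : Lex (Fin r → ℤ) →+ Γ}
    (hε : StrictMono ε)

omit [FiniteDimensional F K] [Nontrivial R] in
variable {D} in
theorem IsExtension.single_mem (h : D.IsExtension a ι σ z)
    (he : ∀ i, g (e i) = Additive.ofMul (σ i)) (i : Fin r) :
    single (e i) (z i) ∈ gradedSubring ι g := by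
  intro γ
  by_cases hγ : γ = e i
  · rw [hγ, coeff_single_same, he]
    exact h.crossed.z_mem i
  · rw [coeff_single_of_ne hγ]
    exact zero_mem _

-- The generator `z_i` goes to the series with the single coefficient `z i` at `e i`. Its `n_i`-th
-- power has coefficient `b_i` and exponent `n_i • e i`, the exponent of `x_i`, which is the
-- relation `z_i ^ n_i = b_i x_i`.
omit [FiniteDimensional F K] [Nontrivial R] in
theorem exists_algHom_gradedSubring (h : D.IsExtension a ι σ z)
    (hg : ∀ n, ε n ∈ g.ker) (he : ∀ i, g (e i) = Additive.ofMul (σ i))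
    (hεe : ∀ i, ε (toLex (Pi.single i.rev 1)) = orderOf (D.σ i) • e i)
    [Algebra (IterLaurent r F) (gradedSubring ι g)]
    (hj : ∀ x : IterLaurent r F, (algebraMap _ (gradedSubring ι g) x : HahnSeries Γ R) =
      laurentHom hε ((ι.comp a).comp (algebraMap F K)) x) :
    ∃ φ : D.PowerSeriesGeneric →ₐ[IterLaurent r F] gradedSubring ι g,
      (∀ x, (φ (PowerSeriesGeneric.incl D x) : HahnSeries Γ R) = laurentHom hε (ι.comp a) x) ∧
      ∀ i, (φ (PowerSeriesGeneric.gen D i) : HahnSeries Γ R) = single (e i) (z i) := by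
  have hcr := h.crossed
  obtain ⟨φ, hφ, hφz⟩ := PowerSeriesGeneric.exists_lift D
    (B := gradedSubring ι g)
    ((laurentHom hε (ι.comp a)).codRestrict (gradedSubring ι g) (laurentHom_mem hε hg a))
    (fun x => Subtype.ext ((laurentHom_map hε _ _ x).trans (hj x).symm))
    (fun i => ⟨single (e i) (z i), h.single_mem he i⟩)
    (fun i x => Subtype.ext (by
      refine (single_mul_laurentHom hε (f' := (ι.comp a).comp (D.σ i : K →+* K)) (fun c => ?_)
        (e i) x).trans ?_
      · refine (hcr.z_mem i (a c)).trans ?_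
        rw [h.map_σ]
        rfl
      · rw [← laurentHom_map]
        rfl))
    (fun i j => Subtype.ext (by
      change single (e i) (z i) * single (e j) (z j) =
        laurentHom hε (ι.comp a) _ * (single (e j) (z j) * single (e i) (z i))
      rw [laurentHom_C, single_mul_single, single_mul_single, single_mul_single, zero_add,
        add_comm, h.z_mul_z]
      rfl))
    (fun i => Subtype.ext (by
      change single (e i) (z i) ^ _ = laurentHom hε (ι.comp a) _ * laurentHom hε (ι.comp a) _
      rw [laurentHom_C, laurentHom_X, single_pow, single_mul_single, zero_add, h.z_pow, mul_one,
        hεe]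
      rfl))
  exact ⟨φ, fun x => congrArg Subtype.val (hφ x), fun i => congrArg Subtype.val (hφz i)⟩

omit [FiniteDimensional F K] in
theorem eq_zero_of_sum_smul_eq_zero (h : D.IsExtension a ι σ z) (hβ : ∀ j, β j = a (κ j))
    [Algebra (HahnSeries g.ker k) (gradedSubring ι g)]
    (halg : ∀ ω, (algebraMap (HahnSeries g.ker k) (gradedSubring ι g) ω : HahnSeries Γ R) =
      centerHom ι g ω)
    (φ : D.PowerSeriesGeneric →+* gradedSubring ι g)
    (hφ : ∀ x, (φ (PowerSeriesGeneric.incl D x) : HahnSeries Γ R) = laurentHom hε (ι.comp a) x)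
    (hφz : ∀ i, (φ (PowerSeriesGeneric.gen D i) : HahnSeries Γ R) = single (e i) (z i))
    (ω : J × ((i : Fin r) → Fin (orderOf (D.σ i))) → HahnSeries g.ker k)
    (hω : ∑ t, ω t • φ (PowerSeriesGeneric.incl D (IterLaurent.C r K (κ t.1)) *
      orderedMonomial (PowerSeriesGeneric.gen D) fun i => (t.2 i : ℕ)) = 0) : ω = 0 := by
  choose γ hγ using fun m : (i : Fin r) → Fin (orderOf (D.σ i)) =>
    exists_orderedMonomial_single e z fun i => (m i : ℕ)
  refine eq_zero_of_sum_centerHom_mul_eq_zero h.crossed β γ ω ?_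
  have h1 := congrArg (gradedSubring ι g).subtype hω
  rw [map_sum, map_zero] at h1
  rw [← h1]
  refine Finset.sum_congr rfl fun t _ => ?_
  rw [Algebra.smul_def, ← halg, map_mul, map_mul, map_mul, ← hγ t.2, hβ]
  refine congrArg₂ (· * ·) rfl (congrArg₂ (· * ·) ?_ ?_)
  · refine (laurentHom_C hε (ι.comp a) _).symm.trans (hφ _).symm
  · refine Eq.symm ((map_orderedMonomial (((gradedSubring ι g).subtype.comp φ :
      D.PowerSeriesGeneric →+* HahnSeries Γ R) : D.PowerSeriesGeneric →* HahnSeries Γ R) _ _).trans ?_)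
    exact congrArg (fun f => orderedMonomial f _) (funext hφz)

end AbelianCrossedProduct

/-- A homomorphism that maps a spanning family to a family independent over a larger field is
injective after base change to that field. -/
theorem exists_baseChange_injective {E Ω A B I : Type*} [Field E] [Field Ω] [Algebra E Ω] [Ring A]
    [Algebra E A] [Ring B] [Algebra E B] [Algebra Ω B] [IsScalarTower E Ω B] [Fintype I]
    (φ : A →ₐ[E] B) (b : I → A) (hspan : Submodule.span E (Set.range b) = ⊤)
    (hind : ∀ ω : I → Ω, ∑ t, ω t • φ (b t) = 0 → ω = 0) :
    Module.Finite E A ∧ Module.finrank E A = Fintype.card I ∧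
      ∃ Ψ : Ω ⊗[E] A →ₐ[Ω] B, Function.Injective Ψ ∧ ∀ y, Ψ (1 ⊗ₜ y) = φ y := by
  have hli : LinearIndependent E b := by
    have h1 : LinearIndependent Ω fun t => φ (b t) :=
      Fintype.linearIndependent_iff.2 fun ω hω t => congrFun (hind ω hω) t
    exact (h1.restrict_scalars' E).of_comp φ.toLinearMap
  let bas := Module.Basis.mk hli hspan.ge
  have hbas : ∀ t, bas t = b t := Module.Basis.mk_apply hli _
  refine ⟨Module.Finite.of_basis bas, Module.finrank_eq_card_basis bas, ?_⟩
  let Ψ : Ω ⊗[E] A →ₐ[Ω] B :=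
    Algebra.TensorProduct.lift (Algebra.ofId _ _) φ fun x y => Algebra.commutes _ _
  have hΨ : ∀ y, Ψ (1 ⊗ₜ y) = φ y := fun y =>
    (Algebra.TensorProduct.lift_tmul _ _ _ _ _).trans (by rw [map_one, one_mul])
  refine ⟨Ψ, (injective_iff_map_eq_zero _).2 fun x hx => ?_, hΨ⟩
  have h1 := (bas.baseChange Ω).sum_repr x
  rw [← h1, map_sum] at hx
  have h2 := hind (fun t => (bas.baseChange Ω).repr x t) (by
    rw [← hx]
    refine Finset.sum_congr rfl fun t _ => ?_
    rw [map_smul, Module.Basis.baseChange_apply, hΨ, hbas])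
  rw [← h1]
  refine Finset.sum_eq_zero fun t _ => ?_
  have h3 := congrFun h2 t
  simp only [Pi.zero_apply] at h3
  rw [h3, zero_smul]

namespace AbelianCrossedProduct

open HahnSeries

variable {F : Type u} {K : Type v} {Δ : Type w} [Field F] [Field K] [Algebra F K] [Ring Δ]
  [Algebra F Δ] {r : ℕ} (D : AbelianCrossedProduct F K Δ r) [FiniteDimensional F K]
  {k K' R : Type*} [Field k] [Field K']
  [Algebra k K'] [Ring R] [Nontrivial R]
  {a : K →+* K'} {ι : K' →+* R} {σ : Fin r → (K' ≃ₐ[k] K')} {z : Fin r → R}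
  {J : Type*} [Fintype J] (κ : Module.Basis J F K) (β : Module.Basis J k K')
  {Γ : Type*} [AddCommGroup Γ] [LinearOrder Γ] [IsOrderedAddMonoid Γ]
  {g : Γ →+ Additive (K' ≃ₐ[k] K')} {e : Fin r → Γ} {ε : Lex (Fin r → ℤ) →+ Γ}
  (hε : StrictMono ε)

/-- The scalar extension of `𝔸_Δ` to `k((ker g))` embeds into `gradedSubring ι g`, and its center
is `k((ker g))`. -/
theorem exists_algHom_baseChange [FiniteDimensional k K'] [IsGalois k K']
    (h : D.IsExtension a ι σ z) (hβ : ∀ j, β j = a (κ j))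
    (hg : ∀ n, ε n ∈ g.ker) (he : ∀ i, g (e i) = Additive.ofMul (σ i))
    (hεe : ∀ i, ε (toLex (Pi.single i.rev 1)) = orderOf (D.σ i) • e i)
    [Algebra (HahnSeries g.ker k) (gradedSubring ι g)]
    (halg : ∀ ω, (algebraMap (HahnSeries g.ker k) (gradedSubring ι g) ω : HahnSeries Γ R) =
      centerHom ι g ω)
    [Algebra (IterLaurent r F) (HahnSeries g.ker k)] [Algebra (IterLaurent r F) (gradedSubring ι g)]
    [IsScalarTower (IterLaurent r F) (HahnSeries g.ker k) (gradedSubring ι g)]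
    (hj : ∀ x : IterLaurent r F, centerHom ι g (algebraMap _ (HahnSeries g.ker k) x) =
      laurentHom hε ((ι.comp a).comp (algebraMap F K)) x) :
    Module.Finite (IterLaurent r F) D.PowerSeriesGeneric ∧
    Module.finrank (IterLaurent r F) D.PowerSeriesGeneric =
      Fintype.card (J × ((i : Fin r) → Fin (orderOf (D.σ i)))) ∧
    ∃ Ψ : HahnSeries g.ker k ⊗[IterLaurent r F] D.PowerSeriesGeneric →ₐ[HahnSeries g.ker k]
        gradedSubring ι g,
      Function.Injective Ψ ∧
      ∀ b : HahnSeries g.ker k ⊗[IterLaurent r F] D.PowerSeriesGeneric,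
        (∀ x, b * x = x * b) → ∃ ω, b = algebraMap (HahnSeries g.ker k) _ ω := by
  obtain ⟨φ, hφ, hφz⟩ := D.exists_algHom_gradedSubring hε h hg he hεe (fun x => by
    rw [IsScalarTower.algebraMap_apply (IterLaurent r F) (HahnSeries g.ker k), halg]
    exact hj x)
  obtain ⟨hfin, hcard, Ψ, hinj, hΨ⟩ := exists_baseChange_injective (Ω := HahnSeries g.ker k) φ _
    (PowerSeriesGeneric.span_eq_top D κ)
    (D.eq_zero_of_sum_smul_eq_zero κ β hε h hβ halg (φ : _ →+* gradedSubring ι g) hφ hφz)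
  refine ⟨hfin, hcard, Ψ, hinj, fun b hb => ?_⟩
  have hcomm : ∀ y, (Ψ b : HahnSeries Γ R) * φ y = φ y * Ψ b := fun y => by
    rw [← hΨ]
    exact congrArg Subtype.val ((map_mul Ψ _ _).symm.trans
      ((congrArg Ψ (hb _)).trans (map_mul Ψ _ _)))
  obtain ⟨ω, hω⟩ := exists_eq_centerHom h.crossed (h.crossed.hasUnitComponents h.injective) β e
    (Ψ b).2 (fun j => by
      have h1 := hcomm (PowerSeriesGeneric.incl D (IterLaurent.C r K (κ j)))
      rw [hφ, laurentHom_C] at h1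
      rw [hβ]
      exact h1) (fun i => by
      have h1 := hcomm (PowerSeriesGeneric.gen D i)
      rw [hφz] at h1
      exact h1)
  exact ⟨ω, hinj (Subtype.ext (hω.trans ((halg ω).symm.trans
    (congrArg Subtype.val (Ψ.commutes ω).symm))))⟩

end AbelianCrossedProduct

/-! ### Extension of scalars for `Δ`. -/

namespace AbelianCrossedProduct

variable {F : Type u} {K : Type v} {Δ : Type w} [Field F] [Field K] [Algebra F K] [Ring Δ]
  [Algebra F Δ] {r : ℕ} (D : AbelianCrossedProduct F K Δ r) [FiniteDimensional F K]

/-- The coordinates `c ↦ ∑ c_m z ^ m`. -/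
noncomputable def sumHom : (((i : Fin r) → Fin (orderOf (D.σ i))) → K) →ₗ[F] Δ where
  toFun c := ∑ m, D.ι (c m) * orderedMonomial D.z fun i => (m i : ℕ)
  map_add' _ _ := by
    rw [← Finset.sum_add_distrib]
    exact Finset.sum_congr rfl fun m _ => by rw [Pi.add_apply, map_add, add_mul]
  map_smul' _ _ := by
    rw [RingHom.id_apply, Finset.smul_sum]
    exact Finset.sum_congr rfl fun m _ => by rw [Pi.smul_apply, map_smul, smul_mul_assoc]

omit [FiniteDimensional F K] in
theorem sumHom_bijective : Function.Bijective D.sumHom := by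
  refine (Function.bijective_iff_existsUnique _).2 fun a => ?_
  obtain ⟨c, hc, huniq⟩ := D.basis a
  exact ⟨c, hc.symm, fun c' hc' => huniq c' hc'.symm⟩

theorem isUnit_z (i : Fin r) : IsUnit (D.z i) := by
  rw [← isUnit_pow_iff (orderOf_pos (D.σ i)).ne', D.z_pow]
  exact (D.b i).isUnit.map D.ι

theorem isCrossed : IsCrossed (D.ι : K →+* Δ) D.σ D.z fun i => orderOf (D.σ i) where
  z_mem i x := D.z_mul_ι i x
  z_isUnit := D.isUnit_z
  surjective := D.σ_bijective.2
  exists_eq_sum a := (D.basis a).exists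
  eq_zero _ hc := D.sumHom_bijective.1 (hc.trans (map_zero D.sumHom).symm)

open Module

theorem finrank_eq : finrank F Δ =
    Fintype.card ((i : Fin r) → Fin (orderOf (D.σ i))) * finrank F K := by
  rw [← (LinearEquiv.ofBijective D.sumHom D.sumHom_bijective).finrank_eq,
    finrank_pi_fintype, Finset.sum_const, Finset.card_univ, smul_eq_mul]

theorem card_eq_finrank [IsGalois F K] :
    Fintype.card ((i : Fin r) → Fin (orderOf (D.σ i))) = finrank F K := by
  rw [← IsGalois.card_aut_eq_finrank, ← Nat.card_eq_fintype_card]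
  exact Nat.card_eq_of_bijective _ D.σ_bijective

instance nonempty_pi_fin : Nonempty ((i : Fin r) → Fin (orderOf (D.σ i))) :=
  ⟨fun i => ⟨0, orderOf_pos (D.σ i)⟩⟩

include D in
theorem finite : Module.Finite F Δ :=
  Module.Finite.equiv (LinearEquiv.ofBijective D.sumHom D.sumHom_bijective)

include D in
theorem finrank_pos : 0 < finrank F Δ := by
  rw [D.finrank_eq]
  exact Nat.mul_pos Fintype.card_pos Module.finrank_pos

variable {k K' : Type*} [Field k] [Algebra F k] [Field K'] [Algebra k K'] (e : k ⊗[F] K ≃ₐ[k] K')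

/-- The embedding of `K' ≃ k ⊗ K` into `k ⊗ Δ`. -/
noncomputable def baseChangeι : K' →ₐ[k] k ⊗[F] Δ :=
  (Algebra.TensorProduct.map (AlgHom.id k k) D.ι).comp (e.symm : K' →ₐ[k] k ⊗[F] K)

omit [FiniteDimensional F K] in
theorem baseChangeι_tmul (c : k) (x : K) : D.baseChangeι e (e (c ⊗ₜ x)) = c ⊗ₜ D.ι x := by
  simp [baseChangeι]

/-- The inclusion `K → K' ≃ k ⊗ K`. -/
noncomputable def baseChangeIncl : K →+* K' :=
  ((e : k ⊗[F] K ≃+* K') : k ⊗[F] K →+* K').comp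
    (Algebra.TensorProduct.includeRight (R := F) (A := k) (B := K) : K →+* k ⊗[F] K)

omit [FiniteDimensional F K] in
theorem baseChangeIncl_apply (x : K) : baseChangeIncl e x = e (1 ⊗ₜ x) := rfl

include D in
theorem nontrivial_baseChange : Nontrivial (k ⊗[F] Δ) := by
  have h1 := D.finrank_pos
  rw [← finrank_baseChange (R := k) (M' := Δ)] at h1
  exact Module.nontrivial_of_finrank_pos h1

omit [FiniteDimensional F K] in
theorem orderedMonomial_one_tmul (m : Fin r → ℕ) :
    orderedMonomial (fun i => (1 : k) ⊗ₜ[F] D.z i) m = 1 ⊗ₜ orderedMonomial D.z m :=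
  (map_orderedMonomial ((Algebra.TensorProduct.includeRight (R := F) (A := k) (B := Δ) :
    Δ →ₐ[F] k ⊗[F] Δ) : Δ →* k ⊗[F] Δ) _ _).symm

theorem isExtension_baseChange [IsGalois F K] :
    D.IsExtension (baseChangeIncl e) (D.baseChangeι e : K' →+* k ⊗[F] Δ)
      (fun i => baseChangeAut e (D.σ i)) fun i => (1 : k) ⊗ₜ[F] D.z i where
  crossed := by
    have hex : ∀ a : k ⊗[F] Δ, ∃ c : ((i : Fin r) → Fin (orderOf (D.σ i))) → K',
        a = ∑ m, D.baseChangeι e (c m) *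
          orderedMonomial (fun i => (1 : k) ⊗ₜ[F] D.z i) fun i => (m i : ℕ) := by
      intro a
      induction a with
      | zero => exact ⟨0, by simp⟩
      | add a b ha hb =>
        obtain ⟨c, rfl⟩ := ha
        obtain ⟨c', rfl⟩ := hb
        refine ⟨c + c', ?_⟩
        rw [← Finset.sum_add_distrib]
        exact Finset.sum_congr rfl fun m _ => by rw [Pi.add_apply, map_add, add_mul]
      | tmul x a =>
        obtain ⟨c, rfl⟩ := (D.basis a).exists
        refine ⟨fun m => e (x ⊗ₜ c m), ?_⟩
        rw [TensorProduct.tmul_sum]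
        refine Finset.sum_congr rfl fun m _ => ?_
        rw [baseChangeι_tmul, orderedMonomial_one_tmul, Algebra.TensorProduct.tmul_mul_tmul,
          mul_one]
    let T : (((i : Fin r) → Fin (orderOf (D.σ i))) → K') →ₗ[k] k ⊗[F] Δ :=
      { toFun := fun c => ∑ m, D.baseChangeι e (c m) *
          orderedMonomial (fun i => (1 : k) ⊗ₜ[F] D.z i) fun i => (m i : ℕ)
        map_add' := fun c c' => by
          rw [← Finset.sum_add_distrib]
          exact Finset.sum_congr rfl fun m _ => by rw [Pi.add_apply, map_add, add_mul]
        map_smul' := fun x c => by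
          rw [RingHom.id_apply, Finset.smul_sum]
          exact Finset.sum_congr rfl fun m _ => by rw [Pi.smul_apply, map_smul, smul_mul_assoc] }
    have hfin := D.finite
    have hfinK : FiniteDimensional k K' := Module.Finite.equiv e.toLinearEquiv
    -- Uniqueness of coordinates follows from their existence, because both sides have the same
    -- dimension over `k`.
    have hT : Function.Injective T := by
      refine (LinearMap.injective_iff_surjective_of_finrank_eq_finrank ?_).2 fun a => ?_
      · rw [finrank_pi_fintype, Finset.sum_const, Finset.card_univ, smul_eq_mul,
          finrank_of_tensorProduct_algEquiv e, finrank_baseChange, D.finrank_eq]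
      · obtain ⟨c, hc⟩ := hex a
        exact ⟨c, hc.symm⟩
    refine ⟨fun i κ => ?_, fun i => ?_, fun τ => ?_, hex, fun c hc => hT (hc.trans (map_zero T).symm)⟩
    · obtain ⟨κ, rfl⟩ := e.surjective κ
      change _ * D.baseChangeι e (e κ) = D.baseChangeι e (baseChangeAut e (D.σ i) (e κ)) * _
      induction κ with
      | zero => simp
      | add x y hx hy => simp only [map_add, mul_add, add_mul, hx, hy]
      | tmul c x =>
        rw [baseChangeAut_tmul, baseChangeι_tmul, baseChangeι_tmul,
          Algebra.TensorProduct.tmul_mul_tmul, Algebra.TensorProduct.tmul_mul_tmul, one_mul,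
          mul_one, D.z_mul_ι]
    · exact (D.isUnit_z i).map (Algebra.TensorProduct.includeRight (R := F) (A := k) (B := Δ))
    · obtain ⟨τ, rfl⟩ := (isGalois_of_tensorProduct_algEquiv e).2.2.2 τ
      obtain ⟨m, rfl⟩ := D.σ_bijective.2 τ
      exact ⟨m, (map_orderedMonomial (baseChangeAut e) _ _).symm⟩
  injective m m' h := by
    refine D.σ_bijective.1 (baseChangeAut_injective e ?_)
    refine (map_orderedMonomial (baseChangeAut e) _ _).trans (h.trans ?_)
    exact (map_orderedMonomial (baseChangeAut e) _ _).symm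
  map_σ i x := baseChangeAut_tmul e _ _ _
  z_mul_z i j := by
    change _ = D.baseChangeι e (e (1 ⊗ₜ (D.u i j : K))) * _
    rw [baseChangeι_tmul, Algebra.TensorProduct.tmul_mul_tmul,
      Algebra.TensorProduct.tmul_mul_tmul, Algebra.TensorProduct.tmul_mul_tmul, D.z_mul_z, one_mul, one_mul]
  z_pow i := by
    change _ = D.baseChangeι e (e (1 ⊗ₜ (D.b i : K)))
    rw [baseChangeι_tmul, Algebra.TensorProduct.tmul_pow, D.z_pow, one_pow]

/-- The scalar extension of a basis of `K/F` is a basis of `K'/k`. -/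
noncomputable def baseChangeBasis {J : Type*} (κ : Basis J F K) : Basis J k K' :=
  (κ.baseChange k).map e.toLinearEquiv

omit [FiniteDimensional F K] in
theorem baseChangeBasis_apply {J : Type*} (κ : Basis J F K) (j : J) :
    baseChangeBasis e κ j = baseChangeIncl e (κ j) := by
  rw [baseChangeBasis, Basis.map_apply, Basis.baseChange_apply]
  rfl

end AbelianCrossedProduct

/-! ### Norm equations and strong degeneracy. -/

section Twist

variable {k K' R : Type*} [Field k] [Field K'] [Algebra k K'] [Ring R] {ι : K' →+* R}

theorem map_mul_pow_of_mem_homComponent {s : K' ≃ₐ[k] K'} {d : R} (hd : d ∈ homComponent ι s)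
    (w : K') (n : ℕ) : (ι w * d) ^ n = ι (∏ j ∈ Finset.range n, (s ^ j) w) * d ^ n := by
  induction n with
  | zero => simp
  | succ n ih =>
    rw [pow_succ, ih, Finset.prod_range_succ, map_mul, mul_assoc, ← mul_assoc (d ^ n),
      pow_mem_homComponent hd n w, pow_succ]
    simp only [mul_assoc]

/-- Conjugation by `z` turns `d` into `w d`, so it turns `d ^ n` into the product of the `s ^ j (w)`
times `d ^ n`; on `K'` it acts as `σ`. -/
theorem apply_eq_prod_mul_of_mem_homComponent [Nontrivial R] {s σ : K' ≃ₐ[k] K'} {d z : R}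
    (hd : d ∈ homComponent ι s) (hz : z ∈ homComponent ι σ) (hzu : IsUnit z) {w : K'}
    (hw : z * d = ι w * d * z) {n : ℕ} {x : K'} (hx : d ^ n = ι x) :
    σ x = (∏ j ∈ Finset.range n, (s ^ j) w) * x := by
  have h1 : SemiconjBy z (d ^ n) ((ι w * d) ^ n) := SemiconjBy.pow_right hw n
  rw [map_mul_pow_of_mem_homComponent hd, hx, ← map_mul] at h1
  exact ι.injective (hzu.mul_right_cancel ((hz x).symm.trans h1))

/-- Hilbert's Theorem 90 for the cyclic group generated by an automorphism. -/
theorem exists_eq_apply_div_of_prod_eq_one {s : K' ≃ₐ[k] K'} {n : ℕ} (hs : orderOf s = n)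
    (hn : 0 < n) {w : K'} (hw : ∏ j ∈ Finset.range n, (s ^ j) w = 1) :
    ∃ y : K', y ≠ 0 ∧ w = s y / y := by
  let P : ℕ → K' := fun j => ∏ l ∈ Finset.range j, (s ^ l) w
  have hinj : Function.Injective fun j : Fin n =>
      ((s ^ (j : ℕ) : K' ≃ₐ[k] K') : K' →* K') := by
    intro i j hij
    have h1 : s ^ (i : ℕ) = s ^ (j : ℕ) := AlgEquiv.ext fun x => congrArg (fun f => f x) hij
    exact Fin.ext (pow_injOn_Iio_orderOf (by rw [hs]; exact i.2) (by rw [hs]; exact j.2) h1)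
  have hli := (linearIndependent_monoidHom K' K').comp _ hinj
  -- By Dedekind's independence of characters some resolvent `y` is nonzero. It satisfies `w * s y =
  -- y`, so its inverse is the solution.
  obtain ⟨θ, hθ⟩ : ∃ θ, ∑ j : Fin n, P j * (s ^ (j : ℕ)) θ ≠ 0 := by
    by_contra! h
    have h1 := Fintype.linearIndependent_iff.1 hli (fun j => P j) (by
      funext θ
      rw [Finset.sum_apply]
      exact h θ) ⟨0, hn⟩
    simp [P] at h1
  rw [Fin.sum_univ_eq_sum_range (fun j => P j * (s ^ j) θ) n] at hθ
  set y := ∑ j ∈ Finset.range n, P j * (s ^ j) θ with hy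
  have hP : ∀ j, w * s (P j) = P (j + 1) := by
    intro j
    simp only [P]
    rw [Finset.prod_range_succ', map_prod, mul_comm]
    refine congrArg₂ (· * ·) (Finset.prod_congr rfl fun l _ => ?_) rfl
    rw [pow_succ', AlgEquiv.mul_apply]
  have h1 : w * s y = y := by
    have h2 : w * s y = ∑ j ∈ Finset.range n, P (j + 1) * (s ^ (j + 1)) θ := by
      rw [hy, map_sum, Finset.mul_sum]
      refine Finset.sum_congr rfl fun j _ => ?_
      rw [map_mul, ← mul_assoc, hP, pow_succ', AlgEquiv.mul_apply]
    have h3 := Finset.sum_range_succ (fun j => P j * (s ^ j) θ) n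
    rw [Finset.sum_range_succ', ← h2, ← hy] at h3
    have h4 : P n * (s ^ n) θ = P 0 * (s ^ 0) θ := by
      have h5 : s ^ n = 1 := hs ▸ pow_orderOf_eq_one s
      have h6 : P n = 1 := hw
      rw [h5, h6]
      simp [P]
    rw [h4] at h3
    exact add_right_cancel h3
  refine ⟨y⁻¹, inv_ne_zero hθ, ?_⟩
  rw [map_inv₀, div_inv_eq_mul, ← div_eq_inv_mul, eq_div_iff ((map_ne_zero s).2 hθ)]
  exact h1

theorem exists_pow_apply_eq_mul (s : K' ≃ₐ[k] K') {u : K'} (hu : u ≠ 0) (j : ℕ) :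
    ∃ v : K', v ≠ 0 ∧ (s ^ j) u = u * (s v / v) := by
  induction j with
  | zero => exact ⟨1, one_ne_zero, by simp⟩
  | succ j ih =>
    obtain ⟨v, hv, h⟩ := ih
    have hsv : s v ≠ 0 := (map_ne_zero s).2 hv
    refine ⟨u * s v, mul_ne_zero hu hsv, ?_⟩
    rw [pow_succ', AlgEquiv.mul_apply, h, map_mul, map_mul, map_div₀]
    field_simp

/-- Each factor `s ^ j (u)` differs from `u` by a quotient `s v / v`, and such quotients are closed
under products. -/
theorem exists_prod_pow_apply_eq_mul (s : K' ≃ₐ[k] K') {u : K'} (hu : u ≠ 0) (n : ℕ) :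
    ∃ v : K', v ≠ 0 ∧ ∏ j ∈ Finset.range n, (s ^ j) u = u ^ n * (s v / v) := by
  induction n with
  | zero => exact ⟨1, one_ne_zero, by simp⟩
  | succ n ih =>
    obtain ⟨v, hv, h⟩ := ih
    obtain ⟨v', hv', h'⟩ := exists_pow_apply_eq_mul s hu n
    refine ⟨v * v', mul_ne_zero hv hv', ?_⟩
    rw [Finset.prod_range_succ, h, h', map_mul, pow_succ, mul_div_mul_comm]
    ring

/-- The tuples `(s(kᵢ) kᵢ⁻¹ σᵢ(l) l⁻¹)ᵢ`. -/
def degenerateSubgroup {r : ℕ} (s : K' ≃ₐ[k] K') (σ : Fin r → (K' ≃ₐ[k] K')) :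
    Subgroup (Fin r → K'ˣ) where
  carrier := {t | ∃ (l : K'ˣ) (κ : Fin r → K'ˣ), ∀ i, t i =
    Units.mapEquiv s.toMulEquiv (κ i) * (κ i)⁻¹ * (Units.mapEquiv (σ i).toMulEquiv l * l⁻¹)}
  one_mem' := ⟨1, 1, fun i => by simp⟩
  mul_mem' := by
    rintro a b ⟨l, κ, h⟩ ⟨l', κ', h'⟩
    refine ⟨l * l', κ * κ', fun i => ?_⟩
    rw [Pi.mul_apply, h, h', Pi.mul_apply, map_mul, map_mul, mul_inv, mul_inv]
    simp only [mul_comm, mul_left_comm, mul_assoc]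
  inv_mem' := by
    rintro a ⟨l, κ, h⟩
    refine ⟨l⁻¹, κ⁻¹, fun i => ?_⟩
    rw [Pi.inv_apply, h, Pi.inv_apply, map_inv, map_inv, mul_inv, mul_inv, mul_inv]

theorem mem_degenerateSubgroup_of {r : ℕ} {s : K' ≃ₐ[k] K'} {σ : Fin r → (K' ≃ₐ[k] K')}
    {t : Fin r → K'ˣ} {l : K'} (hl : l ≠ 0)
    (h : ∀ i, ∃ κ : K', κ ≠ 0 ∧ (t i : K') = s κ / κ * (σ i l / l)) :
    t ∈ degenerateSubgroup s σ := by
  choose κ hκ h using h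
  refine ⟨Units.mk0 l hl, fun i => Units.mk0 (κ i) (hκ i), fun i => Units.ext ?_⟩
  rw [h]
  simp only [Units.val_mul, Units.val_inv_eq_inv_val, Units.val_mk0, div_eq_mul_inv]
  rfl

theorem Subgroup.mem_of_pow_mem_of_coprime {G : Type*} [Group G] {H : Subgroup G} {x : G}
    {m n : ℕ} (h : m.Coprime n) (hm : x ^ m ∈ H) (hn : x ^ n ∈ H) : x ∈ H := by
  obtain ⟨a, b, hab⟩ := Nat.isCoprime_iff_coprime.2 h
  have : x = (x ^ m) ^ a * (x ^ n) ^ b := by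
    rw [← zpow_natCast, ← zpow_natCast, ← zpow_mul, ← zpow_mul, ← zpow_add, mul_comm (m : ℤ),
      mul_comm (n : ℤ), hab, zpow_one]
  rw [this]
  exact mul_mem (zpow_mem hm _) (zpow_mem hn _)

end Twist

section Norm

open Module AbelianCrossedProduct

variable {F : Type*} {K k K' : Type*} [Field F] [Field K] [Algebra F K] [FiniteDimensional F K]
  [Field k] [Algebra F k] [FiniteDimensional F k] [Field K'] [Algebra k K']
  (e : k ⊗[F] K ≃ₐ[k] K')

/-- The norm of `K'/K`. It brings relations over `K'` down to `K`, at the cost of raising elements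
of `K` to the power `[k : F]`. -/
theorem exists_norm_baseChange : ∃ N : K' →* K,
    (∀ x, N (baseChangeIncl e x) = x ^ finrank F k) ∧
    ∀ τ y, N (baseChangeAut e τ y) = τ (N y) := by
  let : Algebra K K' := (baseChangeIncl e).toAlgebra
  let : Algebra F K' := ((algebraMap k K').comp (algebraMap F k)).toAlgebra
  have : IsScalarTower F k K' := IsScalarTower.of_algebraMap_eq fun _ => rfl
  have : IsScalarTower F K K' := IsScalarTower.of_algebraMap_eq fun c => by
    change algebraMap k K' (algebraMap F k c) = e (1 ⊗ₜ algebraMap F K c)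
    rw [← Algebra.TensorProduct.tmul_one_eq_one_tmul, ← e.commutes]
    rfl
  have h1 : finrank K K' = finrank F k := by
    have h2 := finrank_mul_finrank F K K'
    rw [← finrank_mul_finrank F k K', finrank_of_tensorProduct_algEquiv e, mul_comm] at h2
    exact Nat.eq_of_mul_eq_mul_right finrank_pos h2
  refine ⟨Algebra.norm K, fun x => ?_, fun τ y => ?_⟩
  · rw [← h1]
    exact Algebra.norm_algebraMap (S := K') x
  · have h2 := Algebra.norm_eq_of_equiv_equiv (τ : K ≃+* K) (baseChangeAut e τ : K' ≃+* K')
      (RingHom.ext fun x => (baseChangeAut_tmul e τ 1 x).symm) y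
    rw [h2]
    exact ((τ : K ≃+* K).apply_symm_apply _).symm

end Norm

namespace AbelianCrossedProduct

open Module

variable {F : Type u} {K : Type v} {Δ : Type w} [Field F] [Field K] [Algebra F K] [Ring Δ]
  [Algebra F Δ] {r : ℕ} (D : AbelianCrossedProduct F K Δ r) [FiniteDimensional F K] [IsGalois F K]
  {k K' : Type*} [Field k] [Algebra F k] [FiniteDimensional F k] [Field K'] [Algebra k K']
  (e : k ⊗[F] K ≃ₐ[k] K')

/-- A bad element is `d = c z ^ m` with `s = σ ^ m` of order `p`. It yields degeneracy of the `[k :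
F]`-th power of the tuple `u`, while its `p`-th power is degenerate in any case; coprimality of the
exponents makes the tuple itself degenerate. -/
theorem noCentralPower_baseChange (hD : ¬ D.StronglyDegenerate) {p : ℕ} [hp : Fact p.Prime]
    (hk : (finrank F k).Coprime p) : NoCentralPower p k (D.baseChangeι e : K' →+* k ⊗[F] Δ) := by
  intro τ' hτ' d hd hd0 x hx
  have hR : Nontrivial (k ⊗[F] Δ) := D.nontrivial_baseChange
  have hΔ : Nontrivial Δ := Module.nontrivial_of_finrank_pos D.finrank_pos
  have hext := D.isExtension_baseChange e
  have hfinK : FiniteDimensional k K' := Module.Finite.equiv e.toLinearEquiv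
  obtain ⟨τ, rfl⟩ := (isGalois_of_tensorProduct_algEquiv e).2.2.2 τ'
  obtain ⟨m', rfl⟩ := D.σ_bijective.2 τ
  let m : Fin r → ℕ := fun i => (m' i : ℕ)
  let s := orderedMonomial D.σ m
  have hs : orderOf s = p := by
    rw [← orderOf_injective (baseChangeAut e) (baseChangeAut_injective e) s]
    exact hτ'
  have hmap : baseChangeAut e s = orderedMonomial (fun i => baseChangeAut e (D.σ i)) m :=
    map_orderedMonomial (baseChangeAut e) _ _
  obtain ⟨c, hc⟩ := hext.crossed.exists_eq_mul m' (hmap ▸ hd) hext.injective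
  have hc0 : c ≠ 0 := by
    rintro rfl
    rw [map_zero, zero_mul] at hc
    exact hd0 hc
  have hcom : ∀ i, ∃ u : K, D.z i * orderedMonomial D.z m =
      D.ι u * (orderedMonomial D.z m * D.z i) := fun i =>
    exists_mul_orderedMonomial_eq (ι := (D.ι : K →+* Δ)) D.isCrossed.z_mem
      (u := fun j => D.u i j) (fun j => D.z_mul_z i j) m
  choose u hu using hcom
  have hzm : IsUnit (orderedMonomial D.z m) := isUnit_orderedMonomial D.isUnit_z m
  have hu0 : ∀ i, u i ≠ 0 := by
    intro i h
    have h1 := hu i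
    rw [h, map_zero, zero_mul] at h1
    exact ((D.isUnit_z i).mul hzm).ne_zero h1
  obtain ⟨N, hN, hNτ⟩ := exists_norm_baseChange e
  have hN0 : N c ≠ 0 := ((isUnit_iff_ne_zero.2 hc0).map N).ne_zero
  -- Conjugation by `z_i` multiplies `d` by `w = σ_i(c) u_i c⁻¹`. As `d ^ p` is in `k` it is
  -- unchanged, so the product of the `s ^ j (w)` is `1`. Taking norms to `K` and then Hilbert 90
  -- for `s` solves for `u_i ^ [k : F]`, with `l` the inverse of the norm of `c`.
  have hpow_q : (fun i => Units.mk0 (u i) (hu0 i)) ^ finrank F k ∈ degenerateSubgroup s D.σ := by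
    refine mem_degenerateSubgroup_of (inv_ne_zero hN0) fun i => ?_
    have hw : ((1 : k) ⊗ₜ[F] D.z i) * d =
        D.baseChangeι e (baseChangeAut e (D.σ i) c * baseChangeIncl e (u i) * c⁻¹) * d *
          ((1 : k) ⊗ₜ[F] D.z i) := by
      have h1 : ((1 : k) ⊗ₜ[F] D.z i) * ((1 : k) ⊗ₜ[F] orderedMonomial D.z m) =
          D.baseChangeι e (baseChangeIncl e (u i)) *
            (((1 : k) ⊗ₜ[F] orderedMonomial D.z m) * ((1 : k) ⊗ₜ[F] D.z i)) := by
        rw [baseChangeIncl_apply, baseChangeι_tmul]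
        simp only [Algebra.TensorProduct.tmul_mul_tmul, hu, one_mul]
      have h2 := hext.crossed.z_mem i c
      have h3 : orderedMonomial (fun i => (1 : k) ⊗ₜ[F] D.z i) (fun i => (m' i : ℕ)) =
        1 ⊗ₜ orderedMonomial D.z m := D.orderedMonomial_one_tmul m
      rw [hc, h3, ← mul_assoc, h2, mul_assoc, h1]
      simp only [RingHom.coe_coe]
      rw [← mul_assoc (D.baseChangeι e _) (D.baseChangeι e c), ← map_mul,
        inv_mul_cancel_right₀ hc0, map_mul]
      simp only [mul_assoc]
    have h1 := apply_eq_prod_mul_of_mem_homComponent hd (hext.crossed.z_mem i)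
      (hext.crossed.z_isUnit i) hw hx
    have hx0 : algebraMap k K' x ≠ 0 := by
      intro h
      rw [h, map_zero] at hx
      exact (((hext.crossed.hasUnitComponents hext.injective).isUnit hd hd0).pow p).ne_zero hx
    rw [AlgEquiv.commutes] at h1
    have h2 := congrArg N (mul_right_cancel₀ hx0 ((one_mul _).trans h1))
    rw [map_one, map_prod] at h2
    have h3 : ∀ j ∈ Finset.range p, N ((baseChangeAut e s ^ j)
        (baseChangeAut e (D.σ i) c * baseChangeIncl e (u i) * c⁻¹)) =
        (s ^ j) (D.σ i (N c) * u i ^ finrank F k * (N c)⁻¹) := by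
      intro j _
      have h4 : N c⁻¹ = (N c)⁻¹ := eq_inv_of_mul_eq_one_left (by
        rw [← map_mul, inv_mul_cancel₀ hc0, map_one])
      rw [← map_pow, hNτ, map_mul N, map_mul N, hNτ, hN, h4]
    obtain ⟨y, hy0, hy⟩ := exists_eq_apply_div_of_prod_eq_one hs hp.out.pos
      ((Finset.prod_congr rfl h3).symm.trans h2.symm)
    refine ⟨y, hy0, ?_⟩
    rw [← hy, map_inv₀]
    have hσ0 : D.σ i (N c) ≠ 0 := (map_ne_zero _).2 hN0
    simp only [Pi.pow_apply, Units.val_pow_eq_pow_val, Units.val_mk0]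
    field_simp
  -- Here `(z ^ m) ^ p` is an element `ε` of `K`, and `σ_i(ε) / ε` is the product of the `s ^ j
  -- (u_i)`, which is `u_i ^ p` up to a quotient `s v / v`.
  have hpow_p : (fun i => Units.mk0 (u i) (hu0 i)) ^ p ∈ degenerateSubgroup s D.σ := by
    have hzs : orderedMonomial D.z m ∈ homComponent (D.ι : K →+* Δ) s :=
      orderedMonomial_mem_homComponent D.isCrossed.z_mem m
    have hzp := pow_mem_homComponent hzs p
    rw [show s ^ p = 1 from hs ▸ pow_orderOf_eq_one s] at hzp
    obtain ⟨ε, hε⟩ := (D.isCrossed.hasUnitComponents D.σ_bijective.1).exists_eq_map hzp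
    have hε0 : ε ≠ 0 := by
      rintro rfl
      rw [map_zero] at hε
      exact (hzm.pow p).ne_zero hε
    refine mem_degenerateSubgroup_of hε0 fun i => ?_
    have h1 := apply_eq_prod_mul_of_mem_homComponent hzs (D.isCrossed.z_mem i) (D.isUnit_z i)
      ((hu i).trans (mul_assoc _ _ _).symm) hε
    obtain ⟨v, hv0, hv⟩ := exists_prod_pow_apply_eq_mul s (hu0 i) p
    rw [hv] at h1
    refine ⟨v⁻¹, inv_ne_zero hv0, ?_⟩
    have hsv : s v ≠ 0 := (map_ne_zero s).2 hv0
    rw [h1, map_inv₀]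
    simp only [Pi.pow_apply, Units.val_pow_eq_pow_val, Units.val_mk0]
    field_simp
  obtain ⟨l, κ, h⟩ := Subgroup.mem_of_pow_mem_of_coprime hk hpow_q hpow_p
  refine hD ⟨m, hs.symm ▸ hp.out, l, κ, fun i => ?_⟩
  rw [← h i]
  change orderedMonomial D.z (Pi.single i 1) * orderedMonomial D.z m = D.ι (u i) *
    (orderedMonomial D.z m * orderedMonomial D.z (Pi.single i 1))
  rw [orderedMonomial_single, pow_one]
  exact hu i

end AbelianCrossedProduct

/-! ### Transfer to Galois subfields of the generic crossed product. -/

theorem finite_and_finrank_dvd_of_algHom {E L M : Type*} [Field E] [Field L] [Algebra E L] [Ring M]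
    [Nontrivial M] [Algebra E M] [Module.Finite E M] (φ : L →ₐ[E] M) :
    FiniteDimensional E L ∧ Module.finrank E L ∣ Module.finrank E M := by
  have hfin : FiniteDimensional E L :=
    Module.Finite.of_injective φ.toLinearMap (φ : L →+* M).injective
  let : Module L M := Module.compHom M (φ : L →+* M)
  have : IsScalarTower E L M := ⟨fun c l x => by
    change φ (c • l) * x = c • (φ l * x)
    rw [map_smul, smul_mul_assoc]⟩
  refine ⟨hfin, ?_⟩
  rw [← Module.finrank_mul_finrank E L M]
  exact dvd_mul_right _ _

/-- After cancelling the double base change the map is the scalar extension of `φ`, which stays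
injective because `Ω` is flat over `E`. -/
theorem exists_algHom_tensorProduct {E₀ E Ω L A : Type*} [Field E₀] [Field E] [Field Ω] [Field L]
    [Ring A] [Algebra E₀ E] [Algebra E Ω] [Algebra E₀ Ω] [IsScalarTower E₀ E Ω] [Algebra E L]
    [Algebra E₀ A] [Nontrivial A] (φ : L →ₐ[E] E ⊗[E₀] A) :
    ∃ Θ : Ω ⊗[E] L →ₐ[Ω] Ω ⊗[E₀] A, Function.Injective Θ := by
  let χ : E ⊗[E₀] A →ₐ[E] Ω ⊗[E₀] A :=
    Algebra.TensorProduct.map (Algebra.ofId E Ω) (AlgHom.id E₀ A)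
  let Θ : Ω ⊗[E] L →ₐ[Ω] Ω ⊗[E₀] A :=
    Algebra.TensorProduct.lift (Algebra.ofId Ω _) (χ.comp φ) fun x y => Algebra.commutes _ _
  let T := TensorProduct.AlgebraTensorModule.cancelBaseChange E₀ E Ω Ω A
  have h1 : ∀ (ω : Ω) (y : E ⊗[E₀] A), algebraMap Ω _ ω * χ y = T (ω ⊗ₜ y) := by
    intro ω y
    induction y with
    | zero => simp
    | add a b ha hb => rw [map_add, mul_add, ha, hb, TensorProduct.tmul_add, map_add]
    | tmul x a => simp [T, χ, Algebra.smul_def, mul_comm]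
  have h2 : ∀ x, Θ x = T (LinearMap.lTensor Ω φ.toLinearMap x) := by
    intro x
    induction x with
    | zero => simp
    | add a b ha hb => rw [map_add, map_add, map_add, ha, hb]
    | tmul ω l => exact (Algebra.TensorProduct.lift_tmul _ _ _ _ _).trans (h1 ω (φ l))
  have hnt : Nontrivial (E ⊗[E₀] A) := inferInstance
  refine ⟨Θ, fun x y hxy => ?_⟩
  rw [h2, h2] at hxy
  exact Module.Flat.lTensor_preserves_injective_linearMap (M := Ω) φ.toLinearMap
    (φ : L →+* E ⊗[E₀] A).injective (T.injective hxy)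

namespace HahnSeries

open Module

variable {k K' R : Type*} [Field k] [Field K'] [Algebra k K'] [Ring R] [Nontrivial R]
  [FiniteDimensional k K'] [IsGalois k K'] {ι : K' →+* R}
  {Γ : Type*} [AddCommGroup Γ] [LinearOrder Γ] [IsOrderedAddMonoid Γ]
  {g : Γ →+ Additive (K' ≃ₐ[k] K')}

/-- If `A` is an algebra over `E₀` whose scalar extension to `k((ker g))` is central and embeds into
`gradedSubring ι g`, then the Galois group of a Galois extension `L/E` contained in `E ⊗ A`, where
`E₀ ⊆ E ⊆ k((ker g))`, is a quotient of the Galois group of `K'/k`. -/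
theorem exists_surjective_of_algHom {p : ℕ} [hp : Fact p.Prime] [CharP k p]
    (hι : HasUnitComponents k ι) (hQ : IsPGroup p (K' ≃ₐ[k] K')) (hND : NoCentralPower p k ι)
    {E₀ E A L : Type*} [Field E₀] [Field E] [Ring A] [Field L] [Algebra E₀ E] [Algebra E₀ A]
    [Module.Finite E₀ A] {n : ℕ} (hn : finrank E₀ A = p ^ n)
    [Algebra E (HahnSeries g.ker k)] [Algebra E₀ (HahnSeries g.ker k)]
    [IsScalarTower E₀ E (HahnSeries g.ker k)]
    [Algebra (HahnSeries g.ker k) (gradedSubring ι g)]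
    (halg : ∀ ω, (algebraMap (HahnSeries g.ker k) (gradedSubring ι g) ω : HahnSeries Γ R) =
      centerHom ι g ω)
    (Ψ : HahnSeries g.ker k ⊗[E₀] A →ₐ[HahnSeries g.ker k] gradedSubring ι g)
    (hΨ : Function.Injective Ψ)
    (hcen : ∀ b : HahnSeries g.ker k ⊗[E₀] A, (∀ x, b * x = x * b) →
      ∃ ω, b = algebraMap (HahnSeries g.ker k) _ ω)
    [Algebra E L] [IsGalois E L] (φ : L →ₐ[E] E ⊗[E₀] A) :
    ∃ f : (K' ≃ₐ[k] K') →* (L ≃ₐ[E] L), Function.Surjective f := by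
  have hA : Nontrivial A := Module.nontrivial_of_finrank_pos (R := E₀) (by
    rw [hn]
    exact pow_pos hp.out.pos n)
  obtain ⟨hfinL, hdvd⟩ := finite_and_finrank_dvd_of_algHom φ
  rw [finrank_baseChange, hn] at hdvd
  obtain ⟨s, -, hs⟩ := (Nat.dvd_prime_pow hp.out).1 hdvd
  obtain ⟨Θ, hΘ⟩ := exists_algHom_tensorProduct (Ω := HahnSeries g.ker k) φ
  -- The algebra `Ω ⊗ L` sits in `Ω ⊗ A`, hence in the graded ring, so it is a finite-dimensional
  -- domain over `Ω = k((ker g))` and therefore a field.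
  have hB0 := noZeroDivisors_gradedSubring (g := g) hι
  have hB : NoZeroDivisors (HahnSeries g.ker k ⊗[E₀] A) :=
    hΨ.noZeroDivisors Ψ (map_zero Ψ) (map_mul Ψ)
  have hL : NoZeroDivisors (HahnSeries g.ker k ⊗[E] L) :=
    hΘ.noZeroDivisors Θ (map_zero Θ) (map_mul Θ)
  have hL' : IsDomain (HahnSeries g.ker k ⊗[E] L) := NoZeroDivisors.to_isDomain _
  obtain ⟨L', _, _, ⟨eL⟩⟩ := exists_field_algEquiv (HahnSeries g.ker k)
    (A := HahnSeries g.ker k ⊗[E] L)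
  obtain ⟨hfin', hgal', hbij⟩ := isGalois_of_tensorProduct_algEquiv eL
  let θ : L' →ₐ[HahnSeries g.ker k] HahnSeries g.ker k ⊗[E₀] A :=
    Θ.comp (eL.symm : L' →ₐ[HahnSeries g.ker k] HahnSeries g.ker k ⊗[E] L)
  have hθ : Function.Injective θ := hΘ.comp eL.symm.injective
  let ψ : GradedEmbedding ι g L' :=
    { toRingHom := (gradedSubring ι g).subtype.comp ((Ψ.comp θ : L' →ₐ[_] _) : L' →+* _)
      mem := fun a => (Ψ (θ a)).2
      comm := fun ω => by
        rw [← halg]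
        exact congrArg Subtype.val ((Ψ.comp θ).commutes ω)
      -- Conjugate elements of `L'` have the same minimal polynomial, so some nonzero `x`
      -- intertwines them. Orders add under multiplication, and the finite order of `x` cancels.
      orderTop_aut := fun h a => by
        change (Ψ (θ (h a)) : HahnSeries Γ R).orderTop = (Ψ (θ a) : HahnSeries Γ R).orderTop
        obtain ⟨x, hx0, hx⟩ := exists_ne_zero_mul_eq_mul hcen (a := θ a) (b := θ (h a)) (by
          rw [minpoly.algHom_eq θ hθ, minpoly.algHom_eq θ hθ, minpoly.algEquiv_eq])
        have h1 := congrArg (fun t => (Ψ t : HahnSeries Γ R).orderTop) hx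
        have h2 : ∀ y y', (Ψ (y * y') : HahnSeries Γ R).orderTop =
            (Ψ y : HahnSeries Γ R).orderTop + (Ψ y' : HahnSeries Γ R).orderTop := fun y y' => by
          rw [map_mul]
          exact orderTop_mul_of_mem hι (Ψ y).2 (Ψ y').2
        simp only [h2] at h1
        rw [add_comm] at h1
        refine (WithTop.add_left_inj ?_).1 h1
        intro h3
        refine hx0 (hΨ (Subtype.ext ?_))
        rw [map_zero]
        exact orderTop_eq_top.1 h3 }
  have hcard : Nat.card (L' ≃ₐ[HahnSeries g.ker k] L') = p ^ s := by
    rw [← Nat.card_eq_of_bijective _ hbij, IsGalois.card_aut_eq_finrank, hs]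
  obtain ⟨f, hf⟩ := ψ.exists_surjective hι hQ hND hcard
  let M := MulEquiv.ofBijective (baseChangeAut eL) hbij
  exact ⟨M.symm.toMonoidHom.comp f, M.symm.surjective.comp hf⟩

end HahnSeries

theorem exists_exponents_of_commute {G : Type*} [Group G] (hcomm : ∀ a b : G, a * b = b * a) (p : ℕ)
    [Fact p.Prime] (hG : IsPGroup p G) {r : ℕ} (σ : Fin r → G) (hσ : ∀ i, 0 < orderOf (σ i)) :
    ∃ (Λ : Type) (_ : AddCommGroup Λ) (_ : LinearOrder Λ) (_ : IsOrderedAddMonoid Λ)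
      (g : Λ →+ Additive G) (e : Fin r → Λ) (ε : Lex (Fin r → ℤ) →+ Λ), StrictMono ε ∧
      (∀ n, ε n ∈ g.ker) ∧ (∀ i, g (e i) = Additive.ofMul (σ i)) ∧
      (∀ i, ε (toLex (Pi.single i.rev 1)) = orderOf (σ i) • e i) ∧
      ∀ n : ℕ, n.Coprime p → ∀ γ ∈ g.ker, ∃ δ ∈ g.ker, n • δ = γ := by
  let : CommGroup G := { (inferInstance : Group G) with mul_comm := hcomm }
  obtain ⟨Λ, _, _, _, g, e, ε, h1, h2, h3, h4⟩ := exists_exponents p (A := Additive G) (fun a => by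
    obtain ⟨n, hn⟩ := hG a.toMul
    exact ⟨n, hn⟩) (fun i => Additive.ofMul (σ i)) (fun i => orderOf (σ i)) hσ
  refine ⟨Λ, inferInstance, inferInstance, inferInstance, g, e, ε, h1, fun n => ?_, h2, h3, h4⟩
  -- The exponent of `x_i` is `n_i • e i`, which `g` sends to `σ_i ^ n_i = 1`.
  have h5 : ∀ i (x : ℤ), ε (toLex (Pi.single i x)) ∈ g.ker := by
    intro i x
    have h6 := h3 i.rev
    rw [Fin.rev_rev] at h6
    have h7 : (toLex (Pi.single i x) : Lex (Fin r → ℤ)) = x • toLex (Pi.single i 1) := by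
      refine congrArg toLex (?_ : Pi.single (M := fun _ => ℤ) i x = x • Pi.single i 1)
      rw [← Pi.single_smul, smul_eq_mul, mul_one]
    rw [h7, map_zsmul]
    refine zsmul_mem ?_ x
    rw [h6, AddMonoidHom.mem_ker, map_nsmul, h2]
    exact pow_orderOf_eq_one (σ i.rev)
  have h6 : n = ∑ i, toLex (Pi.single i (ofLex n i)) :=
    (Finset.univ_sum_single (ofLex n)).symm
  rw [h6, map_sum]
  exact sum_mem fun i _ => h5 i _

section

open HahnSeries

theorem centerHom_laurentHom {F k K' R : Type*} [Field F] [Field k] [Field K'] [Algebra k K']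
    [Ring R] {ι : K' →+* R} {Γ : Type*} [AddCommGroup Γ] [LinearOrder Γ] [IsOrderedAddMonoid Γ]
    {g : Γ →+ Additive (K' ≃ₐ[k] K')} {r : ℕ} {ε : Lex (Fin r → ℤ) →+ Γ} (hε : StrictMono ε)
    {ε' : Lex (Fin r → ℤ) →+ g.ker} (hε' : StrictMono ε') (h : ∀ n, (ε' n : Γ) = ε n) (f : F →+* k)
    (x : IterLaurent r F) :
    centerHom ι g (laurentHom hε' f x) = laurentHom hε (ι.comp ((algebraMap k K').comp f)) x := by
  ext γ
  by_cases hγ : γ ∈ Set.range ε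
  · obtain ⟨n, rfl⟩ := hγ
    rw [coeff_laurentHom_of_mem, ← h, coeff_centerHom_of_mem, coeff_laurentHom_of_mem]
    rfl
  · rw [coeff_laurentHom_of_notMem hε _ _ hγ]
    by_cases hker : γ ∈ g.ker
    · rw [coeff_centerHom_of_mem _ ⟨γ, hker⟩, coeff_laurentHom_of_notMem, map_zero, map_zero]
      rintro ⟨n, hn⟩
      exact hγ ⟨n, (h n).symm.trans (congrArg Subtype.val hn)⟩
    · exact coeff_centerHom_of_notMem _ hker

open Module in
/-- A finite extension of degree prime to `p` of `F''` embeds into `k((S))`, where `k/F` is a finite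
extension of degree prime to `p`. -/
theorem exists_extension_iterLaurent {F : Type u} [Field F] {p : ℕ} [Fact p.Prime] [CharP F p]
    {r : ℕ} {E : Type*} [Field E] [Algebra (IterLaurent r F) E]
    [FiniteDimensional (IterLaurent r F) E] (hE : (finrank (IterLaurent r F) E).Coprime p)
    {Γ : Type*} [AddCommGroup Γ] [LinearOrder Γ] [IsOrderedAddMonoid Γ] {S : AddSubgroup Γ}
    (hS : ∀ n : ℕ, n.Coprime p → ∀ γ ∈ S, ∃ δ ∈ S, n • δ = γ) {ε : Lex (Fin r → ℤ) →+ Γ}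
    (hε : StrictMono ε) (hεS : ∀ n, ε n ∈ S) :
    ∃ (k : Type u) (_ : Field k) (_ : Algebra F k), FiniteDimensional F k ∧
      (finrank F k).Coprime p ∧ ∀ T : AddSubgroup Γ, S = T →
        ∃ (ε' : Lex (Fin r → ℤ) →+ T) (hε' : StrictMono ε') (J : E →+* HahnSeries T k),
          (∀ n, (ε' n : Γ) = ε n) ∧
          ∀ x, J (algebraMap (IterLaurent r F) E x) = laurentHom hε' (algebraMap F k) x := by
  let ε' : Lex (Fin r → ℤ) →+ S := ε.codRestrict S hεS
  have hε' : StrictMono ε' := fun a b h => hε h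
  obtain ⟨k, _, _, h1, h2, J, hJ⟩ := exists_extension_of_coprime (Γ := S) (p := p)
    (fun n hn γ => by
      obtain ⟨δ, hδ, h⟩ := hS n hn γ γ.2
      exact ⟨⟨δ, hδ⟩, Subtype.ext h⟩) F hE (laurentHom hε' (RingHom.id F))
  refine ⟨k, inferInstance, inferInstance, h1, h2, ?_⟩
  -- The subgroup `T` will be the kernel of a homomorphism to `Gal(K'/k)`, which can be formed only
  -- once `k` is known. It is equal to `S` but not by definition.
  rintro _ rfl
  refine ⟨ε', hε', J, fun _ => rfl, fun x => ?_⟩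
  refine (congrArg (fun f => f x) hJ).trans ?_
  exact mapRingHom_embDomainRingHom (algebraMap F k) ε' hε'.injective _ _

end

namespace AbelianCrossedProduct

variable {F : Type u} {K : Type v} {Δ : Type w} [Field F] [Field K] [Algebra F K] [Ring Δ]
  [Algebra F Δ] {r : ℕ} (D : AbelianCrossedProduct F K Δ r) [FiniteDimensional F K]

omit [FiniteDimensional F K] in
include D in
theorem mul_comm_aut (a b : K ≃ₐ[F] K) : a * b = b * a := by
  have h1 : ∀ i (m : Fin r → ℕ), Commute (D.σ i) (orderedMonomial D.σ m) := fun i m => by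
    refine Commute.list_prod_right _ _ fun x hx => ?_
    obtain ⟨j, rfl⟩ := List.mem_ofFn.1 hx
    exact (D.σ_commute i j).pow_right _
  obtain ⟨m, rfl⟩ := D.σ_bijective.2 a
  obtain ⟨m', rfl⟩ := D.σ_bijective.2 b
  refine (Commute.list_prod_left _ _ fun x hx => ?_ :
    Commute (orderedMonomial D.σ _) (orderedMonomial D.σ _))
  obtain ⟨j, rfl⟩ := List.mem_ofFn.1 hx
  exact (h1 j _).pow_left _

end AbelianCrossedProduct

namespace AbelianCrossedProduct

open HahnSeries Module

theorem exists_surjective_galois {F : Type u} {K : Type v} {Δ : Type w} [Field F] [Field K]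
    [Algebra F K] [FiniteDimensional F K] [IsGalois F K] [Ring Δ] [Algebra F Δ] {p : ℕ}
    [Fact p.Prime] [CharP F p] (hGp : IsPGroup p (K ≃ₐ[F] K)) {r : ℕ}
    (D : AbelianCrossedProduct F K Δ r) (hD : ¬ D.StronglyDegenerate) {E : Type*} [Field E]
    [Algebra (IterLaurent r F) E] [FiniteDimensional (IterLaurent r F) E]
    (hE : (finrank (IterLaurent r F) E).Coprime p) {L : Type*} [Field L] [Algebra E L]
    [IsGalois E L] (φ : L →ₐ[E] E ⊗[IterLaurent r F] D.PowerSeriesGeneric) :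
    ∃ f : (K ≃ₐ[F] K) →* (L ≃ₐ[E] L), Function.Surjective f := by
  obtain ⟨Γ, _, _, _, g₀, t, ε, hε, hεg, hg, hεt, hdiv⟩ :=
    exists_exponents_of_commute D.mul_comm_aut p hGp D.σ fun i => orderOf_pos _
  obtain ⟨k, _, _, hkfin, hk, hJ⟩ := exists_extension_iterLaurent hE hdiv hε hεg
  obtain ⟨n, hn⟩ := IsPGroup.iff_card.1 hGp
  rw [IsGalois.card_aut_eq_finrank] at hn
  obtain ⟨K', _, _, ⟨e⟩⟩ := exists_compositum_of_coprime (F := F) (k := k) (K := K) (by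
    rw [hn]
    exact hk.pow_right n)
  obtain ⟨hfinK, hgalK, hbij⟩ := isGalois_of_tensorProduct_algEquiv e
  -- The grading is transported along `Gal(K/F) ≃ Gal(K'/k)`, which leaves its kernel unchanged.
  let g : Γ →+ Additive (K' ≃ₐ[k] K') := (MonoidHom.toAdditive (baseChangeAut e)).comp g₀
  have hker : g₀.ker = g.ker := by
    ext γ
    rw [AddMonoidHom.mem_ker, AddMonoidHom.mem_ker]
    exact (map_eq_one_iff (baseChangeAut e) (baseChangeAut_injective e)
      (x := (g₀ γ).toMul)).symm
  obtain ⟨ε', hε', J, hεε', hJ⟩ := hJ g.ker hker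
  have hR := D.nontrivial_baseChange (k := k)
  have hext := D.isExtension_baseChange e
  let ι : K' →+* k ⊗[F] Δ := D.baseChangeι e
  let iE : Algebra E (HahnSeries g.ker k) := J.toAlgebra
  let iF : Algebra (IterLaurent r F) (HahnSeries g.ker k) :=
    (J.comp (algebraMap (IterLaurent r F) E)).toAlgebra
  have : IsScalarTower (IterLaurent r F) E (HahnSeries g.ker k) :=
    IsScalarTower.of_algebraMap_eq fun _ => rfl
  let iB : Algebra (HahnSeries g.ker k) (gradedSubring ι g) := gradedAlgebra ι g
  let iFB : Algebra (IterLaurent r F) (gradedSubring ι g) :=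
    Algebra.compHom _ (algebraMap (IterLaurent r F) (HahnSeries g.ker k))
  have : IsScalarTower (IterLaurent r F) (HahnSeries g.ker k) (gradedSubring ι g) :=
    IsScalarTower.of_algebraMap_eq fun _ => rfl
  let κ := Module.finBasis F K
  obtain ⟨hfin, hcard, Ψ, hΨ, hcen⟩ := D.exists_algHom_baseChange κ (baseChangeBasis e κ) hε hext
    (baseChangeBasis_apply e κ) (fun n => hker ▸ hεg n)
    (fun i => congrArg (MonoidHom.toAdditive (baseChangeAut e)) (hg i)) hεt (fun _ => rfl)
    (fun x => by
      refine (congrArg (centerHom ι g) (hJ x)).trans ?_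
      rw [centerHom_laurentHom hε hε' hεε']
      refine congrArg (fun f => laurentHom hε f x) (RingHom.ext fun c =>
        congrArg ι ?_)
      change algebraMap k K' (algebraMap F k c) = e (1 ⊗ₜ algebraMap F K c)
      rw [← Algebra.TensorProduct.tmul_one_eq_one_tmul, ← e.commutes]
      rfl)
  -- The dimension of `𝔸_Δ` is `[K : F]` squared, a power of `p`; this makes the degree of `L` a
  -- power of `p`.
  rw [Fintype.card_prod, Fintype.card_fin, D.card_eq_finrank, hn, ← _root_.pow_add] at hcard
  have : CharP k p := charP_of_injective_ringHom (algebraMap F k).injective p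
  let M := MulEquiv.ofBijective (baseChangeAut e) hbij
  obtain ⟨f, hf⟩ := exists_surjective_of_algHom
    (hext.crossed.hasUnitComponents hext.injective) (hGp.of_equiv M)
    (D.noCentralPower_baseChange e hD hk) hcard (fun _ => rfl) Ψ hΨ hcen φ
  exact ⟨f.comp M.toMonoidHom, hf.comp M.surjective⟩

end AbelianCrossedProduct

theorem corollary2p2
    {F K Δ : Type*} [Field F] [Field K] [Algebra F K] [FiniteDimensional F K] [IsGalois F K]
    [Ring Δ] [Algebra F Δ]
    (p : ℕ) [Fact p.Prime] [CharP F p]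
    (hGp : IsPGroup p (K ≃ₐ[F] K)) (hGcyc : ¬ IsCyclic (K ≃ₐ[F] K))
    {r : ℕ} (D : AbelianCrossedProduct F K Δ r) (hD : ¬ D.StronglyDegenerate)
    (E : Type*) [Field E] [Algebra (IterLaurent r F) E] [FiniteDimensional (IterLaurent r F) E]
    (hE : (Module.finrank (IterLaurent r F) E).Coprime p)
    (L : Type*) [Field L] [Algebra E L] [IsGalois E L]
    (φ : L →ₐ[E] E ⊗[IterLaurent r F] D.PowerSeriesGeneric) :
    ∃ f : (K ≃ₐ[F] K) →* (L ≃ₐ[E] L), Function.Surjective f := by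
  exact D.exists_surjective_galois hGp hD hE φ
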